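/- Let $p\neq\ell$ be primes, let $W=W_{\mathbb{Q}_p}$ be the Weil group of $\mathbb{Q}_p$, with wild inertia subgroup $P_{\mathbb{Q}_p}$, and let $|\cdot|_p : W\to\overline{\mathbb{Q}}_\ell^\times$ be the norm character (trivial on inertia, $p$ on lifts of the arithmetic Frobenius). For a $\overline{\mathbb{Q}}_\ell$-algebra $A$, an $L$-parameter for $\mathrm{GL}_n$ with coefficients in $A$ is a continuous homomorphism $W\to \mathrm{GL}_n(A)$, where $A$ is the colimit of its finitely generated $\mathbb{Z}_\ell$-submodules with their $\ell$-adic topologies. For an open subgroup $P$ of $P_{\mathbb{Q}_p}$, let $Z^1(W/P,\mathrm{GL}_n)=\operatorname{Spec} R_P$ be the affine $\overline{\mathbb{Q}}_\ell$-scheme whose $A$-points are the $L$-parameters with coefficients in $A$ that are trivial on $P$; the space $Z^1(W,\mathrm{GL}_n)$ is the union of these open and closed subschemes. $\mathrm{GL}_n$ acts by conjugation, and $\theta_P : [Z^1(W/P,\mathrm{GL}_n)/\mathrm{GL}_n]\to \operatorname{Spec}(R_P^{\mathrm{GL}_n})$ denotes the natural map to the categorical quotient. Let $\phi : W\to \mathrm{GL}_n(\overline{\mathbb{Q}}_\ell)$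 be an $L$-parameter with $\phi\simeq\phi_1\oplus\dots\oplus\phi_r$, where the $\phi_i$ are irreducible representations of $W$, and suppose that there are no $i\neq j$ with $\phi_i\simeq\phi_j$ or $\phi_i\simeq\phi_j\otimes|\cdot|_p$. Then: (1) every $L$-parameter $\phi' : W\to \mathrm{GL}_n(\overline{\mathbb{Q}}_\ell)$ whose semisimplification is isomorphic to $\phi$ is $\mathrm{GL}_n(\overline{\mathbb{Q}}_\ell)$-conjugate to $\phi$; (2) $\phi$ is trivial on some open subgroup $P$ of $P_{\mathbb{Q}_p}$, and for every such $P$ the scheme $Z^1(W/P,\mathrm{GL}_n)$ exists and, with $\overline{x}$ the point of $[Z^1(W/P,\mathrm{GL}_n)/\mathrm{GL}_n]$ defined by $\phi$ and $x=\theta_P(\overline{x})$: (a) for every algebraically closed field $K$ over $\overline{\mathbb{Q}}_\ell$, every $K$-point of $Z^1(W/P,\mathrm{GL}_n)$ lying over $x$ (that is, on which the elements of $R_P^{\mathrm{GL}_n}$ take the same values as on $\phi$) is $\mathrm{GL}_n(K)$-conjugate to $\phi$, and the underlying set of $\theta_P^{-1}(x)$ is $\{\overline{x}\}$; (b) $\overline{x}$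 is a closed point of $[Z^1(W/P,\mathrm{GL}_n)/\mathrm{GL}_n]$; (c) the stack $[Z^1(W/P,\mathrm{GL}_n)/\mathrm{GL}_n]$ is smooth over $\overline{\mathbb{Q}}_\ell$ at $\overline{x}$. -/

import Mathlib

open scoped MonoidAlgebra Topology

noncomputable section

/-! ## The Weil group of `ℚ_p` -/

namespace WeilGroup

variable (p : ℕ) [Fact p.Prime]

/-- The absolute Galois group of `ℚ_p`, with its Krull topology. -/
abbrev Gal : Type := PadicAlgCl p ≃ₐ[ℚ_[p]] PadicAlgCl p

/-- The valuation ring of the algebraic closure of `ℚ_p`. -/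
abbrev integers : ValuationSubring (PadicAlgCl p) :=
  (Valued.v : Valuation (PadicAlgCl p) NNReal).valuationSubring

/-- The residue field of the algebraic closure of `ℚ_p`, an algebraic closure of `𝔽_p`. -/
abbrev residueField : Type := IsLocalRing.ResidueField (integers p)

open scoped Pointwise in
theorem mem_decompositionSubgroup (g : Gal p) :
    g ∈ (integers p).decompositionSubgroup ℚ_[p] := by
  have key : ∀ (h : Gal p) (x : PadicAlgCl p), h x ∈ integers p ↔ x ∈ integers p := by
    intro h x
    have e : ‖h x‖ = ‖x‖ := by
      rw [← PadicAlgCl.spectralNorm_eq, ← PadicAlgCl.spectralNorm_eq]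
      exact (spectralNorm_eq_of_equiv h x).symm
    have e' : (Valued.v (h x) : NNReal) = Valued.v x := by
      rw [PadicAlgCl.valuation_def, PadicAlgCl.valuation_def]
      exact NNReal.eq e
    change (Valued.v (h x) : NNReal) ≤ 1 ↔ (Valued.v x : NNReal) ≤ 1
    rw [e']
  rw [MulAction.mem_stabilizer_iff]
  ext x
  rw [ValuationSubring.mem_pointwise_smul_iff_inv_smul_mem]
  exact key g⁻¹ x

/-- The action of the Galois group on the residue field. -/
def residueAction : Gal p →* RingAut (residueField p) :=
  (MulSemiringAction.toRingAut ((integers p).decompositionSubgroup ℚ_[p]) (residueField p)).comp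
    ((MonoidHom.id (Gal p)).codRestrict _ (mem_decompositionSubgroup p))

/-- `g` acts on the residue field as the `d`-th power of the arithmetic Frobenius `x ↦ x ^ p`,
that is `r(g) ∘ Frob ^ b = Frob ^ a` with `d = a - b`. -/
def ActsAsFrobPow (g : Gal p) (d : ℤ) : Prop :=
  ∃ a b : ℕ, d = (a : ℤ) - b ∧ ∀ x : residueField p, residueAction p g x ^ p ^ b = x ^ p ^ a

/-- The Weil group of `ℚ_p`, as the fibre product of the Galois group of `ℚ_p` and of
`Frob ^ ℤ` over the Galois group of the residue field. -/
def weil : Subgroup (Gal p × Multiplicative ℤ) where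
  carrier := {w | ActsAsFrobPow p w.1 w.2.toAdd}
  one_mem' := ⟨0, 0, by simp, by simp⟩
  mul_mem' := by
    rintro ⟨g, d⟩ ⟨g', d'⟩ ⟨a, b, hd, h⟩ ⟨a', b', hd', h'⟩
    dsimp only at hd hd' h h'
    refine ⟨a + a', b + b', ?_, fun x => ?_⟩
    · simp only [Prod.mk_mul_mk, toAdd_mul, hd, hd']
      push_cast
      ring
    · simp only [Prod.mk_mul_mk, map_mul, RingAut.mul_apply]
      rw [pow_add, pow_mul, h, pow_right_comm, h', ← pow_mul, ← pow_add, add_comm a' a]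
  inv_mem' := by
    rintro ⟨g, d⟩ ⟨a, b, hd, h⟩
    dsimp only at hd h
    refine ⟨b, a, ?_, fun x => ?_⟩
    · simp only [Prod.inv_mk, toAdd_inv, hd]
      ring
    · have := h ((residueAction p g)⁻¹ x)
      simp only [Prod.inv_mk, map_inv]
      rw [← this]
      congr 1
      exact RingEquiv.apply_symm_apply (residueAction p g) x

/-- The Weil group as a topological group: the subspace topology of `Gal × ℤ`, with `ℤ` discrete.
So inertia is open and carries the topology induced by the Galois group. -/
abbrev W : Type := weil p

/-- The power of the arithmetic Frobenius by which an element of the Weil group acts. -/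
def degree : W p →* Multiplicative ℤ :=
  (MonoidHom.snd (Gal p) (Multiplicative ℤ)).comp (weil p).subtype

/-- The wild inertia subgroup: the elements of inertia which moreover act trivially on
`x 𝒪ˣ / x (1 + 𝔪)` for every nonzero `x`, that is `g x / x ≡ 1` modulo the maximal ideal. -/
def wildInertia : Subgroup (W p) where
  carrier := {w | degree p w = 1 ∧ ∀ x : PadicAlgCl p, x ≠ 0 → ‖w.1.1 x - x‖ < ‖x‖}
  one_mem' := ⟨map_one _, fun x hx => by simpa using hx⟩
  mul_mem' := by
    rintro w w' ⟨h1, h2⟩ ⟨h1', h2'⟩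
    refine ⟨by rw [map_mul, h1, h1', one_mul], fun x hx => ?_⟩
    have hn : ∀ y : PadicAlgCl p, ‖w.1.1 y‖ = ‖y‖ := fun y => by
      rw [← PadicAlgCl.spectralNorm_eq, ← PadicAlgCl.spectralNorm_eq]
      exact (spectralNorm_eq_of_equiv w.1.1 y).symm
    have e : (w * w').1.1 x - x = w.1.1 (w'.1.1 x - x) + (w.1.1 x - x) := by
      rw [map_sub]
      change w.1.1 (w'.1.1 x) - x = _
      ring
    rw [e]
    refine (IsUltrametricDist.norm_add_le_max _ _).trans_lt (max_lt ?_ (h2 x hx))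
    rw [hn]
    exact h2' x hx
  inv_mem' := by
    rintro w ⟨h1, h2⟩
    refine ⟨by rw [map_inv, h1, inv_one], fun x hx => ?_⟩
    have hn : ∀ y : PadicAlgCl p, ‖w.1.1 y‖ = ‖y‖ := fun y => by
      rw [← PadicAlgCl.spectralNorm_eq, ← PadicAlgCl.spectralNorm_eq]
      exact (spectralNorm_eq_of_equiv w.1.1 y).symm
    have e : w.1.1 ((w⁻¹).1.1 x) = x := AlgEquiv.apply_symm_apply w.1.1 x
    rw [← hn, map_sub, e, ← norm_neg, neg_sub]
    exact h2 x hx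

/-- The norm character `|·|_p` with values in `ℚ̄_ℓˣ`; it is trivial on inertia and sends
a lift of the arithmetic Frobenius to `p`. -/
def normChar (ℓ : ℕ) [Fact ℓ.Prime] : W p →* (PadicAlgCl ℓ)ˣ :=
  (zpowersHom (PadicAlgCl ℓ)ˣ (Units.mk0 (p : PadicAlgCl ℓ)
    (Nat.cast_ne_zero.mpr (Fact.out : p.Prime).ne_zero))).comp (degree p)

end WeilGroup

/-! ## Twists and semisimplifications of representations -/

namespace Representation

variable {k G V V' : Type*} [Field k] [Group G] [AddCommGroup V] [Module k V]
  [AddCommGroup V'] [Module k V']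

/-- The twist `ρ ⊗ χ` of a representation by a character. -/
def charTwist (ρ : Representation k G V) (χ : G →* kˣ) : Representation k G V where
  toFun g := (χ g : k) • ρ g
  map_one' := by simp
  map_mul' g h := by
    rw [map_mul, map_mul, Units.val_mul, smul_mul_smul_comm]

/-- `σ` is a semisimplification of `ρ`: it is isomorphic to the direct sum of the successive
quotients of a composition series of `ρ`. -/
def IsSemisimplification (ρ : Representation k G V) (σ : Representation k G V') : Prop :=
  ∃ s : CompositionSeries (Submodule k[G] ρ.asModule), s.head = ⊥ ∧ s.last = ⊤ ∧
    Nonempty (σ.asModule ≃ₗ[k[G]]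
      ((i : Fin s.length) → (s i.succ) ⧸ (s i.castSucc).submoduleOf (s i.succ)))

end Representation

/-! ## L-parameters for `GL_n` and their moduli -/

namespace LParameter

open WeilGroup

variable {p ℓ : ℕ} [Fact p.Prime] [Fact ℓ.Prime]

/-- Continuity of a map to a `ℚ̄_ℓ`-algebra `A`, where `A` is the colimit of its finitely generated
`ℤ_ℓ`-submodules with their `ℓ`-adic topologies: locally the map has values in some
`ℤ_ℓ a₁ + ⋯ + ℤ_ℓ a_m`, with coordinates that depend continuously on the argument. -/
def IsContinuousMap {T A : Type*} [TopologicalSpace T] [CommRing A] [Algebra (PadicAlgCl ℓ) A]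
    (f : T → A) : Prop :=
  ∀ t : T, ∃ U ∈ 𝓝 t, ∃ (m : ℕ) (a : Fin m → A) (c : Fin m → T → ℤ_[ℓ]),
    (∀ i, ContinuousOn (c i) U) ∧
    ∀ u ∈ U, f u = ∑ i, algebraMap (PadicAlgCl ℓ) A (algebraMap ℤ_[ℓ] (PadicAlgCl ℓ) (c i u)) * a i

/-- An L-parameter for `GL_n` with coefficients in `A`: a continuous homomorphism. -/
def IsLParameter {n : ℕ} {A : Type*} [CommRing A] [Algebra (PadicAlgCl ℓ) A]
    (φ : W p →* GL (Fin n) A) : Prop :=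
  ∀ i j : Fin n, IsContinuousMap (ℓ := ℓ) fun w => (φ w : Matrix (Fin n) (Fin n) A) i j

/-- The representation on column vectors attached to a homomorphism to `GL_n`. -/
def toRep {n : ℕ} {K G : Type*} [Field K] [Group G] (φ : G →* GL (Fin n) K) :
    Representation K G (Fin n → K) where
  toFun g := Matrix.toLin' (φ g : Matrix (Fin n) (Fin n) K)
  map_one' := by rw [map_one, Units.val_one, Matrix.toLin'_one]; rfl
  map_mul' g h := by rw [map_mul, Units.val_mul, Matrix.toLin'_mul]; rfl

variable (ℓ) in
/-- The affine scheme `Z¹(W/P, GL_n) = Spec R` over `ℚ̄_ℓ`, with the universal L-parameter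
over `R` that is trivial on `P`: its points in a `ℚ̄_ℓ`-algebra `A` are the
L-parameters with coefficients in `A` that are trivial on `P`. -/
structure ModuliSpace (n : ℕ) (P : Subgroup (W p)) where
  R : Type
  [commRing : CommRing R]
  [algebra : Algebra (PadicAlgCl ℓ) R]
  univ : W p →* GL (Fin n) R
  isLParameter : IsLParameter (ℓ := ℓ) univ
  trivial_on : ∀ w ∈ P, univ w = 1
  existsUnique : ∀ (A : Type) [CommRing A] [Algebra (PadicAlgCl ℓ) A] (φ : W p →* GL (Fin n) A),
    IsLParameter (ℓ := ℓ) φ → (∀ w ∈ P, φ w = 1) →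
    ∃! f : R →ₐ[PadicAlgCl ℓ] A,
      ∀ w, Matrix.GeneralLinearGroup.map (f : R →+* A) (univ w) = φ w

attribute [instance] ModuliSpace.commRing ModuliSpace.algebra

namespace ModuliSpace

variable {n : ℕ} {P : Subgroup (W p)} (X : ModuliSpace ℓ n P)

/-- The homomorphism to `GL_n(A)` attached to an `A`-point. -/
def param {A : Type} [CommRing A] [Algebra (PadicAlgCl ℓ) A] (f : X.R →ₐ[PadicAlgCl ℓ] A) :
    W p →* GL (Fin n) A :=
  (Matrix.GeneralLinearGroup.map (f : X.R →+* A)).comp X.univ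

/-- The `A`-point of the moduli space attached to an L-parameter over `A`. -/
def point {A : Type} [CommRing A] [Algebra (PadicAlgCl ℓ) A] (φ : W p →* GL (Fin n) A)
    (hφ : IsLParameter (ℓ := ℓ) φ) (hP : ∀ w ∈ P, φ w = 1) : X.R →ₐ[PadicAlgCl ℓ] A :=
  (X.existsUnique A φ hφ hP).choose

/-- Two `A`-points are conjugate under `GL_n(A)`. -/
def Conj {A : Type} [CommRing A] [Algebra (PadicAlgCl ℓ) A] (f f' : X.R →ₐ[PadicAlgCl ℓ] A) :
    Prop :=
  ∃ g : GL (Fin n) A, ∀ w, X.param f' w = g * X.param f w * g⁻¹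

/-- The point of `Spec R` underlying a field-valued point. -/
def specPoint {K : Type} [Field K] [Algebra (PadicAlgCl ℓ) K] (f : X.R →ₐ[PadicAlgCl ℓ] K) :
    PrimeSpectrum X.R :=
  ⟨RingHom.ker f, RingHom.ker_isPrime f⟩

/-- Two points of `Spec R` underlie the same point of the quotient stack: they carry field-valued
points which, over some common field, are conjugate under `GL_n`. -/
def StackRel (z z' : PrimeSpectrum X.R) : Prop :=
  ∃ (K : Type) (_ : Field K) (_ : Algebra (PadicAlgCl ℓ) K) (f f' : X.R →ₐ[PadicAlgCl ℓ] K),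
    X.Conj f f' ∧ X.specPoint f = z ∧ X.specPoint f' = z'

/-- The underlying topological space of the quotient stack `[Spec R / GL_n]`, with the quotient
topology. -/
def Stack : Type := Quot X.StackRel

instance : TopologicalSpace X.Stack := inferInstanceAs (TopologicalSpace (Quot X.StackRel))

/-- The ring of `GL_n`-invariant functions on `Spec R`. -/
def invariants : Subalgebra (PadicAlgCl ℓ) X.R where
  carrier := {a | ∀ (A : Type) [CommRing A] [Algebra (PadicAlgCl ℓ) A]
    (f f' : X.R →ₐ[PadicAlgCl ℓ] A), X.Conj f f' → f a = f' a}
  mul_mem' := fun {a b} ha hb A _ _ f f' h => by rw [map_mul, map_mul, ha A f f' h, hb A f f' h]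
  add_mem' := fun {a b} ha hb A _ _ f f' h => by rw [map_add, map_add, ha A f f' h, hb A f f' h]
  algebraMap_mem' := fun c A _ _ f f' _ => by rw [AlgHom.commutes, AlgHom.commutes]

/-- The underlying space of the categorical quotient `Spec R // GL_n = Spec (R ^ GL_n)`. -/
abbrev Coarse : Type := PrimeSpectrum X.invariants

/-- The map `θ` from the quotient stack to the categorical quotient, on points. -/
def theta : X.Stack → X.Coarse :=
  Quot.lift (PrimeSpectrum.comap X.invariants.val.toRingHom) (by
    rintro z z' ⟨K, _, _, f, f', h, rfl, rfl⟩
    ext a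
    change f a.1 = 0 ↔ f' a.1 = 0
    rw [a.2 K f f' h])

/-- The point of the stack defined by a field-valued point. -/
def stackPoint {K : Type} [Field K] [Algebra (PadicAlgCl ℓ) K] (f : X.R →ₐ[PadicAlgCl ℓ] K) :
    X.Stack :=
  Quot.mk _ (X.specPoint f)

/-- The quotient stack is smooth over `ℚ̄_ℓ` at a point: the smooth atlas `Spec R` is smooth over
`ℚ̄_ℓ` on an open neighbourhood of a point above it. -/
def SmoothAt (y : X.Stack) : Prop :=
  ∃ z : PrimeSpectrum X.R, Quot.mk X.StackRel z = y ∧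
    ∃ a : X.R, a ∉ z.asIdeal ∧ Algebra.Smooth (PadicAlgCl ℓ) (Localization.Away a)

end ModuliSpace

end LParameter

end

/-! The obstruction to every assertion is monodromy. Wild inertia is pro-`p` and tame inertia is
procyclic, with Frobenius acting on it as the `p`-th power. Hence there are an open subgroup `J` of
inertia, an element `x₀` and an exponent map `z : J → ℤ_ℓ`, the same for all coefficient rings, such
that every parameter `ρ` trivial on `P` has `ρ(x₀)` unipotent and `ρ(x) = ρ(x₀) ^ z(x)` on `J`
(`nonempty_monodromyData`). These data give an explicit presentation of the moduli space. The
logarithm `N` of `ρ(x₀)` satisfies `ρ(w) N = |w| N ρ(w)`.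

The constituents `φ_i` and their twists `φ_i ⊗ |·|` are pairwise non-isomorphic: the hypotheses say
so for distinct indices, and determinants separate `φ_i` from its own twist. So by the density
theorem some `b` in the group algebra acts as `1` on `φ` and as `0` on `φ ⊗ |·|`. For arbitrary `ρ`,
let `f` be the characteristic polynomial of the action of `b` on `ρ ⊗ |·|`. By Cayley–Hamilton
`f(ρ(b)) N = 0`, so the invariant function `det f(ρ(b))` (`resultantDet`) kills `N`, and its value
at `φ` is `1`. Wherever it is invertible, `N = 0` and `J` acts trivially.

Smoothness: on that open set parameters have finite inertial image. They lift along square-zero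
thickenings, because finite groups have no higher cohomology in characteristic zero and the quotient
of `W` by inertia is the free group `ℤ` (`smooth_away`).

Fibre: once `J` acts trivially, the existence of a nonzero map `φ_i → ρ` is the vanishing of one
invariant determinant (`exists_intertwiner_iff`). A point with the same invariants as `φ` thus
receives nonzero maps from all `φ_i`, and these assemble to an isomorphism with `φ`
(`exists_conj_of_intertwiners`). The fibre is therefore one point, closed as the preimage of a
closed point.

Semisimplification: the invariants used are built from determinants of matrices over the group
algebra, which only depend on the Jordan–Hölder constituents. The same criterion therefore gives
(1). -/

noncomputable section

/-! ### Residues, tame characters and the tame relation -/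

namespace WeilGroup

variable (p : ℕ) [Fact p.Prime]

variable {p} in
theorem norm_gal_apply (g : Gal p) (x : PadicAlgCl p) : ‖g x‖ = ‖x‖ := by
  rw [← PadicAlgCl.spectralNorm_eq, ← PadicAlgCl.spectralNorm_eq]
  exact (spectralNorm_eq_of_equiv g x).symm

variable {p} in
theorem mem_integers_iff (x : PadicAlgCl p) : x ∈ integers p ↔ ‖x‖ ≤ 1 := by
  change (Valued.v x : NNReal) ≤ 1 ↔ _
  rw [PadicAlgCl.valuation_def]
  exact Iff.rfl

/-- The residue class of an element of the algebraic closure, with junk value zero outside the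
valuation ring. -/
def res (x : PadicAlgCl p) : residueField p :=
  open Classical in if h : x ∈ integers p then IsLocalRing.residue (integers p) ⟨x, h⟩ else 0

variable {p}

theorem res_of_mem {x : PadicAlgCl p} (h : x ∈ integers p) :
    res p x = IsLocalRing.residue (integers p) ⟨x, h⟩ := dif_pos h

theorem res_mul {x y : PadicAlgCl p} (hx : ‖x‖ ≤ 1) (hy : ‖y‖ ≤ 1) :
    res p (x * y) = res p x * res p y := by
  rw [← mem_integers_iff] at hx hy
  rw [res_of_mem hx, res_of_mem hy, res_of_mem (mul_mem hx hy), ← map_mul]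
  rfl

theorem res_sub {x y : PadicAlgCl p} (hx : ‖x‖ ≤ 1) (hy : ‖y‖ ≤ 1) :
    res p (x - y) = res p x - res p y := by
  rw [← mem_integers_iff] at hx hy
  rw [res_of_mem hx, res_of_mem hy, res_of_mem (sub_mem hx hy), ← map_sub]
  rfl

theorem res_one : res p (1 : PadicAlgCl p) = 1 := by
  rw [res_of_mem (one_mem _)]
  exact map_one (IsLocalRing.residue (integers p))

theorem res_eq_zero_iff {x : PadicAlgCl p} (hx : ‖x‖ ≤ 1) : res p x = 0 ↔ ‖x‖ < 1 := by
  rw [← mem_integers_iff] at hx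
  rw [res_of_mem hx, IsLocalRing.residue_eq_zero_iff, ValuationSubring.valuation_lt_one_iff]
  have : ∀ y : PadicAlgCl p, (integers p).valuation y < 1 ↔ ‖y‖ < 1 := by
    intro y
    have h := (Valuation.isEquiv_valuation_valuationSubring
      (Valued.v : Valuation (PadicAlgCl p) NNReal)).lt_one_iff_lt_one (x := y)
    rw [← h, PadicAlgCl.valuation_def]
    exact Iff.rfl
  exact this x

theorem res_eq_iff {x y : PadicAlgCl p} (hx : ‖x‖ ≤ 1) (hy : ‖y‖ ≤ 1) :
    res p x = res p y ↔ ‖x - y‖ < 1 := by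
  have h : ‖x - y‖ ≤ 1 := by
    rw [sub_eq_add_neg]
    exact (IsUltrametricDist.norm_add_le_max x (-y)).trans (max_le hx (by rwa [norm_neg]))
  rw [← sub_eq_zero, ← res_sub hx hy, res_eq_zero_iff h]

theorem exists_res (y : residueField p) : ∃ x : PadicAlgCl p, ‖x‖ ≤ 1 ∧ res p x = y := by
  obtain ⟨⟨x, hx⟩, rfl⟩ := IsLocalRing.residue_surjective y
  exact ⟨x, (mem_integers_iff x).1 hx, res_of_mem hx⟩

theorem residueAction_res (g : Gal p) {x : PadicAlgCl p} (hx : ‖x‖ ≤ 1) :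
    residueAction p g (res p x) = res p (g x) := by
  have hgx : ‖g x‖ ≤ 1 := by rwa [norm_gal_apply]
  rw [← mem_integers_iff] at hx hgx
  rw [res_of_mem hx, res_of_mem hgx]
  rfl

instance : CharP (residueField p) p := by
  refine (CharP.charP_iff_prime_eq_zero (Fact.out : p.Prime)).2 ?_
  have h : ‖((p : ℕ) : PadicAlgCl p)‖ < 1 := by
    rw [← map_natCast (algebraMap ℚ_[p] (PadicAlgCl p)), PadicAlgCl.norm_extends]
    exact Padic.norm_p_lt_one
  have h2 := (res_eq_zero_iff h.le).2 h
  rw [res_of_mem ((mem_integers_iff _).2 h.le)] at h2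
  rw [← h2, ← map_natCast (IsLocalRing.residue (integers p))]
  congr 1

/-- The factor `Frob ^ b` can be cancelled since Frobenius is injective on a field. -/
theorem ActsAsFrobPow.eq_pow {g : Gal p} {n : ℕ} (h : ActsAsFrobPow p g n) (x : residueField p) :
    residueAction p g x = x ^ p ^ n := by
  obtain ⟨a, b, hd, h⟩ := h
  have ha : a = n + b := by omega
  have := h x
  rw [ha, pow_add, pow_mul] at this
  exact iterateFrobenius_inj (residueField p) p b (by simpa [iterateFrobenius_def] using this)

theorem res_apply_of_frob {g : Gal p} {n : ℕ} (h : ActsAsFrobPow p g n) {x : PadicAlgCl p}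
    (hx : ‖x‖ ≤ 1) : res p (g x) = res p x ^ p ^ n := by
  rw [← residueAction_res g hx, h.eq_pow]

variable (p) in
/-- The inertia subgroup of the Weil group. -/
def inertia : Subgroup (W p) := (degree p).ker

theorem mem_inertia {w : W p} : w ∈ inertia p ↔ degree p w = 1 := Iff.rfl

instance : (inertia p).Normal := MonoidHom.normal_ker _

theorem actsAsFrobPow_of_degree {w : W p} {n : ℤ} (h : degree p w = Multiplicative.ofAdd n) :
    ActsAsFrobPow p w.1.1 n := by
  have h1 : w.1.2 = Multiplicative.ofAdd n := h
  have := w.2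
  change ActsAsFrobPow p w.1.1 w.1.2.toAdd at this
  rwa [h1] at this

theorem res_apply_inertia {w : W p} (h : w ∈ inertia p) {x : PadicAlgCl p} (hx : ‖x‖ ≤ 1) :
    res p (w.1.1 x) = res p x := by
  have := res_apply_of_frob (n := 0) (actsAsFrobPow_of_degree (n := 0) h) hx
  simpa using this

/-- The ratio `g x / x` modulo the maximal ideal. -/
def chi (g : Gal p) (x : PadicAlgCl p) : residueField p := res p (g x / x)

theorem norm_ratio (g : Gal p) {x : PadicAlgCl p} (hx : x ≠ 0) : ‖g x / x‖ = 1 := by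
  rw [norm_div, norm_gal_apply, div_self (norm_ne_zero_iff.2 hx)]

theorem chi_ne_zero (g : Gal p) {x : PadicAlgCl p} (hx : x ≠ 0) : chi g x ≠ 0 := by
  rw [chi, Ne, res_eq_zero_iff (norm_ratio g hx).le, norm_ratio g hx]
  exact lt_irrefl _

theorem chi_mul_right (g : Gal p) {x y : PadicAlgCl p} (hx : x ≠ 0) (hy : y ≠ 0) :
    chi g (x * y) = chi g x * chi g y := by
  rw [chi, chi, chi, ← res_mul (norm_ratio g hx).le (norm_ratio g hy).le, map_mul,
    div_mul_div_comm]

theorem chi_one_right (g : Gal p) : chi g 1 = 1 := by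
  rw [chi, map_one, div_one, res_one]

theorem chi_pow_right (g : Gal p) {x : PadicAlgCl p} (hx : x ≠ 0) (n : ℕ) :
    chi g (x ^ n) = chi g x ^ n := by
  induction n with
  | zero => simp [chi_one_right]
  | succ n ih => rw [pow_succ, chi_mul_right g (pow_ne_zero _ hx) hx, ih, pow_succ]

theorem chi_eq_one_iff (g : Gal p) {x : PadicAlgCl p} (hx : x ≠ 0) :
    chi g x = 1 ↔ ‖g x - x‖ < ‖x‖ := by
  rw [chi, ← res_one, res_eq_iff (norm_ratio g hx).le (by simp), div_sub_one hx, norm_div,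
    div_lt_one (norm_pos_iff.2 hx)]

theorem chi_of_norm_one {w : W p} (h : w ∈ inertia p) {x : PadicAlgCl p} (hx : ‖x‖ = 1) :
    chi w.1.1 x = 1 := by
  have hx0 : x ≠ 0 := by rintro rfl; simp at hx
  rw [chi_eq_one_iff _ hx0, hx, ← res_eq_iff (by rw [norm_gal_apply, hx]) hx.le,
    res_apply_inertia h hx.le]

/-- Inertia acts trivially on residues of units such as `x / y`, so for inertia `chi` only sees the
valuation of `x`. -/
theorem chi_congr {w : W p} (h : w ∈ inertia p) {x y : PadicAlgCl p} (hx : x ≠ 0) (hy : y ≠ 0)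
    (hxy : ‖x‖ = ‖y‖) : chi w.1.1 x = chi w.1.1 y := by
  have h1 : ‖x / y‖ = 1 := by rw [norm_div, hxy, div_self (norm_ne_zero_iff.2 hy)]
  have := chi_mul_right w.1.1 (div_ne_zero hx hy) hy
  rw [div_mul_cancel₀ _ hy, chi_of_norm_one h h1, one_mul] at this
  exact this

/-- In general `chi` is only a cocycle in the group element; it becomes a character because the
first factor acts trivially on residues. -/
theorem chi_mul_left {w w' : W p} (h : w ∈ inertia p) {x : PadicAlgCl p} (hx : x ≠ 0) :
    chi (w * w').1.1 x = chi w.1.1 x * chi w'.1.1 x := by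
  have h1 : (w * w').1.1 x = w.1.1 (w'.1.1 x) := rfl
  have e : (w * w').1.1 x / x = (w.1.1 x / x) * w.1.1 (w'.1.1 x / x) := by
    have : w.1.1 x ≠ 0 := by simpa using hx
    rw [h1, map_div₀]
    field_simp
  rw [chi, e, res_mul (norm_ratio _ hx).le (by rw [norm_gal_apply, norm_ratio _ hx]),
    res_apply_inertia h (norm_ratio _ hx).le]
  rfl

/-- With `y = w⁻¹ x`, the ratio for the conjugate is `w (g y / y)`. Here `w` acts on residues as
`Frob ^ n`, and `y` may be replaced by `x` because both have the same norm. -/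
theorem chi_conj {w g : W p} {n : ℕ} (hw : degree p w = Multiplicative.ofAdd (n : ℤ))
    (hg : g ∈ inertia p) {x : PadicAlgCl p} (hx : x ≠ 0) :
    chi (w * g * w⁻¹).1.1 x = chi g.1.1 x ^ p ^ n := by
  set y := (w⁻¹).1.1 x with hy
  have hwy : w.1.1 y = x := AlgEquiv.apply_symm_apply w.1.1 x
  have hy0 : y ≠ 0 := by rintro h0; rw [h0, map_zero] at hwy; exact hx hwy.symm
  have h1 : (w * g * w⁻¹).1.1 x = w.1.1 (g.1.1 y) := rfl
  have e : (w * g * w⁻¹).1.1 x / x = w.1.1 (g.1.1 y / y) := by rw [h1, map_div₀, hwy]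
  rw [chi, e, res_apply_of_frob (actsAsFrobPow_of_degree hw) (norm_ratio _ hy0).le]
  change chi g.1.1 y ^ p ^ n = _
  rw [chi_congr hg hy0 hx (norm_gal_apply _ _)]

theorem mem_wildInertia_iff {w : W p} : w ∈ wildInertia p ↔
    w ∈ inertia p ∧ ∀ x : PadicAlgCl p, x ≠ 0 → chi w.1.1 x = 1 :=
  and_congr_right fun _ => forall₂_congr fun _ hx => (chi_eq_one_iff _ hx).symm

theorem wildInertia_le_inertia : wildInertia p ≤ inertia p := fun _ h => h.1

variable (p) in
/-- A compatible system of roots of the uniformizer: `π_k ^ (k !) = p`. -/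
def unifRoot : ℕ → PadicAlgCl p
  | 0 => p
  | k + 1 => (IsAlgClosed.exists_pow_nat_eq (unifRoot k) k.succ_pos).choose

theorem unifRoot_succ_pow (k : ℕ) : unifRoot p (k + 1) ^ (k + 1) = unifRoot p k :=
  (IsAlgClosed.exists_pow_nat_eq (unifRoot p k) k.succ_pos).choose_spec

theorem unifRoot_pow_factorial (k : ℕ) : unifRoot p k ^ k.factorial = p := by
  induction k with
  | zero => simp [unifRoot]
  | succ k ih => rw [Nat.factorial_succ, pow_mul, unifRoot_succ_pow, ih]

theorem unifRoot_ne_zero (k : ℕ) : unifRoot p k ≠ 0 := by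
  intro h
  have := unifRoot_pow_factorial (p := p) k
  rw [h, zero_pow (Nat.factorial_ne_zero k)] at this
  exact (Nat.cast_ne_zero.mpr (Fact.out : p.Prime).ne_zero) this.symm

theorem exists_norm_pow_eq {x : PadicAlgCl p} (hx : x ≠ 0) :
    ∃ m : ℕ, 0 < m ∧ ∃ a : ℤ, ‖x‖ ^ m = ‖(p : PadicAlgCl p)‖ ^ a := by
  have hint : IsIntegral ℚ_[p] x := Algebra.IsIntegral.isIntegral x
  have hm : 0 < (minpoly ℚ_[p] x).natDegree := minpoly.natDegree_pos hint
  have h := spectralNorm.spectralNorm_eq_norm_coeff_zero_rpow (K := ℚ_[p]) (L := PadicAlgCl p) x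
  have hc : (minpoly ℚ_[p] x).coeff 0 ≠ 0 := minpoly.coeff_zero_ne_zero hint hx
  refine ⟨_, hm, ((minpoly ℚ_[p] x).coeff 0).valuation, ?_⟩
  have h' : ‖x‖ = ‖(minpoly ℚ_[p] x).coeff 0‖ ^ (1 / ((minpoly ℚ_[p] x).natDegree : ℝ)) := by
    rw [← h]; rfl
  rw [h', ← Real.rpow_natCast, ← Real.rpow_mul (norm_nonneg _), one_div,
    inv_mul_cancel₀ (by exact_mod_cast hm.ne'), Real.rpow_one,
    Padic.norm_eq_zpow_neg_valuation hc, ← map_natCast (algebraMap ℚ_[p] (PadicAlgCl p)),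
    PadicAlgCl.norm_extends, Padic.norm_p, inv_zpow, zpow_neg]

/-- The value group is `|p| ^ ℚ`, so up to a unit each `x` is an integral power of a root of `p`;
and `chi` is multiplicative and depends only on the norm. -/
theorem mem_wildInertia_of_unifRoot {w : W p} (hw : w ∈ inertia p)
    (h : ∀ k, chi w.1.1 (unifRoot p k) = 1) : w ∈ wildInertia p := by
  refine mem_wildInertia_iff.2 ⟨hw, fun x hx => ?_⟩
  obtain ⟨m, hm, a, ha⟩ := exists_norm_pow_eq hx
  have hfac : (m - 1).factorial * m = m.factorial := by
    rw [mul_comm, Nat.mul_factorial_pred hm.ne']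
  obtain ⟨y, hy0, hy1, hyn⟩ : ∃ y : PadicAlgCl p, y ≠ 0 ∧ chi w.1.1 y = 1 ∧
      ‖y‖ ^ m = ‖(p : PadicAlgCl p)‖ := by
    -- An `m`-th root of `p`, because `(m - 1)! * m = m!`.
    refine ⟨unifRoot p m ^ (m - 1).factorial, pow_ne_zero _ (unifRoot_ne_zero m), ?_, ?_⟩
    · rw [chi_pow_right _ (unifRoot_ne_zero m), h, one_pow]
    · rw [← norm_pow, ← pow_mul, hfac, unifRoot_pow_factorial]
  have key : ∀ (a : ℕ), chi w.1.1 (y ^ a) = 1 := fun a => by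
    rw [chi_pow_right _ hy0, hy1, one_pow]
  have hny : ‖y‖ ≠ 0 := norm_ne_zero_iff.2 hy0
  rw [← hyn] at ha
  have hxa : ‖x‖ = ‖y‖ ^ a := by
    refine (pow_left_inj₀ (norm_nonneg _) (zpow_nonneg (norm_nonneg _) _) hm.ne').1 ?_
    rw [ha, ← zpow_natCast, ← zpow_natCast, ← zpow_mul, ← zpow_mul, mul_comm]
  rcases Int.eq_nat_or_neg a with ⟨n, rfl | rfl⟩
  · rw [chi_congr hw hx (pow_ne_zero n hy0) (by rw [hxa, norm_pow, zpow_natCast]), key]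
  · have h1 : chi w.1.1 (x * y ^ n) = 1 := by
      refine chi_of_norm_one hw ?_
      rw [norm_mul, norm_pow, hxa, zpow_neg, zpow_natCast, inv_mul_cancel₀ (pow_ne_zero _ hny)]
    rwa [chi_mul_right _ hx (pow_ne_zero n hy0), key, mul_one] at h1

variable (p) in
/-- The tame character of inertia attached to `π_k`. -/
def tameChar (k : ℕ) : inertia p →* (residueField p)ˣ where
  toFun g := Units.mk0 (chi g.1.1.1 (unifRoot p k)) (chi_ne_zero _ (unifRoot_ne_zero k))
  map_one' := Units.ext (by
    change chi (1 : Gal p) _ = 1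
    rw [chi, AlgEquiv.one_apply, div_self (unifRoot_ne_zero (p := p) k), res_one])
  map_mul' g h := Units.ext (chi_mul_left g.2 (unifRoot_ne_zero k))

theorem tameChar_succ_pow (k : ℕ) (g : inertia p) :
    tameChar p (k + 1) g ^ (k + 1) = tameChar p k g := by
  refine Units.ext ?_
  rw [Units.val_pow_eq_pow_val]
  change chi _ (unifRoot p (k + 1)) ^ (k + 1) = chi _ (unifRoot p k)
  rw [← chi_pow_right _ (unifRoot_ne_zero _), unifRoot_succ_pow]

theorem tameChar_pow_factorial (k : ℕ) (g : inertia p) : tameChar p k g ^ k.factorial = 1 := by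
  refine Units.ext ?_
  rw [Units.val_pow_eq_pow_val]
  change chi _ (unifRoot p k) ^ k.factorial = 1
  rw [← chi_pow_right _ (unifRoot_ne_zero _), unifRoot_pow_factorial, chi, map_natCast, div_self,
    res_one]
  exact Nat.cast_ne_zero.mpr (Fact.out : p.Prime).ne_zero

theorem mem_wildInertia_iff_tameChar (g : inertia p) :
    (g : W p) ∈ wildInertia p ↔ ∀ k, tameChar p k g = 1 := by
  constructor
  · intro h k
    exact Units.ext ((mem_wildInertia_iff.1 h).2 _ (unifRoot_ne_zero k))
  · intro h
    exact mem_wildInertia_of_unifRoot g.2 fun k => congrArg Units.val (h k)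

theorem tameChar_conj {w : W p} {n : ℕ} (hw : degree p w = Multiplicative.ofAdd (n : ℤ))
    (g : inertia p) (k : ℕ) :
    tameChar p k ⟨w * g * w⁻¹, (inferInstance : (inertia p).Normal).conj_mem _ g.2 w⟩ =
      tameChar p k g ^ p ^ n := by
  refine Units.ext ?_
  rw [Units.val_pow_eq_pow_val]
  exact chi_conj hw g.2 (unifRoot_ne_zero k)

/-- The tame relation. It can be checked on the tame characters, whose common kernel in inertia is
wild inertia. -/
theorem conj_mul_inv_mem_wildInertia {w g : W p} {n : ℕ}
    (hw : degree p w = Multiplicative.ofAdd (n : ℤ)) (hg : g ∈ inertia p) :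
    w * g * w⁻¹ * (g ^ p ^ n)⁻¹ ∈ wildInertia p := by
  have hc : w * g * w⁻¹ ∈ inertia p := (inferInstance : (inertia p).Normal).conj_mem _ hg w
  have := (mem_wildInertia_iff_tameChar
    ((⟨w * g * w⁻¹, hc⟩ : inertia p) * ((⟨g, hg⟩ : inertia p) ^ p ^ n)⁻¹)).2 fun k => by
      rw [map_mul, map_inv, map_pow]
      rw [show tameChar p k ⟨w * g * w⁻¹, hc⟩ = _ from tameChar_conj hw ⟨g, hg⟩ k, mul_inv_cancel]
  exact this

end WeilGroup

/-! ### Topology of the Weil group, Frobenius lifts, wild inertia is pro-`p` -/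

namespace WeilGroup

variable {p : ℕ} [Fact p.Prime]

/-- No condition on `s` is needed: the set is a union of left cosets of the stabilizer of `x`, which
is open as `x` is algebraic. -/
theorem isOpen_gal_apply_mem (x : PadicAlgCl p) (s : Set (PadicAlgCl p)) :
    IsOpen {g : Gal p | g x ∈ s} := by
  rw [isOpen_iff_mem_nhds]
  intro g hg
  have h1 : IsOpen (MulAction.stabilizer (Gal p) x : Set (Gal p)) := stabilizer_isOpen_of_isIntegral x
  have h2 := (h1.leftCoset g).mem_nhds ⟨1, one_mem _, mul_one g⟩
  refine Filter.mem_of_superset h2 ?_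
  rintro _ ⟨h, hh, rfl⟩
  have : h x = x := hh
  change g (h x) ∈ s
  rwa [this]

theorem isOpen_apply_mem (x : PadicAlgCl p) (s : Set (PadicAlgCl p)) :
    IsOpen {w : W p | w.1.1 x ∈ s} :=
  (isOpen_gal_apply_mem x s).preimage (continuous_fst.comp continuous_subtype_val)

theorem isOpen_inertia : IsOpen (inertia p : Set (W p)) := by
  have : Continuous fun w : W p => w.1.2 := continuous_snd.comp continuous_subtype_val
  exact (isOpen_discrete ({1} : Set (Multiplicative ℤ))).preimage this

theorem mem_weil_of_forall_res {g : Gal p} (h : ∀ x : PadicAlgCl p, ‖x‖ ≤ 1 → res p (g x) = res p x) :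
    (g, (1 : Multiplicative ℤ)) ∈ weil p := by
  refine ⟨0, 0, by simp, fun x => ?_⟩
  obtain ⟨y, hy, rfl⟩ := exists_res x
  simp [residueAction_res g hy, h y hy]

/-- Inside `Gal × {1}`, inertia is cut out by the closed conditions of fixing each residue class,
and the Galois group is compact. -/
theorem isCompact_inertia : IsCompact (inertia p : Set (W p)) := by
  have hind : Topology.IsInducing (Subtype.val : weil p → Gal p × Multiplicative ℤ) := .subtypeVal
  rw [hind.isCompact_iff]
  have heq : (Subtype.val '' (inertia p : Set (W p))) =
      (⋂ x : {x : PadicAlgCl p // ‖x‖ ≤ 1}, {g : Gal p | res p (g x.1) = res p x.1}) ×ˢ {1} := by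
    ext ⟨g, d⟩
    constructor
    · rintro ⟨w, hw, hwe⟩
      have h1 : w.1.1 = g := congrArg Prod.fst hwe
      have h2 : w.1.2 = d := congrArg Prod.snd hwe
      refine ⟨Set.mem_iInter.2 fun x => ?_, h2.symm.trans hw⟩
      subst h1
      exact res_apply_inertia hw x.2
    · rintro ⟨h1, rfl⟩
      rw [Set.mem_iInter] at h1
      exact ⟨⟨(g, 1), mem_weil_of_forall_res fun x hx => h1 ⟨x, hx⟩⟩, rfl, rfl⟩
  rw [heq]
  refine IsCompact.prod (IsClosed.isCompact (isClosed_iInter fun x => ?_)) isCompact_singleton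
  rw [← isOpen_compl_iff]
  exact isOpen_gal_apply_mem x.1 {y | ¬ res p y = res p x.1}

instance : CompactSpace (inertia p) := isCompact_iff_compactSpace.1 isCompact_inertia

theorem exists_open_normal_subgroup {O : Set (W p)} (hO : O ∈ 𝓝 (1 : W p)) :
    ∃ U : Subgroup (W p), U.Normal ∧ IsOpen (U : Set (W p)) ∧ U ≤ inertia p ∧ (U : Set (W p)) ⊆ O := by
  obtain ⟨O', hO', hsub⟩ := mem_nhds_induced _ _ _ |>.1 hO
  change O' ∈ 𝓝 ((1 : Gal p), (1 : Multiplicative ℤ)) at hO'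
  rw [mem_nhds_prod_iff] at hO'
  obtain ⟨A, hA, B, hB, hAB⟩ := hO'
  obtain ⟨E, hE, hEn, hEA⟩ := (krullTopology_mem_nhds_one_iff_of_normal ℚ_[p] (PadicAlgCl p) A).1 hA
  let f : W p →* Gal p := (MonoidHom.fst _ _).comp (weil p).subtype
  have : Normal ℚ_[p] E := hEn
  have : IsGalois ℚ_[p] E := {}
  have hnorm : (E.fixingSubgroup).Normal := inferInstance
  have hf : Continuous f := continuous_fst.comp continuous_subtype_val
  refine ⟨E.fixingSubgroup.comap f ⊓ inertia p, ?_, ?_, inf_le_right, ?_⟩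
  · have := hnorm.comap f
    infer_instance
  · exact ((IntermediateField.fixingSubgroup_isOpen E).preimage hf).inter isOpen_inertia
  · rintro w ⟨h1, h2⟩
    refine hsub (hAB ⟨hEA h1, ?_⟩)
    have : w.1.2 = 1 := h2
    change w.1.2 ∈ B
    rw [this]
    exact mem_of_mem_nhds hB

theorem isLocallyConstant_tameChar (k : ℕ) : IsLocallyConstant (tameChar p k) := by
  refine IsLocallyConstant.iff_exists_open _ |>.2 fun g => ?_
  refine ⟨(Subtype.val : inertia p → W p) ⁻¹' {w | w.1.1 (unifRoot p k) ∈
    ({g.1.1.1 (unifRoot p k)} : Set (PadicAlgCl p))},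
    (isOpen_apply_mem _ _).preimage continuous_subtype_val, rfl, fun h hh => Units.ext ?_⟩
  change chi _ _ = chi _ _
  have : h.1.1.1 (unifRoot p k) = g.1.1.1 (unifRoot p k) := hh
  rw [chi, chi, this]

section Frobenius

open scoped Pointwise

instance : MulSemiringAction (Gal p) (integers p) :=
  MulSemiringAction.compHom (integers p)
    ((MonoidHom.id (Gal p)).codRestrict ((integers p).decompositionSubgroup ℚ_[p])
      (mem_decompositionSubgroup p))

theorem coe_smul_integers (g : Gal p) (x : integers p) : ((g • x : integers p) : PadicAlgCl p) = g x :=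
  rfl

/-- The structure map from the `p`-adic integers to the integers of the algebraic closure. -/
def padicIntToIntegers : ℤ_[p] →+* integers p :=
  ((algebraMap ℚ_[p] (PadicAlgCl p)).comp PadicInt.Coe.ringHom).codRestrict (integers p).toSubring
    fun x => (mem_integers_iff _).2 (by
      change ‖algebraMap ℚ_[p] (PadicAlgCl p) x‖ ≤ 1
      rw [PadicAlgCl.norm_extends]
      exact x.2)

instance : Algebra ℤ_[p] (integers p) := padicIntToIntegers.toAlgebra

theorem coe_algebraMap_integers (x : ℤ_[p]) :
    ((algebraMap ℤ_[p] (integers p) x : integers p) : PadicAlgCl p) =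
      algebraMap ℚ_[p] (PadicAlgCl p) x := rfl

instance : SMulCommClass (Gal p) ℤ_[p] (integers p) := ⟨fun g a x => by
  rw [Algebra.smul_def, Algebra.smul_def, smul_mul']
  congr 1
  refine Subtype.ext ?_
  rw [coe_smul_integers, coe_algebraMap_integers, AlgEquiv.commutes]⟩

instance : Algebra.IsInvariant ℤ_[p] (integers p) (Gal p) := ⟨fun b hb => by
  have h1 : ∀ g : Gal p, g b.1 = b.1 := fun g => congrArg Subtype.val (hb g)
  obtain ⟨a, ha⟩ := (InfiniteGalois.mem_range_algebraMap_iff_fixed (k := ℚ_[p]) b.1).2 h1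
  have hn : ‖a‖ ≤ 1 := by
    rw [← PadicAlgCl.norm_extends p a, ha]
    exact (mem_integers_iff _).1 b.2
  exact ⟨⟨a, hn⟩, Subtype.ext ha⟩⟩

/-- The stabilizer of the maximal ideal surjects onto the automorphisms of the residue field over
`ℤ_p` modulo the prime below. Frobenius is one of them: it fixes the image of `ℤ_p` by Fermat, and
it is bijective because the residue field is perfect. -/
theorem exists_gal_frobenius : ∃ g : Gal p, ∀ x : residueField p, residueAction p g x = x ^ p := by
  -- With the discrete topology, continuity of the action means that stabilizers are open.
  let _ : TopologicalSpace (integers p) := ⊥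
  have : DiscreteTopology (integers p) := ⟨rfl⟩
  have : ContinuousSMul (Gal p) (integers p) := by
    refine ⟨continuous_iff_continuousAt.2 fun ⟨g, x⟩ => ?_⟩
    rw [ContinuousAt, nhds_discrete (integers p), Filter.tendsto_pure, nhds_prod_eq,
      nhds_discrete (integers p), Filter.prod_pure]
    refine Filter.eventually_map.2 ?_
    filter_upwards [(isOpen_gal_apply_mem x.1 {g x.1}).mem_nhds rfl] with h hh
    exact Subtype.ext hh
  let Q := IsLocalRing.maximalIdeal (integers p)
  let P := Q.under ℤ_[p]
  have : Q.LiesOver P := ⟨rfl⟩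
  have hchar : CharP (integers p ⧸ Q) p := inferInstanceAs (CharP (residueField p) p)
  have hfrob : ∀ a : ℤ_[p], (Ideal.Quotient.mk Q (algebraMap ℤ_[p] (integers p) a)) ^ p =
      Ideal.Quotient.mk Q (algebraMap ℤ_[p] (integers p) a) := by
    intro a
    have h1 : a ^ p - a ∈ IsLocalRing.maximalIdeal ℤ_[p] := by
      rw [← PadicInt.ker_toZMod, RingHom.mem_ker, map_sub, map_pow, ZMod.pow_card, sub_self]
    rw [← map_pow, ← map_pow, ← sub_eq_zero, ← map_sub, ← map_sub, Ideal.Quotient.eq_zero_iff_mem]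
    rw [PadicInt.maximalIdeal_eq_span_p, Ideal.mem_span_singleton] at h1
    obtain ⟨c, hc⟩ := h1
    rw [hc, map_mul, map_natCast]
    refine Ideal.mul_mem_right _ _ ?_
    rw [← Ideal.Quotient.eq_zero_iff_mem, map_natCast]
    exact CharP.cast_eq_zero _ p
  -- Lift a monic polynomial to the valuation ring. Its root in the algebraic closure is integral,
  -- hence lies in the valuation ring, and reduces to a root.
  have : IsAlgClosed (residueField p) := by
    refine IsAlgClosed.of_exists_root _ fun f hf hirr => ?_
    obtain ⟨q, hq, hqd, hqm⟩ := Polynomial.lifts_and_natDegree_eq_and_monic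
      ((Polynomial.lifts_iff_coeff_lifts f).2 fun n => IsLocalRing.residue_surjective (R := integers p) _) hf
    have hdeg : (q.map (integers p).subtype).degree ≠ 0 := by
      rw [hqm.degree_map]
      intro h0
      have := hirr.natDegree_pos
      rw [← hqd, Polynomial.natDegree_eq_of_degree_eq_some h0] at this
      exact lt_irrefl _ this
    obtain ⟨x, hx⟩ := IsAlgClosed.exists_root _ hdeg
    have hint : IsIntegral (integers p) x := ⟨q, hqm, by
      rwa [Polynomial.IsRoot, Polynomial.eval_map] at hx⟩
    obtain ⟨y, rfl⟩ := IsIntegrallyClosed.isIntegral_iff.1 hint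
    refine ⟨IsLocalRing.residue _ y, ?_⟩
    rw [← hq, Polynomial.eval_map_apply]
    have : q.eval y = 0 := by
      apply (integers p).subtype_injective
      rw [map_zero, ← Polynomial.eval_map_apply]
      exact hx
    rw [this, map_zero]
  have : PerfectRing (residueField p) p := inferInstance
  let e : residueField p ≃+* residueField p := frobeniusEquiv (residueField p) p
  let σ : (integers p ⧸ Q) ≃ₐ[ℤ_[p] ⧸ P] (integers p ⧸ Q) :=
    AlgEquiv.ofRingEquiv (f := e) (by
      rintro ⟨a⟩
      exact hfrob a)
  obtain ⟨g, hg⟩ := Ideal.Quotient.stabilizerHom_surjective_of_profinite (G := Gal p) P Q σ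
  refine ⟨g.1, fun x => ?_⟩
  obtain ⟨x, rfl⟩ := IsLocalRing.residue_surjective x
  have := congrArg (fun s => s (Ideal.Quotient.mk Q x)) hg
  exact this

variable (p) in
theorem exists_frobenius : ∃ F : W p, degree p F = Multiplicative.ofAdd (1 : ℤ) := by
  obtain ⟨g, hg⟩ := exists_gal_frobenius (p := p)
  exact ⟨⟨(g, Multiplicative.ofAdd 1), ⟨1, 0, by simp, fun x => by simp [hg]⟩⟩, rfl⟩

end Frobenius

section WildPrimeTo

/-- A wild element whose period on `x` is prime to `p` fixes `x`. -/
theorem wild_apply_eq_of_coprime {g : W p} (hg : g ∈ wildInertia p) {x : PadicAlgCl p} {m : ℕ}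
    (hm : ¬ p ∣ m) (hx : (g ^ m).1.1 x = x) : g.1.1 x = x := by
  have hm0 : (m : PadicAlgCl p) ≠ 0 := by
    intro h
    rw [Nat.cast_eq_zero] at h
    exact hm (h ▸ dvd_zero p)
  have hnm : ‖(m : PadicAlgCl p)‖ = 1 := by
    rw [← map_natCast (algebraMap ℚ_[p] (PadicAlgCl p)), PadicAlgCl.norm_extends]
    exact Padic.norm_natCast_eq_one_iff.2 ((Nat.Prime.coprime_iff_not_dvd Fact.out).2 hm)
  have hpow : ∀ (i : ℕ) (y : PadicAlgCl p), (g ^ (i + 1)).1.1 y = g.1.1 ((g ^ i).1.1 y) := by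
    intro i y
    rw [pow_succ']
    rfl
  have h0 : ∀ y : PadicAlgCl p, (g ^ 0).1.1 y = y := fun y => by rw [pow_zero]; rfl
  set s := ∑ i ∈ Finset.range m, (g ^ i).1.1 x with hs
  have hgs : g.1.1 s = s := by
    rw [hs, map_sum]
    simp_rw [← hpow]
    have h1 := Finset.sum_range_succ (fun i => (g ^ i).1.1 x) m
    rw [Finset.sum_range_succ', h0, hx] at h1
    exact add_right_cancel h1
  have hgs' : ∀ i : ℕ, (g ^ i).1.1 s = s := by
    intro i
    induction i with
    | zero => exact h0 s
    | succ i ih => rw [hpow, ih, hgs]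
  -- The difference of `m x` and the orbit sum `s`, so `z` has orbit sum zero. If `z ≠ 0`, wildness
  -- makes each `gⁱ z - z` strictly smaller than `z`, whereas these differences add up to `-m z`, of
  -- the same norm as `z`.
  set z := m * x - s with hz
  have hsum : ∑ i ∈ Finset.range m, (g ^ i).1.1 z = 0 := by
    simp_rw [hz, map_sub, map_mul, map_natCast, hgs']
    rw [Finset.sum_sub_distrib, ← Finset.mul_sum, ← hs, Finset.sum_const, Finset.card_range,
      nsmul_eq_mul, sub_self]
  have hz0 : z = 0 := by
    by_contra hne
    have h1 : ∀ i ∈ Finset.range m, ‖(g ^ i).1.1 z - z‖ < ‖z‖ := fun i _ =>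
      (pow_mem hg i).2 z hne
    have hmpos : (Finset.range m).Nonempty := by
      rw [Finset.nonempty_range_iff]
      rintro rfl
      exact hm (dvd_zero p)
    have h2 : ‖∑ i ∈ Finset.range m, ((g ^ i).1.1 z - z)‖ < ‖z‖ := by
      obtain ⟨i, hi, hle⟩ := IsUltrametricDist.exists_norm_finsetSum_le_of_nonempty hmpos
        (fun i => (g ^ i).1.1 z - z)
      exact hle.trans_lt (h1 i hi)
    rw [Finset.sum_sub_distrib, hsum, Finset.sum_const, Finset.card_range, nsmul_eq_mul, zero_sub,
      norm_neg, norm_mul, hnm, one_mul] at h2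
    exact lt_irrefl _ h2
  have hmx : m * x = s := sub_eq_zero.1 hz0
  have := congrArg g.1.1 hmx
  rw [map_mul, map_natCast, hgs, ← hmx] at this
  exact mul_left_cancel₀ hm0 this

/-- A neighbourhood of `1` contains the fixer of some finite extension, and fixing a primitive
element fixes the extension. -/
theorem exists_inertia_fixing_subset {O : Set (W p)} (hO : O ∈ 𝓝 (1 : W p)) :
    ∃ x : PadicAlgCl p, ∀ w ∈ inertia p, w.1.1 x = x → w ∈ O := by
  obtain ⟨O', hO', hsub⟩ := mem_nhds_induced _ _ _ |>.1 hO
  change O' ∈ 𝓝 ((1 : Gal p), (1 : Multiplicative ℤ)) at hO'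
  rw [mem_nhds_prod_iff] at hO'
  obtain ⟨A, hA, B, hB, hAB⟩ := hO'
  obtain ⟨E, hE, hEA⟩ := (krullTopology_mem_nhds_one_iff ℚ_[p] (PadicAlgCl p) A).1 hA
  let pb := Field.powerBasisOfFiniteOfSeparable ℚ_[p] E
  refine ⟨pb.gen, fun w hw hwa => hsub (hAB ⟨hEA ?_, ?_⟩)⟩
  · rw [SetLike.mem_coe, IntermediateField.mem_fixingSubgroup_iff]
    have h1 : w.1.1.toAlgHom.comp E.val = E.val := pb.algHom_ext hwa
    exact fun x hx => DFunLike.congr_fun h1 ⟨x, hx⟩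
  · have : w.1.2 = 1 := hw
    change w.1.2 ∈ B
    rw [this]
    exact mem_of_mem_nhds hB

/-- Wild inertia is pro-`p`. -/
theorem exists_pow_mem_of_wild {g : W p} (hg : g ∈ wildInertia p) {O : Set (W p)}
    (hO : O ∈ 𝓝 (1 : W p)) : ∃ k : ℕ, g ^ p ^ k ∈ O := by
  obtain ⟨x, hx⟩ := exists_inertia_fixing_subset hO
  have hgi := wildInertia_le_inertia hg
  let S : Subgroup (inertia p) := (MulAction.stabilizer (Gal p) x).comap
    (((MonoidHom.fst _ _).comp (weil p).subtype).comp (inertia p).subtype)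
  have hSo : IsOpen (S : Set (inertia p)) := (stabilizer_isOpen_of_isIntegral x).preimage
    ((continuous_fst.comp continuous_subtype_val).comp continuous_subtype_val)
  have hfin : Finite (inertia p ⧸ S) := S.quotient_finite_of_isOpen hSo
  have : S.FiniteIndex := S.finiteIndex_of_finite_quotient
  obtain ⟨N, hN0, -, hN⟩ := S.exists_pow_mem_of_index_ne_zero this.index_ne_zero ⟨g, hgi⟩
  -- Some power `g ^ N` fixes `x`. Write `N = p ^ k * m` with `m` prime to `p`: the wild element `g
  -- ^ p ^ k` has period `m` on `x`, hence fixes `x`.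
  obtain ⟨k, m, hm, rfl⟩ := Nat.exists_eq_pow_mul_and_not_dvd hN0.ne' p
    (Fact.out : p.Prime).ne_one
  refine ⟨k, hx _ (pow_mem hgi _) ?_⟩
  refine wild_apply_eq_of_coprime (pow_mem hg _) hm ?_
  rw [← pow_mul]
  exact hN

end WildPrimeTo

end WeilGroup

/-! ### Matrices conjugate to a power of themselves -/

namespace Matrix

theorem pow_eq_zero_of_spectrum_subset {L : Type*} [Field L] [IsAlgClosed L] {n : ℕ}
    (M : Matrix (Fin n) (Fin n) L) (h : spectrum L M ⊆ {0}) : M ^ n = 0 := by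
  have hs : M.charpoly.Splits := IsAlgClosed.splits _
  have hr : M.charpoly.roots = Multiset.replicate n 0 := by
    refine Multiset.eq_replicate.2 ⟨?_, fun x hx => ?_⟩
    · rw [← hs.natDegree_eq_card_roots, M.charpoly_natDegree_eq_dim, Fintype.card_fin]
    · exact h (Matrix.mem_spectrum_iff_isRoot_charpoly.2 (Polynomial.isRoot_of_mem_roots hx))
  have hc : M.charpoly = Polynomial.X ^ n := by
    rw [hs.eq_prod_roots_of_monic M.charpoly_monic, hr]
    simp
  have := M.aeval_self_charpoly
  rwa [hc, map_pow, Polynomial.aeval_X] at this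

theorem finite_spectrum_card_le {L : Type*} [Field L] {n : ℕ} (M : Matrix (Fin n) (Fin n) L) :
    (spectrum L M).Finite ∧ (spectrum L M).ncard ≤ n := by
  classical
  have hs : spectrum L M ⊆ (M.charpoly.roots.toFinset : Set L) := fun x hx => by
    simp only [Finset.mem_coe, Multiset.mem_toFinset]
    exact (Polynomial.mem_roots M.charpoly_monic.ne_zero).2
      (Matrix.mem_spectrum_iff_isRoot_charpoly.1 hx)
  refine ⟨(Finset.finite_toSet _).subset hs, ?_⟩
  refine (Set.ncard_le_ncard hs (Finset.finite_toSet _)).trans ?_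
  rw [Set.ncard_coe_finset]
  refine (Multiset.toFinset_card_le _).trans ((Polynomial.card_roots' _).trans ?_)
  rw [M.charpoly_natDegree_eq_dim, Fintype.card_fin]

/-- The map `x ↦ x ^ q` permutes the at most `n` eigenvalues, so its `n!`-th iterate is the
identity. Each eigenvalue is nonzero, hence a root of unity of order dividing `q ^ n! - 1`. -/
theorem pow_sub_one_pow_eq_zero_of_conj_eq_pow {L : Type*} [Field L] [IsAlgClosed L] {n q : ℕ}
    (hq : 0 < q) (X g : (Matrix (Fin n) (Fin n) L)ˣ) (h : g * X * g⁻¹ = X ^ q) :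
    ((X : Matrix (Fin n) (Fin n) L) ^ (q ^ n.factorial - 1) - 1) ^ n = 0 := by
  set S := spectrum L (X : Matrix (Fin n) (Fin n) L) with hS
  obtain ⟨hfin, hcard⟩ := finite_spectrum_card_le (X : Matrix (Fin n) (Fin n) L)
  have himg : (fun x => x ^ q) '' S = S := by
    rw [hS, ← spectrum.map_pow_of_pos _ hq, ← Units.val_pow_eq_pow_val, ← h, Units.val_mul,
      Units.val_mul, spectrum.units_conjugate]
  have hmaps : Set.MapsTo (fun x : L => x ^ q) S S := fun x hx => himg ▸ Set.mem_image_of_mem _ hx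
  have : Finite S := hfin
  have hsurj : Function.Surjective (hmaps.restrict) :=
    (Set.MapsTo.restrict_surjective_iff _).2 himg.symm.subset
  let e : Equiv.Perm S := Equiv.ofBijective _ (Finite.injective_iff_surjective.2 hsurj |>.bijective_of_finite)
  have hepow : ∀ (k : ℕ) (x : S), ((e ^ k) x : L) = (x : L) ^ q ^ k := by
    intro k x
    induction k with
    | zero => simp
    | succ k ih =>
      rw [pow_succ', Equiv.Perm.mul_apply, pow_succ, pow_mul, ← ih]
      rfl
  have he : e ^ n.factorial = 1 := by
    rw [← orderOf_dvd_iff_pow_eq_one]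
    refine (orderOf_dvd_natCard e).trans ?_
    rw [Nat.card_perm]
    exact Nat.factorial_dvd_factorial hcard
  have hone : ∀ x ∈ S, x ^ (q ^ n.factorial - 1) = 1 := by
    intro x hx
    have hx0 : x ≠ 0 := by
      rintro rfl
      exact spectrum.zero_notMem L X.isUnit hx
    have h1 := hepow n.factorial ⟨x, hx⟩
    rw [he] at h1
    have h2 : 1 ≤ q ^ n.factorial := Nat.one_le_pow _ _ hq
    refine mul_right_cancel₀ hx0 ?_
    rw [← pow_succ, Nat.sub_add_cancel h2, one_mul]
    exact h1.symm
  refine pow_eq_zero_of_spectrum_subset _ ?_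
  intro y hy
  rw [← map_one (algebraMap L (Matrix (Fin n) (Fin n) L)), ← spectrum.sub_singleton_eq] at hy
  obtain ⟨z, hz, o, ho, rfl⟩ := hy
  obtain rfl : o = 1 := ho
  -- The exponent vanishes for `q = 1`, where the spectral mapping for positive powers does not
  -- apply.
  rcases Nat.eq_zero_or_pos (q ^ n.factorial - 1) with h0 | hpos
  · rw [h0, pow_zero] at hz
    rcases isEmpty_or_nonempty (Fin n) with hn | hn
    · have : Subsingleton (Matrix (Fin n) (Fin n) L) := inferInstance
      rw [spectrum.of_subsingleton] at hz
      exact hz.elim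
    · rw [spectrum.one_eq] at hz
      rw [Set.mem_singleton_iff.1 hz]
      simp
  · rw [spectrum.map_pow_of_pos _ hpos] at hz
    obtain ⟨w, hw, rfl⟩ := hz
    simp [hone w hw]

/-- The ideal of the entries is finitely generated and nil, hence nilpotent, and `M ^ r` has entries
in its `r`-th power. -/
theorem isNilpotent_of_forall_isNilpotent {A : Type*} [CommRing A] {n : ℕ}
    (M : Matrix (Fin n) (Fin n) A) (h : ∀ i j, IsNilpotent (M i j)) : IsNilpotent M := by
  let I : Ideal A := Ideal.span (Set.range fun ij : Fin n × Fin n => M ij.1 ij.2)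
  have hI : IsNilpotent I := by
    rw [Ideal.FG.isNilpotent_iff_le_nilradical
      ⟨(Set.finite_range _).toFinset, by rw [Set.Finite.coe_toFinset]⟩, Ideal.span_le]
    rintro _ ⟨ij, rfl⟩
    exact mem_nilradical.2 (h _ _)
  obtain ⟨k, hk⟩ := hI
  have key : ∀ (r : ℕ) (i j : Fin n), (M ^ r) i j ∈ I ^ r := by
    intro r
    induction r with
    | zero => intro i j; simp
    | succ r ih =>
      intro i j
      rw [pow_succ, pow_succ M]
      exact (Matrix.mul_apply (M := M ^ r) (N := M)) ▸ Ideal.sum_mem _ fun l _ => Ideal.mul_mem_mul (ih i l)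
        (Ideal.subset_span ⟨(l, j), rfl⟩)
  refine ⟨k, ?_⟩
  ext i j
  have := key k i j
  rw [hk] at this
  exact this

/-- The entries of the `n`-th power lie in every prime ideal, as is seen over an algebraic closure
of each residue field. -/
theorem isNilpotent_pow_sub_one_of_conj_eq_pow {A : Type*} [CommRing A] {n q : ℕ} (hq : 0 < q)
    (X g : (Matrix (Fin n) (Fin n) A)ˣ) (h : g * X * g⁻¹ = X ^ q) :
    IsNilpotent ((X : Matrix (Fin n) (Fin n) A) ^ (q ^ n.factorial - 1) - 1) := by
  suffices IsNilpotent (((X : Matrix (Fin n) (Fin n) A) ^ (q ^ n.factorial - 1) - 1) ^ n) by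
    obtain ⟨k, hk⟩ := this
    exact ⟨n * k, by rw [pow_mul, hk]⟩
  refine isNilpotent_of_forall_isNilpotent _ fun i j => ?_
  rw [← mem_nilradical, nilradical_eq_sInf, Ideal.mem_sInf]
  intro P hP
  have : P.IsPrime := hP
  let f : A →+* AlgebraicClosure (FractionRing (A ⧸ P)) :=
    ((algebraMap (FractionRing (A ⧸ P)) _).comp (algebraMap (A ⧸ P) _)).comp (Ideal.Quotient.mk P)
  have hf : RingHom.ker f = P := by
    ext x
    rw [RingHom.mem_ker]
    change algebraMap (FractionRing (A ⧸ P)) _ (algebraMap (A ⧸ P) _ _) = 0 ↔ _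
    rw [FaithfulSMul.algebraMap_eq_zero_iff, FaithfulSMul.algebraMap_eq_zero_iff,
      Ideal.Quotient.eq_zero_iff_mem]
  have hmap := pow_sub_one_pow_eq_zero_of_conj_eq_pow hq
    (Units.map f.mapMatrix.toMonoidHom X) (Units.map f.mapMatrix.toMonoidHom g)
    (by rw [← map_mul, ← map_inv, ← map_mul, h, map_pow])
  rw [← hf, RingHom.mem_ker]
  have h2 : f.mapMatrix (((X : Matrix (Fin n) (Fin n) A) ^ (q ^ n.factorial - 1) - 1) ^ n) = 0 := by
    rw [map_pow, map_sub, map_pow, map_one]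
    exact hmap
  exact congrFun (congrFun h2 i) j

/-- The point is that `K` is uniform in the ring. Otherwise each `K` has a counterexample; the
product of all of them is a single matrix over the product ring, whose nilpotency exponent `K`
contradicts its own `K`-th component. -/
theorem exists_pow_sub_one_pow_eq_zero (n q : ℕ) (hq : 1 < q) :
    ∃ m K : ℕ, 0 < m ∧ ∀ (A : Type) [CommRing A] (X g : (Matrix (Fin n) (Fin n) A)ˣ),
      g * X * g⁻¹ = X ^ q → ((X : Matrix (Fin n) (Fin n) A) ^ m - 1) ^ K = 0 := by
  have hm : 0 < q ^ n.factorial - 1 := Nat.sub_pos_of_lt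
    (Nat.one_lt_pow (Nat.factorial_ne_zero n) hq)
  by_contra! hcon
  have h1 : ∀ K : ℕ, _ := fun K => hcon (q ^ n.factorial - 1) K hm
  choose A hA X g hXg hne using h1
  let pr : ∀ i, (∀ i, A i) →+* A i := fun i => Pi.evalRingHom A i
  let toPi (Z : ∀ i, Matrix (Fin n) (Fin n) (A i)) : Matrix (Fin n) (Fin n) (∀ i, A i) :=
    Matrix.of fun a b i => Z i a b
  have hinj : ∀ Y Z : Matrix (Fin n) (Fin n) (∀ i, A i),
      (∀ i, (pr i).mapMatrix Y = (pr i).mapMatrix Z) → Y = Z := by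
    intro Y Z hYZ
    ext a b i
    exact congrFun (congrFun (hYZ i) a) b
  have hto : ∀ Z i, (pr i).mapMatrix (toPi Z) = Z i := fun Z i => rfl
  have hunit : ∀ Z : ∀ i, (Matrix (Fin n) (Fin n) (A i))ˣ,
      ∃ U : (Matrix (Fin n) (Fin n) (∀ i, A i))ˣ, ∀ i, Units.map (pr i).mapMatrix.toMonoidHom U = Z i := by
    intro Z
    refine ⟨⟨toPi fun i => Z i, toPi fun i => (Z i)⁻¹.val, hinj _ _ fun i => ?_,
      hinj _ _ fun i => ?_⟩, fun i => Units.ext rfl⟩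
    · rw [map_mul, hto, hto, map_one, Units.mul_inv]
    · rw [map_mul, hto, hto, map_one, Units.inv_mul]
  obtain ⟨X', hX'⟩ := hunit X
  obtain ⟨g', hg'⟩ := hunit g
  have hrel : g' * X' * g'⁻¹ = X' ^ q := by
    refine Units.ext (hinj _ _ fun i => ?_)
    have := hXg i
    rw [← hX' i, ← hg' i, ← map_mul, ← map_inv, ← map_mul, ← map_pow] at this
    exact congrArg Units.val this
  obtain ⟨K, hK⟩ := isNilpotent_pow_sub_one_of_conj_eq_pow (zero_lt_one.trans hq) X' g' hrel
  refine hne K ?_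
  have := congrArg (pr K).mapMatrix hK
  rw [map_pow, map_sub, map_pow, map_one, map_zero] at this
  rw [← this, ← hX' K]
  rfl

end Matrix

/-! ### Tame inertia is procyclic -/

namespace WeilGroup

variable {p : ℕ} [Fact p.Prime]

theorem _root_.pow_zpow_comm {G : Type*} [Group G] (c : G) (N : ℕ) (j : ℤ) :
    (c ^ N) ^ j = (c ^ j) ^ N := by
  rw [← zpow_natCast, ← zpow_natCast, zpow_comm]

theorem tameChar_eq_pow_of_le {k k' : ℕ} (h : k ≤ k') :
    ∃ N : ℕ, ∀ g, tameChar p k g = tameChar p k' g ^ N := by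
  induction k', h using Nat.le_induction with
  | base => exact ⟨1, fun g => (pow_one _).symm⟩
  | succ k' _ ih =>
    obtain ⟨N, hN⟩ := ih
    exact ⟨(k' + 1) * N, fun g => by rw [hN, pow_mul, tameChar_succ_pow]⟩

theorem isOfFinOrder_tameChar (k : ℕ) (g : inertia p) : IsOfFinOrder (tameChar p k g) :=
  isOfFinOrder_iff_pow_eq_one.2 ⟨_, Nat.factorial_pos k, tameChar_pow_factorial k g⟩

theorem isClosed_tameChar_mem (k : ℕ) (s : Set (residueField p)ˣ) :
    IsClosed {g : inertia p | tameChar p k g ∈ s} := by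
  rw [← isOpen_compl_iff]
  exact isLocallyConstant_tameChar k sᶜ

/-- The image of `U` under each tame character is a finite subgroup of the units of a field, hence
cyclic. The sets of generators at level `k` are closed, nonempty and decreasing, so by compactness
they have a common element. -/
theorem exists_tame_generator (U : Subgroup (inertia p)) (hU : IsClosed (U : Set (inertia p))) :
    ∃ τ ∈ U, ∀ x ∈ U, ∀ k, tameChar p k x ∈ Subgroup.zpowers (tameChar p k τ) := by
  let T : ℕ → Set (inertia p) := fun k =>
    U ∩ {τ | tameChar p k τ ∈ {c | ∀ x ∈ U, tameChar p k x ∈ Subgroup.zpowers c}}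
  have hcl : ∀ k, IsClosed (T k) := fun k => hU.inter (isClosed_tameChar_mem k _)
  have hne : (⋂ k, T k).Nonempty := by
    refine IsCompact.nonempty_iInter_of_sequence_nonempty_isCompact_isClosed T ?_ ?_
      (hcl 0).isCompact hcl
    · rintro k τ ⟨hτ, h⟩
      refine ⟨hτ, fun x hx => ?_⟩
      obtain ⟨j, hj⟩ := h x hx
      refine ⟨j, ?_⟩
      simp only at hj ⊢
      rw [← tameChar_succ_pow k τ, ← tameChar_succ_pow k x, ← hj, pow_zpow_comm]
    · intro k
      let S := U.map (tameChar p k)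
      have hS : S ≤ rootsOfUnity k.factorial (residueField p) := by
        rintro _ ⟨x, -, rfl⟩
        exact tameChar_pow_factorial k x
      have : NeZero k.factorial := ⟨Nat.factorial_ne_zero k⟩
      have : Finite S := Finite.of_injective _ (Subgroup.inclusion_injective hS)
      obtain ⟨⟨_, τ, hτ, rfl⟩, hg⟩ := IsCyclic.exists_generator (α := S)
      refine ⟨τ, hτ, fun x hx => ?_⟩
      obtain ⟨j, hj⟩ := hg ⟨_, x, hx, rfl⟩
      exact ⟨j, congrArg Subtype.val hj⟩
  obtain ⟨τ, hτ⟩ := hne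
  rw [Set.mem_iInter] at hτ
  exact ⟨τ, (hτ 0).1, fun x hx k => (hτ k).2 x hx⟩

/-- The elements of `U` which modulo wild inertia are topologically generated by `x₀`. -/
def tameClosure (U : Subgroup (inertia p)) (x₀ : inertia p) : Subgroup (inertia p) :=
  U ⊓ ⨅ k, (Subgroup.zpowers (tameChar p k x₀)).comap (tameChar p k)

theorem mem_tameClosure {U : Subgroup (inertia p)} {x₀ x : inertia p} :
    x ∈ tameClosure U x₀ ↔ x ∈ U ∧ ∀ k, tameChar p k x ∈ Subgroup.zpowers (tameChar p k x₀) := by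
  simp [tameClosure, Subgroup.mem_iInf]

/-- A closed subgroup of finite index is open, and the translates by `τ ^ r` with `r < m` cover `U`.
-/
theorem isOpen_tameClosure (U : Subgroup (inertia p)) (hU : IsOpen (U : Set (inertia p)))
    {τ : inertia p} (hτ : τ ∈ U)
    (h : ∀ x ∈ U, ∀ k, tameChar p k x ∈ Subgroup.zpowers (tameChar p k τ)) {m : ℕ} (hm : 0 < m) :
    IsOpen (tameClosure U (τ ^ m) : Set (inertia p)) := by
  set J := tameClosure U (τ ^ m) with hJ
  have hclosed : IsClosed (J : Set (inertia p)) := by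
    have : (J : Set (inertia p)) = (U : Set (inertia p)) ∩ ⋂ k, {x | tameChar p k x ∈
        (Subgroup.zpowers (tameChar p k (τ ^ m)) : Set (residueField p)ˣ)} := by
      ext x
      simp only [SetLike.mem_coe, hJ, mem_tameClosure, Set.mem_inter_iff, Set.mem_iInter]
      rfl
    rw [this]
    exact (Subgroup.isClosed_of_isOpen U hU).inter (isClosed_iInter fun k => isClosed_tameChar_mem k _)
  have : NeZero m := ⟨hm.ne'⟩
  have hcov : ∀ x ∈ U, ∃ r : Fin m, x * (τ ^ (r : ℕ))⁻¹ ∈ J := by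
    intro x hx
    have h1 : ∀ k, ∃ r : Fin m, tameChar p k (x * (τ ^ (r : ℕ))⁻¹) ∈
        Subgroup.zpowers (tameChar p k (τ ^ m)) := by
      intro k
      obtain ⟨j, hj⟩ := (isOfFinOrder_tameChar k τ).mem_powers_iff_mem_zpowers.2 (h x hx k)
      simp only at hj
      refine ⟨⟨j % m, Nat.mod_lt _ hm⟩, ((j / m : ℕ) : ℤ), ?_⟩
      simp only [map_mul, map_inv, map_pow, zpow_natCast]
      rw [← hj, eq_mul_inv_iff_mul_eq, ← pow_mul, ← pow_add, Nat.div_add_mod]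
    choose r hr using h1
    -- Each level has its own residue `r k`; one value serves infinitely many levels, hence all,
    -- because lower tame characters are powers of higher ones.
    obtain ⟨y, hy⟩ := Finite.exists_infinite_fiber r
    refine ⟨y, mem_tameClosure.2 ⟨mul_mem hx (inv_mem (pow_mem hτ _)), fun k => ?_⟩⟩
    rw [Set.infinite_coe_iff] at hy
    obtain ⟨k', hk', hlt⟩ := hy.exists_gt k
    obtain ⟨N, hN⟩ := tameChar_eq_pow_of_le (p := p) hlt.le
    obtain ⟨j, hj⟩ := hr k'
    rw [Set.mem_preimage, Set.mem_singleton_iff] at hk'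
    rw [hk'] at hj
    refine ⟨j, ?_⟩
    simp only at hj ⊢
    rw [hN, hN, ← hj, pow_zpow_comm]
  have : U.FiniteIndex := by
    have := U.quotient_finite_of_isOpen hU
    exact U.finiteIndex_of_finite_quotient
  have hrel : J.relIndex U ≠ 0 := by
    rw [Subgroup.relIndex]
    have : Finite (U ⧸ J.subgroupOf U) := by
      refine Finite.of_surjective
        (fun r : Fin m => (QuotientGroup.mk (⟨τ ^ (r : ℕ), pow_mem hτ _⟩⁻¹ : U) : U ⧸ J.subgroupOf U)) ?_
      intro q
      induction q using QuotientGroup.induction_on with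
      | H z =>
        obtain ⟨r, hr⟩ := hcov z⁻¹ (inv_mem z.2)
        refine ⟨r, ?_⟩
        rw [QuotientGroup.eq, inv_inv]
        have := inv_mem hr
        rw [mul_inv_rev, inv_inv, inv_inv] at this
        exact this
    have := (J.subgroupOf U).finiteIndex_of_finite_quotient
    exact this.index_ne_zero
  have hfin : J.FiniteIndex := by
    refine ⟨?_⟩
    rw [← Subgroup.relIndex_mul_index (show J ≤ U from inf_le_left)]
    exact mul_ne_zero hrel this.index_ne_zero
  exact Subgroup.isOpen_of_isClosed_of_finiteIndex J hclosed

end WeilGroup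

/-! ### `ℓ`-adic functionals and `ℓ`-adic powers of unipotent matrices -/

namespace LParameter
open WeilGroup

variable {p ℓ : ℕ} [Fact p.Prime] [Fact ℓ.Prime]

/-- A `ℚ_ℓ`-linear functional on a `ℚ̄_ℓ`-algebra. -/
def IsPadicFunctional {A : Type*} [CommRing A] [Algebra (PadicAlgCl ℓ) A] (f : A →+ ℚ_[ℓ]) : Prop :=
  ∀ (c : ℚ_[ℓ]) (a : A), f (algebraMap (PadicAlgCl ℓ) A (algebraMap ℚ_[ℓ] (PadicAlgCl ℓ) c) * a) = c * f a

/-- Functionals separate points, so limits and identities in `A` can be tested in the Hausdorff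
field `ℚ_ℓ`, without a topology on `A`. -/
theorem exists_padicFunctional {A : Type*} [CommRing A] [Algebra (PadicAlgCl ℓ) A] {a : A}
    (ha : a ≠ 0) : ∃ f : A →+ ℚ_[ℓ], IsPadicFunctional f ∧ f a = 1 := by
  let _ : Algebra ℚ_[ℓ] A :=
    ((algebraMap (PadicAlgCl ℓ) A).comp (algebraMap ℚ_[ℓ] (PadicAlgCl ℓ))).toAlgebra
  obtain ⟨f, hf⟩ := Module.Projective.exists_dual_eq_one ℚ_[ℓ] ha
  refine ⟨f.toAddMonoidHom, fun c a => ?_, hf⟩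
  have := f.map_smul c a
  rw [Algebra.smul_def] at this
  exact this

theorem IsPadicFunctional.comp_mul {A : Type*} [CommRing A] [Algebra (PadicAlgCl ℓ) A]
    {f : A →+ ℚ_[ℓ]} (hf : IsPadicFunctional f) (b : A) :
    IsPadicFunctional (f.comp (AddMonoidHom.mulLeft b)) := fun c a => by
  simp only [AddMonoidHom.coe_comp, Function.comp_apply, AddMonoidHom.coe_mulLeft]
  rw [mul_left_comm, hf]

theorem IsContinuousMap.continuous_functional {T A : Type*} [TopologicalSpace T] [CommRing A]
    [Algebra (PadicAlgCl ℓ) A] {g : T → A} (hg : IsContinuousMap (ℓ := ℓ) g) {f : A →+ ℚ_[ℓ]}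
    (hf : IsPadicFunctional f) : Continuous fun t => f (g t) := by
  rw [continuous_iff_continuousAt]
  intro t
  obtain ⟨U, hU, m, a, c, hc, h⟩ := hg t
  have h1 : ContinuousOn (fun u => ∑ i, ((c i u : ℤ_[ℓ]) : ℚ_[ℓ]) * f (a i)) U :=
    continuousOn_finsetSum _ fun i _ =>
      (continuous_subtype_val.comp_continuousOn (hc i)).mul continuousOn_const
  refine (h1.continuousAt hU).congr ?_
  filter_upwards [hU] with u hu
  rw [h u hu, map_sum]
  refine Finset.sum_congr rfl fun i _ => ?_
  rw [IsScalarTower.algebraMap_apply ℤ_[ℓ] ℚ_[ℓ] (PadicAlgCl ℓ), hf]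
  rfl

/-- For an L-parameter `φ`, functionals of entries of `C * φ w` are continuous in `w`. -/
theorem IsLParameter.continuous_functional {n : ℕ} {A : Type*} [CommRing A] [Algebra (PadicAlgCl ℓ) A]
    {φ : W p →* GL (Fin n) A} (hφ : IsLParameter (ℓ := ℓ) φ) (C : Matrix (Fin n) (Fin n) A)
    {f : A →+ ℚ_[ℓ]} (hf : IsPadicFunctional f) (i j : Fin n) :
    Continuous fun w => f ((C * (φ w : Matrix (Fin n) (Fin n) A)) i j) := by
  simp only [Matrix.mul_apply, map_sum]
  exact continuous_finsetSum _ fun k _ => (hφ k j).continuous_functional (hf.comp_mul (C i k))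

theorem matrix_eq_of_functional {n : ℕ} {A : Type*} [CommRing A] [Algebra (PadicAlgCl ℓ) A]
    {M N : Matrix (Fin n) (Fin n) A}
    (h : ∀ f : A →+ ℚ_[ℓ], IsPadicFunctional f → ∀ i j, f (M i j) = f (N i j)) : M = N := by
  ext i j
  by_contra hne
  obtain ⟨f, hf, h1⟩ := exists_padicFunctional (ℓ := ℓ) (sub_ne_zero.2 hne)
  rw [map_sub, h f hf, sub_self] at h1
  exact zero_ne_one h1

/-- The scalar of a `ℚ̄_ℓ`-algebra attached to an `ℓ`-adic integer. -/
def padicScalar (ℓ : ℕ) [Fact ℓ.Prime] (A : Type*) [CommRing A] [Algebra (PadicAlgCl ℓ) A] :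
    ℤ_[ℓ] →+* A := (algebraMap (PadicAlgCl ℓ) A).comp (algebraMap ℤ_[ℓ] (PadicAlgCl ℓ))

/-- The `ℓ`-adic power `(1 + Y) ^ z` of a unipotent matrix with `Y ^ K = 0`. -/
def binomPow {n : ℕ} {A : Type*} [CommRing A] [Algebra (PadicAlgCl ℓ) A] (K : ℕ)
    (Y : Matrix (Fin n) (Fin n) A) (z : ℤ_[ℓ]) : Matrix (Fin n) (Fin n) A :=
  ∑ i ∈ Finset.range K, padicScalar ℓ A (Ring.choose z i) • Y ^ i

/-- The binomial theorem: the ranges `K` and `j + 1` differ only by terms in which `Y ^ i` or the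
binomial coefficient vanishes. -/
theorem binomPow_natCast {n : ℕ} {A : Type*} [CommRing A] [Algebra (PadicAlgCl ℓ) A] {K : ℕ}
    {Y : Matrix (Fin n) (Fin n) A} (hY : Y ^ K = 0) (j : ℕ) :
    binomPow K Y (j : ℤ_[ℓ]) = (1 + Y) ^ j := by
  have hlarge : ∀ i, K ≤ i → Y ^ i = 0 := fun i hi => pow_eq_zero_of_le hi hY
  have h1 : (1 + Y) ^ j = ∑ i ∈ Finset.range (j + 1), (j.choose i : A) • Y ^ i := by
    rw [add_comm, (Commute.one_right Y).add_pow]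
    refine Finset.sum_congr rfl fun i _ => ?_
    rw [one_pow, mul_one, Nat.cast_smul_eq_nsmul, nsmul_eq_mul, Nat.cast_comm]
  have h2 : binomPow K Y (j : ℤ_[ℓ]) = ∑ i ∈ Finset.range K, (j.choose i : A) • Y ^ i :=
    Finset.sum_congr rfl fun i _ => by rw [Ring.choose_natCast, map_natCast]
  rw [h1, h2]
  rcases le_total K (j + 1) with h | h
  · refine Finset.sum_subset (Finset.range_mono h) fun i _ hi => ?_
    rw [hlarge i (by simpa using hi), smul_zero]
  · refine (Finset.sum_subset (Finset.range_mono h) fun i _ hi => ?_).symm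
    rw [Nat.choose_eq_zero_of_lt (by simpa using hi), Nat.cast_zero, zero_smul]

theorem IsPadicFunctional.padicScalar_mul {A : Type*} [CommRing A] [Algebra (PadicAlgCl ℓ) A]
    {f : A →+ ℚ_[ℓ]} (hf : IsPadicFunctional f) (z : ℤ_[ℓ]) (a : A) :
    f (padicScalar ℓ A z * a) = z * f a := by
  rw [padicScalar, RingHom.comp_apply, IsScalarTower.algebraMap_apply ℤ_[ℓ] ℚ_[ℓ] (PadicAlgCl ℓ), hf]
  rfl

theorem functional_mul_binomPow {n : ℕ} {A : Type*} [CommRing A] [Algebra (PadicAlgCl ℓ) A] (K : ℕ)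
    (C Y : Matrix (Fin n) (Fin n) A) (z : ℤ_[ℓ]) {f : A →+ ℚ_[ℓ]} (hf : IsPadicFunctional f)
    (a b : Fin n) : f ((C * binomPow K Y z) a b) =
      ∑ i ∈ Finset.range K, ((Ring.choose z i : ℤ_[ℓ]) : ℚ_[ℓ]) * f ((C * Y ^ i) a b) := by
  rw [binomPow, Finset.mul_sum, Matrix.sum_apply, map_sum]
  refine Finset.sum_congr rfl fun i _ => ?_
  rw [Matrix.mul_smul, Matrix.smul_apply, smul_eq_mul, hf.padicScalar_mul]

theorem continuous_functional_mul_binomPow {n : ℕ} {A : Type*} [CommRing A]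
    [Algebra (PadicAlgCl ℓ) A] (K : ℕ) (C Y : Matrix (Fin n) (Fin n) A) {f : A →+ ℚ_[ℓ]}
    (hf : IsPadicFunctional f) (a b : Fin n) :
    Continuous fun z : ℤ_[ℓ] => f ((C * binomPow K Y z) a b) := by
  simp only [functional_mul_binomPow K C Y _ hf]
  exact continuous_finsetSum _ fun i _ =>
    (continuous_subtype_val.comp (PadicInt.continuous_choose i)).mul continuous_const

end LParameter

/-! ### The common monodromy of all parameters trivial on `P` -/

namespace LParameter
open WeilGroup

variable {p ℓ : ℕ} [Fact p.Prime] [Fact ℓ.Prime]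

/-- The exponent is chosen before the parameter. Take integers `j k` such that `x * x₀ ^ j k` is
killed by the `k`-th tame character. Along an ultrafilter these products tend in `U` to a wild
element `y`, and `j k` tends to `z` in `ℤ_ℓ`. Since `φ y = 1`, passing to the limit in `φ (x * x₀ ^
j k)` gives the claim. -/
theorem exists_binomPow_eq (U : Subgroup (inertia p)) (hU : IsOpen (U : Set (inertia p)))
    {x x₀ : inertia p} (hx₀ : x₀ ∈ U) (hx : x ∈ tameClosure U x₀) (K : ℕ) :
    ∃ z : ℤ_[ℓ], ∀ (n : ℕ) (A : Type) [CommRing A] [Algebra (PadicAlgCl ℓ) A]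
      (φ : W p →* GL (Fin n) A), IsLParameter (ℓ := ℓ) φ →
      (∀ w ∈ U, (w : W p) ∈ wildInertia p → φ w = 1) →
      ((φ x₀ : Matrix (Fin n) (Fin n) A) - 1) ^ K = 0 →
      (φ x : Matrix (Fin n) (Fin n) A) * binomPow K ((φ x₀ : Matrix (Fin n) (Fin n) A) - 1) z = 1 := by
  rw [mem_tameClosure] at hx
  have h1 : ∀ k, ∃ j : ℕ, tameChar p k (x * x₀ ^ j) = 1 := by
    intro k
    obtain ⟨j, hj⟩ := (isOfFinOrder_tameChar k x₀).mem_powers_iff_mem_zpowers.2 (inv_mem (hx.2 k))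
    simp only at hj
    exact ⟨j, by rw [map_mul, map_pow, hj, mul_inv_cancel]⟩
  choose j hj using h1
  -- One ultrafilter for both compact spaces, so that the two limits are compatible.
  let 𝒰 : Ultrafilter ℕ := Filter.hyperfilter ℕ
  have h𝒰 : (𝒰 : Filter ℕ) ≤ Filter.atTop := by
    rw [← Nat.cofinite_eq_atTop]
    exact Filter.hyperfilter_le_cofinite
  set z := (𝒰.map fun k => (j k : ℤ_[ℓ])).lim with hz
  have hzlim : Filter.Tendsto (fun k => (j k : ℤ_[ℓ])) 𝒰 (𝓝 z) := Ultrafilter.le_nhds_lim _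
  set y := (𝒰.map fun k => x * x₀ ^ j k).lim with hy
  have hylim : Filter.Tendsto (fun k => x * x₀ ^ j k) 𝒰 (𝓝 y) := Ultrafilter.le_nhds_lim _
  have hyU : y ∈ U := (Subgroup.isClosed_of_isOpen U hU).mem_of_tendsto hylim
    (Filter.Eventually.of_forall fun k => mul_mem hx.1 (pow_mem hx₀ _))
  have hyw : (y : W p) ∈ wildInertia p := by
    refine (mem_wildInertia_iff_tameChar y).2 fun k => ?_
    refine (isClosed_tameChar_mem k {1}).mem_of_tendsto hylim ?_
    refine h𝒰 ?_
    filter_upwards [Filter.eventually_ge_atTop k] with k' hk'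
    obtain ⟨N, hN⟩ := tameChar_eq_pow_of_le (p := p) hk'
    change tameChar p k _ = 1
    rw [hN, hj, one_pow]
  refine ⟨z, fun n A _ _ φ hφ hφU hK => matrix_eq_of_functional (ℓ := ℓ) fun f hf a b => ?_⟩
  set Y := (φ x₀ : Matrix (Fin n) (Fin n) A) - 1 with hY
  have hlim1 := ((continuous_functional_mul_binomPow K (φ x : Matrix (Fin n) (Fin n) A) Y hf a b).tendsto
    z).comp hzlim
  have hlim2 := (((hφ.continuous_functional 1 hf a b).comp continuous_subtype_val).tendsto y).comp hylim
  have heq : ((fun z : ℤ_[ℓ] => f (((φ x : Matrix (Fin n) (Fin n) A) * binomPow K Y z) a b)) ∘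
      fun k => (j k : ℤ_[ℓ])) = (((fun w => f (((1 : Matrix (Fin n) (Fin n) A) * (φ w : Matrix (Fin n) (Fin n) A)) a b)) ∘
        (Subtype.val : inertia p → W p)) ∘ fun k => x * x₀ ^ j k) := by
    funext k
    simp only [Function.comp_apply]
    rw [binomPow_natCast hK, one_mul, hY, add_sub_cancel, Subgroup.coe_mul, Subgroup.coe_pow, map_mul,
      map_pow, Units.val_mul, Units.val_pow_eq_pow_val]
  rw [heq] at hlim1
  have := tendsto_nhds_unique hlim1 hlim2
  rw [this]
  simp only [Function.comp_apply]
  rw [hφU y hyU hyw, one_mul, Units.val_one]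

/-- The exponent `z` is continuous as soon as one nontrivial unipotent power detects it. -/
theorem continuousOn_of_binomPow {n : ℕ} {A : Type} [CommRing A] [Algebra (PadicAlgCl ℓ) A]
    {φ : W p →* GL (Fin n) A} (hφ : IsLParameter (ℓ := ℓ) φ) {Y : Matrix (Fin n) (Fin n) A} {K : ℕ}
    (hK : Y ^ K = 0) (hY : Y ≠ 0) {J : Set (W p)} {z : W p → ℤ_[ℓ]}
    (h : ∀ x ∈ J, (φ x : Matrix (Fin n) (Fin n) A) = binomPow K Y (z x)) : ContinuousOn z J := by
  have hnil : IsNilpotent Y := ⟨K, hK⟩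
  set N := nilpotencyClass Y with hN
  have hN2 : 2 ≤ N := by
    by_contra hlt
    have h1 : Y ^ 1 = 0 := pow_eq_zero_of_le (by omega) (pow_nilpotencyClass hnil)
    exact hY (by rwa [pow_one] at h1)
  have hNK : N ≤ K := Nat.sInf_le hK
  have : Nontrivial (Matrix (Fin n) (Fin n) A) := ⟨Y, 0, hY⟩
  have hne : Y ^ (N - 2 + 1) ≠ 0 := by
    rw [show N - 2 + 1 = N - 1 by omega]
    exact pow_pred_nilpotencyClass hnil
  obtain ⟨a, b, hab⟩ : ∃ a b, (Y ^ (N - 2 + 1)) a b ≠ 0 := by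
    by_contra! hcon
    exact hne (by ext a b; exact hcon a b)
  obtain ⟨f, hf, hf1⟩ := exists_padicFunctional (ℓ := ℓ) hab
  -- With `N` the nilpotency class, `Y ^ (N - 2) (1 + Y) ^ z = Y ^ (N - 2) + z Y ^ (N - 1)`, so a
  -- functional normalized on a nonzero entry of `Y ^ (N - 1)` reads off `z`.
  have key : ∀ x ∈ J, ((z x : ℤ_[ℓ]) : ℚ_[ℓ]) =
      f ((Y ^ (N - 2) * (φ x : Matrix (Fin n) (Fin n) A)) a b) - f ((Y ^ (N - 2)) a b) := by
    intro x hx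
    rw [h x hx, functional_mul_binomPow K _ _ _ hf,
      ← Finset.sum_subset (Finset.range_mono (hN2.trans hNK))]
    · rw [Finset.sum_range_succ, Finset.sum_range_one, Ring.choose_zero_right, Ring.choose_one_right,
        pow_zero, mul_one, pow_one, ← pow_succ, hf1]
      simp
    · intro i _ hi
      have hi2 : 2 ≤ i := not_lt.1 fun h2 => hi (Finset.mem_range.2 h2)
      rw [← pow_add, pow_eq_zero_of_le (show N ≤ N - 2 + i by omega) (pow_nilpotencyClass hnil),
        Matrix.zero_apply, map_zero, mul_zero]
  have hiso : Isometry (fun y : ℤ_[ℓ] => (y : ℚ_[ℓ])) := Isometry.of_dist_eq fun _ _ => rfl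
  rw [hiso.isUniformInducing.isInducing.continuousOn_iff]
  exact ((hφ.continuous_functional _ hf a b).sub continuous_const).continuousOn.congr key

variable (ℓ) in
/-- The common shape of all L-parameters for `GL_n` that are trivial on `P`: on an open subgroup `J`
of inertia, they are `ℓ`-adic powers of the unipotent image of one element `x₀`. -/
structure MonodromyData (n : ℕ) (P : Subgroup (W p)) where
  J : Subgroup (W p)
  x₀ : W p
  z : W p → ℤ_[ℓ]
  K : ℕ
  le_inertia : J ≤ inertia p
  isOpen : IsOpen (J : Set (W p))
  continuousOn : ContinuousOn z J
  pow_eq_zero : ∀ (A : Type) [CommRing A] [Algebra (PadicAlgCl ℓ) A] (φ : W p →* GL (Fin n) A),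
    IsLParameter (ℓ := ℓ) φ → (∀ w ∈ P, φ w = 1) → ((φ x₀ : Matrix (Fin n) (Fin n) A) - 1) ^ K = 0
  eq_binomPow : ∀ (A : Type) [CommRing A] [Algebra (PadicAlgCl ℓ) A] (φ : W p →* GL (Fin n) A),
    IsLParameter (ℓ := ℓ) φ → (∀ w ∈ P, φ w = 1) → ∀ x ∈ J, (φ x : Matrix (Fin n) (Fin n) A) =
      binomPow K ((φ x₀ : Matrix (Fin n) (Fin n) A) - 1) (z x)
  conj_eq_pow : ∀ (A : Type) [CommRing A] [Algebra (PadicAlgCl ℓ) A] (φ : W p →* GL (Fin n) A),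
    (∀ w ∈ P, φ w = 1) → ∀ (w : W p) (d : ℕ),
      degree p w = Multiplicative.ofAdd (d : ℤ) → φ w * φ x₀ * (φ w)⁻¹ = φ x₀ ^ p ^ d

/-- Here `x₀ = τ ^ m`, with `τ` a tame generator of a small open subgroup `U` whose wild part lies
in `P`, and `m` the uniform exponent that makes its image unipotent. The subgroup `J` consists of
the elements of `U` that `x₀` topologically generates modulo wild inertia. -/
theorem nonempty_monodromyData (n : ℕ) (P : Subgroup (W p))
    (hP : IsOpen ((P.subgroupOf (wildInertia p) : Subgroup (wildInertia p)) : Set (wildInertia p))) :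
    Nonempty (MonodromyData ℓ n P) := by
  obtain ⟨O, hO, hOP⟩ := isOpen_induced_iff.1 hP
  have h1O : O ∈ 𝓝 (1 : W p) := hO.mem_nhds (by
    have : (1 : wildInertia p) ∈ Subtype.val ⁻¹' O := hOP ▸ one_mem (P.subgroupOf (wildInertia p))
    exact this)
  obtain ⟨U₀, hU₀n, hU₀o, hU₀I, hU₀O⟩ := exists_open_normal_subgroup h1O
  have hUP : ∀ w ∈ U₀, w ∈ wildInertia p → w ∈ P := by
    intro w hw hww
    have : (⟨w, hww⟩ : wildInertia p) ∈ Subtype.val ⁻¹' O := hU₀O hw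
    rw [hOP] at this
    exact this
  let U : Subgroup (inertia p) := U₀.subgroupOf (inertia p)
  have hU : IsOpen (U : Set (inertia p)) := hU₀o.preimage continuous_subtype_val
  obtain ⟨τ, hτ, hgen⟩ := exists_tame_generator U (Subgroup.isClosed_of_isOpen U hU)
  obtain ⟨m, K, hm, hmK⟩ := Matrix.exists_pow_sub_one_pow_eq_zero n p (Fact.out : p.Prime).one_lt
  obtain ⟨F, hF⟩ := exists_frobenius p
  have hx₀ : τ ^ m ∈ U := pow_mem hτ m
  have hconj : ∀ (A : Type) [CommRing A] [Algebra (PadicAlgCl ℓ) A] (φ : W p →* GL (Fin n) A),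
      (∀ w ∈ P, φ w = 1) → ∀ u ∈ U, ∀ (w : W p) (d : ℕ),
      degree p w = Multiplicative.ofAdd (d : ℤ) → φ w * φ u * (φ w)⁻¹ = φ u ^ p ^ d := by
    intro A _ _ φ hφP u hu w d hw
    -- The tame relation holds up to a wild element, which stays in `U₀` by normality and so lies in
    -- `P`.
    have h1 : w * u * w⁻¹ * ((u : W p) ^ p ^ d)⁻¹ ∈ P :=
      hUP _ (mul_mem (hU₀n.conj_mem _ hu w) (inv_mem (pow_mem hu _)))
        (conj_mul_inv_mem_wildInertia hw u.2)
    have h2 := hφP _ h1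
    rw [map_mul, map_inv, map_mul, map_mul, map_inv, map_pow, mul_inv_eq_one] at h2
    exact h2
  have hpow : ∀ (A : Type) [CommRing A] [Algebra (PadicAlgCl ℓ) A] (φ : W p →* GL (Fin n) A),
      (∀ w ∈ P, φ w = 1) → ((φ (τ ^ m : inertia p) : Matrix (Fin n) (Fin n) A) - 1) ^ K = 0 := by
    intro A _ _ φ hφP
    have := hmK A (φ τ) (φ F) (by simpa using hconj A φ hφP τ hτ F 1 hF)
    rwa [Subgroup.coe_pow, map_pow, Units.val_pow_eq_pow_val]
  have hwild : ∀ (A : Type) [CommRing A] [Algebra (PadicAlgCl ℓ) A] (φ : W p →* GL (Fin n) A),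
      (∀ w ∈ P, φ w = 1) → ∀ w ∈ U, (w : W p) ∈ wildInertia p → φ w = 1 :=
    fun A _ _ φ hφP w hw hww => hφP _ (hUP _ hw hww)
  let J : Subgroup (W p) := (tameClosure U (τ ^ m)).map (inertia p).subtype
  have hJmem : ∀ x ∈ J, ∃ y ∈ tameClosure U (τ ^ m), (y : W p) = x := fun x hx => hx
  have hJo : IsOpen (J : Set (W p)) :=
    isOpen_inertia.isOpenMap_subtype_val _ (isOpen_tameClosure U hU hτ hgen hm)
  have hJI : J ≤ inertia p := by
    rintro _ ⟨y, -, rfl⟩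
    exact y.2
  have hex : ∀ x : W p, ∃ z : ℤ_[ℓ], x ∈ J → ∀ (A : Type) [CommRing A] [Algebra (PadicAlgCl ℓ) A]
      (φ : W p →* GL (Fin n) A), IsLParameter (ℓ := ℓ) φ → (∀ w ∈ P, φ w = 1) →
      (φ x : Matrix (Fin n) (Fin n) A) =
        binomPow K ((φ (τ ^ m : inertia p) : Matrix (Fin n) (Fin n) A) - 1) z := by
    intro x
    by_cases hx : x ∈ J
    · obtain ⟨y, hy, rfl⟩ := hJmem x hx
      -- Applied to `y⁻¹`, because the power found there is the inverse of the image.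
      obtain ⟨z, hz⟩ := exists_binomPow_eq (ℓ := ℓ) U hU hx₀ (inv_mem hy) K
      refine ⟨z, fun _ A _ _ φ hφ hφP => ?_⟩
      have := hz n A φ hφ (hwild A φ hφP) (hpow A φ hφP)
      rw [Subgroup.coe_inv, map_inv] at this
      exact (Units.inv_mul_eq_one.1 this)
    · exact ⟨0, fun h => (hx h).elim⟩
  -- One parameter that is nontrivial at `x₀` shows that the chosen exponents are continuous. If
  -- there is none, the exponents are irrelevant and `0` is taken.
  by_cases htriv : ∃ (A : Type) (_ : CommRing A) (_ : Algebra (PadicAlgCl ℓ) A)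
      (φ : W p →* GL (Fin n) A), IsLParameter (ℓ := ℓ) φ ∧ (∀ w ∈ P, φ w = 1) ∧
      (φ (τ ^ m : inertia p) : Matrix (Fin n) (Fin n) A) - 1 ≠ 0
  · choose z hz using hex
    obtain ⟨A, _, _, φ, hφ, hφP, hne⟩ := htriv
    exact ⟨⟨J, (τ ^ m : inertia p), z, K, hJI, hJo, continuousOn_of_binomPow hφ (hpow A φ hφP) hne
      fun x hx => hz x hx A φ hφ hφP, fun A _ _ φ _ hφP => hpow A φ hφP,
      fun A _ _ φ hφ hφP x hx => hz x hx A φ hφ hφP, fun A _ _ φ hφP => hconj A φ hφP _ hx₀⟩⟩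
  · push Not at htriv
    have hbin : ∀ (A : Type) [CommRing A] [Algebra (PadicAlgCl ℓ) A] (y z : ℤ_[ℓ]),
      binomPow K (0 : Matrix (Fin n) (Fin n) A) y = binomPow K (0 : Matrix (Fin n) (Fin n) A) z := by
      intro A _ _ y z
      refine Finset.sum_congr rfl fun i _ => ?_
      rcases Nat.eq_zero_or_pos i with rfl | hi
      · rw [Ring.choose_zero_right, Ring.choose_zero_right]
      · rw [zero_pow hi.ne', smul_zero, smul_zero]
    refine ⟨⟨J, (τ ^ m : inertia p), fun _ => 0, K, hJI, hJo, continuousOn_const,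
      fun A _ _ φ _ hφP => hpow A φ hφP, fun A _ _ φ hφ hφP x hx => ?_,
      fun A _ _ φ hφP => hconj A φ hφP _ hx₀⟩⟩
    obtain ⟨z, hz⟩ := hex x
    rw [hz hx A φ hφ hφP, htriv A _ _ φ hφ hφP]
    exact hbin A _ _

end LParameter

/-! ### Generation by inertia and Frobenius; the moduli space and its finite type -/

namespace WeilGroup

variable {p : ℕ} [Fact p.Prime]

theorem mul_zpow_inv_mem_inertia {F : W p} (hF : degree p F = Multiplicative.ofAdd (1 : ℤ)) (w : W p) :
    w * (F ^ (degree p w).toAdd)⁻¹ ∈ inertia p := by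
  rw [mem_inertia, map_mul, map_inv, map_zpow, hF, mul_inv_eq_one, ← ofAdd_zsmul]
  simp

theorem subgroup_eq_top {H : Subgroup (W p)} (hI : inertia p ≤ H) {F : W p}
    (hF : degree p F = Multiplicative.ofAdd (1 : ℤ)) (hFH : F ∈ H) : H = ⊤ := by
  rw [eq_top_iff]
  intro w _
  have := H.mul_mem (hI (mul_zpow_inv_mem_inertia hF w)) (H.zpow_mem hFH (degree p w).toAdd)
  rwa [inv_mul_cancel_right] at this

theorem finite_inertia_quotient {J : Subgroup (W p)} (hJ : IsOpen (J : Set (W p))) :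
    Finite (inertia p ⧸ J.subgroupOf (inertia p)) :=
  (J.subgroupOf (inertia p)).quotient_finite_of_isOpen (hJ.preimage continuous_subtype_val)

end WeilGroup

namespace LParameter
open WeilGroup

variable {p ℓ : ℕ} [Fact p.Prime] [Fact ℓ.Prime]

theorem map_padicScalar {A B : Type*} [CommRing A] [Algebra (PadicAlgCl ℓ) A] [CommRing B]
    [Algebra (PadicAlgCl ℓ) B] (f : A →ₐ[PadicAlgCl ℓ] B) (z : ℤ_[ℓ]) :
    f (padicScalar ℓ A z) = padicScalar ℓ B z := f.commutes _

theorem map_binomPow {n : ℕ} {A B : Type*} [CommRing A] [Algebra (PadicAlgCl ℓ) A] [CommRing B]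
    [Algebra (PadicAlgCl ℓ) B] (f : A →ₐ[PadicAlgCl ℓ] B) (K : ℕ) (Y : Matrix (Fin n) (Fin n) A)
    (z : ℤ_[ℓ]) : (f : A →+* B).mapMatrix (binomPow K Y z) =
      binomPow K ((f : A →+* B).mapMatrix Y) z := by
  rw [binomPow, map_sum, binomPow]
  refine Finset.sum_congr rfl fun i _ => ?_
  rw [← map_pow]
  ext a b
  simp [map_padicScalar]

/-- Near `t` one has `φ u = φ t * φ (t⁻¹ u)`, a combination of the fixed matrices `φ t * Y ^ i`
whose coefficients are the binomial functions of `z`, continuous on `ℤ_ℓ`. -/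
theorem isLParameter_of_binomPow {n : ℕ} {A : Type*} [CommRing A] [Algebra (PadicAlgCl ℓ) A]
    {φ : W p →* GL (Fin n) A} {J : Subgroup (W p)} (hJ : IsOpen (J : Set (W p))) {z : W p → ℤ_[ℓ]}
    (hz : ContinuousOn z J) {K : ℕ} {Y : Matrix (Fin n) (Fin n) A}
    (h : ∀ x ∈ J, (φ x : Matrix (Fin n) (Fin n) A) = binomPow K Y (z x)) :
    IsLParameter (ℓ := ℓ) φ := by
  intro a b t
  have hopen : IsOpen ((fun u => t⁻¹ * u) ⁻¹' (J : Set (W p))) :=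
    hJ.preimage (continuous_const.mul continuous_id)
  refine ⟨(fun u => t⁻¹ * u) ⁻¹' (J : Set (W p)), hopen.mem_nhds (by simp), K,
    fun i => ((φ t : Matrix (Fin n) (Fin n) A) * Y ^ (i : ℕ)) a b,
    fun i u => Ring.choose (z (t⁻¹ * u)) (i : ℕ), fun i => ?_, fun u hu => ?_⟩
  · exact (PadicInt.continuous_choose _).comp_continuousOn
      (hz.comp (continuous_const.mul continuous_id).continuousOn fun _ h => h)
  · have h1 : (φ u : Matrix (Fin n) (Fin n) A) =
        (φ t : Matrix (Fin n) (Fin n) A) * binomPow K Y (z (t⁻¹ * u)) := by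
      rw [← h _ hu, ← Units.val_mul, ← map_mul, mul_inv_cancel_left]
    simp only
    rw [h1, binomPow, Finset.mul_sum, Matrix.sum_apply, Finset.sum_range]
    refine Finset.sum_congr rfl fun i _ => ?_
    rw [Matrix.mul_smul, Matrix.smul_apply, smul_eq_mul]
    rfl

theorem isLParameter_of_eq_one {n : ℕ} {A : Type*} [CommRing A] [Algebra (PadicAlgCl ℓ) A]
    {φ : W p →* GL (Fin n) A} {J : Subgroup (W p)} (hJ : IsOpen (J : Set (W p)))
    (h : ∀ x ∈ J, φ x = 1) : IsLParameter (ℓ := ℓ) φ :=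
  isLParameter_of_binomPow hJ (z := fun _ => 0) continuousOn_const (K := 1) (Y := 0) fun x hx => by
    simp [h x hx, binomPow]

theorem IsLParameter.map {n : ℕ} {A B : Type*} [CommRing A] [Algebra (PadicAlgCl ℓ) A] [CommRing B]
    [Algebra (PadicAlgCl ℓ) B] {φ : W p →* GL (Fin n) A} (hφ : IsLParameter (ℓ := ℓ) φ)
    (f : A →ₐ[PadicAlgCl ℓ] B) :
    IsLParameter (ℓ := ℓ) ((Matrix.GeneralLinearGroup.map (f : A →+* B)).comp φ) := by
  intro i j t
  obtain ⟨U, hU, m, a, c, hc, h⟩ := hφ i j t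
  refine ⟨U, hU, m, fun k => f (a k), c, hc, fun u hu => ?_⟩
  have := congrArg f (h u hu)
  rw [map_sum] at this
  simp only [map_mul, AlgHom.commutes] at this
  exact this

section Universal

variable {n : ℕ} {P : Subgroup (W p)} (D : MonodromyData ℓ n P)

/-- The generic matrix attached to `w`. -/
def genericMatrix (ℓ : ℕ) [Fact ℓ.Prime] (n : ℕ) (w : W p) :
    Matrix (Fin n) (Fin n) (MvPolynomial (W p × Fin n × Fin n) (PadicAlgCl ℓ)) :=
  Matrix.of fun i j => MvPolynomial.X (w, i, j)

/-- Differences of matrices whose entries generate the relations of the universal L-parameter. -/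
inductive IsRelator : Matrix (Fin n) (Fin n) (MvPolynomial (W p × Fin n × Fin n) (PadicAlgCl ℓ)) → Prop
  | one : IsRelator (genericMatrix ℓ n (1 : W p) - 1)
  | mul (v w : W p) : IsRelator (genericMatrix ℓ n (v * w) - genericMatrix ℓ n v * genericMatrix ℓ n w)
  | triv (w : W p) (hw : w ∈ P) : IsRelator (genericMatrix ℓ n w - 1)
  | monodromy (x : W p) (hx : x ∈ D.J) :
      IsRelator (genericMatrix ℓ n x - binomPow D.K (genericMatrix ℓ n D.x₀ - 1) (D.z x))

/-- The ideal of relations of the universal L-parameter. -/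
def relationIdeal : Ideal (MvPolynomial (W p × Fin n × Fin n) (PadicAlgCl ℓ)) :=
  Ideal.span {a | ∃ M, IsRelator D M ∧ ∃ i j, a = M i j}

/-- The coordinate ring of the moduli space of L-parameters. -/
abbrev UniversalRing : Type :=
  MvPolynomial (W p × Fin n × Fin n) (PadicAlgCl ℓ) ⧸ relationIdeal D

theorem map_relator {M : Matrix (Fin n) (Fin n) (MvPolynomial (W p × Fin n × Fin n) (PadicAlgCl ℓ))}
    (h : IsRelator D M) :
    ((Ideal.Quotient.mkₐ (PadicAlgCl ℓ) (relationIdeal D) :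
      _ →ₐ[PadicAlgCl ℓ] UniversalRing D) : _ →+* UniversalRing D).mapMatrix M = 0 := by
  ext i j
  exact Ideal.Quotient.eq_zero_iff_mem.2 (Ideal.subset_span ⟨M, h, i, j, rfl⟩)

/-- The universal L-parameter. -/
def universalParam : W p →* GL (Fin n) (UniversalRing D) :=
  MonoidHom.toHomUnits
    { toFun := fun w => ((Ideal.Quotient.mkₐ (PadicAlgCl ℓ) (relationIdeal D) :
        _ →ₐ[PadicAlgCl ℓ] UniversalRing D) : _ →+* UniversalRing D).mapMatrix (genericMatrix ℓ n w)
      map_one' := by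
        have := map_relator D IsRelator.one
        rwa [map_sub, map_one, sub_eq_zero] at this
      map_mul' := fun v w => by
        have := map_relator D (IsRelator.mul v w)
        rwa [map_sub, map_mul, sub_eq_zero] at this }

/-- The moduli space of L-parameters trivial on `P`. -/
def universalModuliSpace : ModuliSpace ℓ n P where
  R := UniversalRing D
  univ := universalParam D
  isLParameter := by
    -- Continuity is not an algebraic condition; the monodromy relators encode it.
    refine isLParameter_of_binomPow D.isOpen D.continuousOn (K := D.K)
      (Y := (universalParam D D.x₀ : Matrix (Fin n) (Fin n) (UniversalRing D)) - 1) fun x hx => ?_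
    have := map_relator D (IsRelator.monodromy x hx)
    rw [map_sub, sub_eq_zero, map_binomPow, map_sub, map_one] at this
    exact this
  trivial_on := fun w hw => by
    have := map_relator D (IsRelator.triv w hw)
    rw [map_sub, sub_eq_zero, map_one] at this
    exact Units.ext this
  existsUnique := by
    intro A _ _ φ hφ hφP
    let g : MvPolynomial (W p × Fin n × Fin n) (PadicAlgCl ℓ) →ₐ[PadicAlgCl ℓ] A :=
      MvPolynomial.aeval fun x => (φ x.1 : Matrix (Fin n) (Fin n) A) x.2.1 x.2.2
    have hg : ∀ w, (g : _ →+* A).mapMatrix (genericMatrix ℓ n w) = (φ w : Matrix (Fin n) (Fin n) A) := by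
      intro w
      ext i j
      exact MvPolynomial.aeval_X _ _
    have hrel : ∀ M, IsRelator D M → (g : _ →+* A).mapMatrix M = 0 := by
      intro M hM
      cases hM with
      | one => rw [map_sub, hg, map_one, map_one, Units.val_one, sub_self]
      | mul v w => rw [map_sub, map_mul, hg, hg, hg, map_mul, Units.val_mul, sub_self]
      | triv w hw => rw [map_sub, hg, map_one, hφP w hw, Units.val_one, sub_self]
      | monodromy x hx =>
        rw [map_sub, hg, map_binomPow, map_sub, hg, map_one, D.eq_binomPow A φ hφ hφP x hx, sub_self]
    have hker : ∀ a ∈ relationIdeal D, g a = 0 := by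
      intro a ha
      have : relationIdeal D ≤ RingHom.ker g := by
        refine Ideal.span_le.2 ?_
        rintro _ ⟨M, hM, i, j, rfl⟩
        exact congrFun (congrFun (hrel M hM) i) j
      exact this ha
    refine ⟨Ideal.Quotient.liftₐ _ g hker, fun w => ?_, fun f hf => ?_⟩
    · refine Units.ext ?_
      rw [← hg w]
      rfl
    · refine Ideal.Quotient.algHom_ext _ (MvPolynomial.algHom_ext fun x => ?_)
      have h1 := congrArg Units.val (hf x.1)
      have h2 := congrFun (congrFun h1 x.2.1) x.2.2
      refine h2.trans ?_
      exact (MvPolynomial.aeval_X (R := PadicAlgCl ℓ)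
        (fun x : W p × Fin n × Fin n => (φ x.1 : Matrix (Fin n) (Fin n) A) x.2.1 x.2.2) x).symm

end Universal

theorem nonempty_moduliSpace (n : ℕ) (P : Subgroup (W p))
    (hP : IsOpen ((P.subgroupOf (wildInertia p) : Subgroup (wildInertia p)) : Set (wildInertia p))) :
    Nonempty (ModuliSpace ℓ n P) :=
  (nonempty_monodromyData n P hP).map universalModuliSpace

namespace ModuliSpace

variable {n : ℕ} {P : Subgroup (W p)} (X : ModuliSpace ℓ n P)

theorem hom_ext {A : Type} [CommRing A] [Algebra (PadicAlgCl ℓ) A] {f g : X.R →ₐ[PadicAlgCl ℓ] A}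
    (h : ∀ w, X.param f w = X.param g w) : f = g := by
  have hP : ∀ w ∈ P, X.param g w = 1 := fun w hw => by
    change Matrix.GeneralLinearGroup.map (g : X.R →+* A) (X.univ w) = 1
    rw [X.trivial_on w hw, map_one]
  exact (X.existsUnique A (X.param g) (X.isLParameter.map g) hP).unique h fun _ => rfl

theorem param_point {A : Type} [CommRing A] [Algebra (PadicAlgCl ℓ) A] (φ : W p →* GL (Fin n) A)
    (hφ : IsLParameter (ℓ := ℓ) φ) (hP : ∀ w ∈ P, φ w = 1) : X.param (X.point φ hφ hP) = φ :=
  MonoidHom.ext (X.existsUnique A φ hφ hP).choose_spec.1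

theorem coe_param {A : Type} [CommRing A] [Algebra (PadicAlgCl ℓ) A] (f : X.R →ₐ[PadicAlgCl ℓ] A)
    (w : W p) : (X.param f w : Matrix (Fin n) (Fin n) A) =
      (f : X.R →+* A).mapMatrix (X.univ w : Matrix (Fin n) (Fin n) X.R) := rfl

/-- Let `S` be generated by the entries at Frobenius, at `x₀`, at representatives of inertia modulo
`J`, and at the needed inverses. On `J` the entries are polynomials in those at `x₀`, so the
universal parameter is defined over `S`. The universal property gives a map `R → S` whose composite
with the inclusion is the identity, hence `S` is everything. -/
theorem finiteType (D : MonodromyData ℓ n P) : Algebra.FiniteType (PadicAlgCl ℓ) X.R := by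
  obtain ⟨F, hF⟩ := exists_frobenius p
  have hfin := finite_inertia_quotient D.isOpen
  let T : Set (W p) := {F, F⁻¹, D.x₀} ∪ Set.range (fun q : inertia p ⧸ D.J.subgroupOf (inertia p) =>
    ((q.out : inertia p) : W p)) ∪ Set.range (fun q : inertia p ⧸ D.J.subgroupOf (inertia p) =>
    ((q.out : inertia p) : W p)⁻¹)
  have hT : T.Finite := ((Set.toFinite _).union (Set.finite_range _)).union (Set.finite_range _)
  let E : Set X.R := ⋃ w ∈ T, Set.range fun ij : Fin n × Fin n =>
    (X.univ w : Matrix (Fin n) (Fin n) X.R) ij.1 ij.2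
  have hE : E.Finite := hT.biUnion fun _ _ => Set.finite_range _
  let S := Algebra.adjoin (PadicAlgCl ℓ) E
  let good : Set (Matrix (Fin n) (Fin n) X.R) := {M | ∀ i j, M i j ∈ S}
  have good_mul : ∀ M N, M ∈ good → N ∈ good → M * N ∈ good := fun M N hM hN i j => by
    rw [Matrix.mul_apply]
    exact S.sum_mem fun k _ => S.mul_mem (hM i k) (hN k j)
  have good_one : (1 : Matrix (Fin n) (Fin n) X.R) ∈ good := fun i j => by
    rw [Matrix.one_apply]
    split_ifs
    exacts [S.one_mem, S.zero_mem]
  have good_pow : ∀ M, M ∈ good → ∀ k : ℕ, M ^ k ∈ good := fun M hM k => by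
    induction k with
    | zero => rwa [pow_zero]
    | succ k ih => rw [pow_succ]; exact good_mul _ _ ih hM
  have hTgood : ∀ w ∈ T, (X.univ w : Matrix (Fin n) (Fin n) X.R) ∈ good := fun w hw i j =>
    Algebra.subset_adjoin (Set.mem_biUnion hw ⟨(i, j), rfl⟩)
  let H : Subgroup (W p) :=
    { carrier := {w | (X.univ w : Matrix (Fin n) (Fin n) X.R) ∈ good ∧
        (X.univ w⁻¹ : Matrix (Fin n) (Fin n) X.R) ∈ good}
      one_mem' := by simpa using good_one
      mul_mem' := fun {v w} hv hw => by
        refine ⟨?_, ?_⟩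
        · rw [map_mul, Units.val_mul]; exact good_mul _ _ hv.1 hw.1
        · rw [mul_inv_rev, map_mul, Units.val_mul]; exact good_mul _ _ hw.2 hv.2
      inv_mem' := fun {v} hv => ⟨hv.2, by rw [inv_inv]; exact hv.1⟩ }
  have hJgood : ∀ x ∈ D.J, (X.univ x : Matrix (Fin n) (Fin n) X.R) ∈ good := by
    intro x hx i j
    rw [D.eq_binomPow X.R X.univ X.isLParameter X.trivial_on x hx, binomPow, Matrix.sum_apply]
    refine S.sum_mem fun k _ => ?_
    rw [Matrix.smul_apply, smul_eq_mul]
    refine S.mul_mem (S.algebraMap_mem _) (good_pow _ (fun i j => ?_) k i j)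
    exact S.sub_mem (hTgood _ (Or.inl (Or.inl (by simp))) i j) (good_one i j)
  have hJH : D.J ≤ H := fun x hx => ⟨hJgood x hx, hJgood _ (inv_mem hx)⟩
  have hIH : inertia p ≤ H := by
    intro y hy
    let q : inertia p ⧸ D.J.subgroupOf (inertia p) := QuotientGroup.mk ⟨y, hy⟩
    have h1 : ((q.out : inertia p) : W p) ∈ H :=
      ⟨hTgood _ (Or.inl (Or.inr ⟨q, rfl⟩)), hTgood _ (Or.inr ⟨q, rfl⟩)⟩
    have h2 : (q.out)⁻¹ * ⟨y, hy⟩ ∈ D.J.subgroupOf (inertia p) :=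
      QuotientGroup.eq.1 (Quotient.out_eq' q)
    have := H.mul_mem h1 (hJH h2)
    simpa using this
  have htop : H = ⊤ := subgroup_eq_top hIH hF
    ⟨hTgood _ (Or.inl (Or.inl (by simp))), hTgood _ (Or.inl (Or.inl (by simp)))⟩
  have hall : ∀ w, (X.univ w : Matrix (Fin n) (Fin n) X.R) ∈ good := fun w =>
    (show w ∈ H from htop ▸ Subgroup.mem_top w).1
  have hinj : Function.Injective ((S.val : S →+* X.R).mapMatrix :
      Matrix (Fin n) (Fin n) S →+* Matrix (Fin n) (Fin n) X.R) := fun M N h => by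
    ext i j
    exact congrFun (congrFun h i) j
  let lift (w : W p) : Matrix (Fin n) (Fin n) S := Matrix.of fun i j => ⟨_, hall w i j⟩
  have hlift : ∀ w, (S.val : S →+* X.R).mapMatrix (lift w) = (X.univ w : Matrix (Fin n) (Fin n) X.R) :=
    fun w => rfl
  let φ : W p →* GL (Fin n) S := MonoidHom.toHomUnits
    { toFun := lift
      map_one' := hinj (by rw [hlift, map_one, map_one, Units.val_one])
      map_mul' := fun v w => hinj (by rw [map_mul, hlift, hlift, hlift, map_mul, Units.val_mul]) }
  have hφ : ∀ w, (φ w : Matrix (Fin n) (Fin n) S) = lift w := fun w => rfl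
  have hφL : IsLParameter (ℓ := ℓ) φ := by
    refine isLParameter_of_binomPow D.isOpen D.continuousOn (K := D.K)
      (Y := (φ D.x₀ : Matrix (Fin n) (Fin n) S) - 1) fun x hx => hinj ?_
    rw [map_binomPow, map_sub, map_one, hφ, hφ, hlift, hlift]
    exact D.eq_binomPow X.R X.univ X.isLParameter X.trivial_on x hx
  have hφP : ∀ w ∈ P, φ w = 1 := fun w hw => Units.ext (hinj (by
    rw [hφ, hlift, X.trivial_on w hw, Units.val_one, Units.val_one, map_one]))
  let f : X.R →ₐ[PadicAlgCl ℓ] S := X.point φ hφL hφP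
  have hf : S.val.comp f = AlgHom.id _ _ := by
    refine X.hom_ext fun w => Units.ext ?_
    have h1 : (X.param f w : Matrix (Fin n) (Fin n) S) = lift w := by
      rw [show X.param f = φ from X.param_point φ hφL hφP]
      rfl
    change (S.val : S →+* X.R).mapMatrix (X.param f w : Matrix (Fin n) (Fin n) S) = X.univ w
    rw [h1, hlift]
  refine ⟨⟨hE.toFinset, ?_⟩⟩
  rw [Set.Finite.coe_toFinset, eq_top_iff]
  intro a _
  have := DFunLike.congr_fun hf a
  rw [AlgHom.comp_apply, AlgHom.id_apply] at this
  rw [← this]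
  exact (f a).2

end ModuliSpace

end LParameter

/-! ### Triviality on an open subgroup of wild inertia -/

namespace LParameter
open WeilGroup

variable {p ℓ : ℕ} [Fact p.Prime] [Fact ℓ.Prime]

theorem IsContinuousMap.continuous {T : Type*} [TopologicalSpace T] {f : T → PadicAlgCl ℓ}
    (hf : IsContinuousMap (ℓ := ℓ) f) : Continuous f := by
  rw [continuous_iff_continuousAt]
  intro t
  obtain ⟨U, hU, m, a, c, hc, h⟩ := hf t
  have hcont : Continuous fun x : ℤ_[ℓ] => algebraMap ℤ_[ℓ] (PadicAlgCl ℓ) x := by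
    have h1 : (fun x : ℤ_[ℓ] => algebraMap ℤ_[ℓ] (PadicAlgCl ℓ) x) =
        algebraMap ℚ_[ℓ] (PadicAlgCl ℓ) ∘ fun x : ℤ_[ℓ] => (x : ℚ_[ℓ]) := by
      funext x
      exact IsScalarTower.algebraMap_apply ℤ_[ℓ] ℚ_[ℓ] (PadicAlgCl ℓ) x
    rw [h1]
    exact (continuous_algebraMap ℚ_[ℓ] (PadicAlgCl ℓ)).comp continuous_subtype_val
  have h2 : ContinuousOn (fun u => ∑ i, algebraMap ℤ_[ℓ] (PadicAlgCl ℓ) (c i u) * a i) U :=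
    continuousOn_finsetSum _ fun i _ => (hcont.comp_continuousOn (hc i)).mul continuousOn_const
  refine (h2.continuousAt hU).congr ?_
  filter_upwards [hU] with u hu
  rw [h u hu]
  rfl

theorem norm_mul_apply_le {n : ℕ} {A B : Matrix (Fin n) (Fin n) (PadicAlgCl ℓ)} {a b : ℝ}
    (ha : 0 ≤ a) (hb : 0 ≤ b) (hA : ∀ i j, ‖A i j‖ ≤ a) (hB : ∀ i j, ‖B i j‖ ≤ b) (i j : Fin n) :
    ‖(A * B) i j‖ ≤ a * b := by
  rw [Matrix.mul_apply]
  refine IsUltrametricDist.norm_sum_le_of_forall_le_of_nonneg (mul_nonneg ha hb) fun k _ => ?_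
  rw [norm_mul]
  exact mul_le_mul (hA i k) (hB k j) (norm_nonneg _) ha

/-- The first-order expansion of the power: the remainder is quadratic in `Y`, with integral
coefficients. -/
theorem norm_one_add_pow_sub_le {n : ℕ} {Y : Matrix (Fin n) (Fin n) (PadicAlgCl ℓ)} {c : ℝ}
    (hc : 0 ≤ c) (hc1 : c ≤ 1) (hY : ∀ i j, ‖Y i j‖ ≤ c) (M : ℕ) :
    ∀ i j, ‖((1 + Y) ^ M - 1 - (M : PadicAlgCl ℓ) • Y) i j‖ ≤ c * c := by
  induction M with
  | zero => intro i j; simpa using mul_nonneg hc hc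
  | succ M ih =>
    intro i j
    set Z := (1 + Y) ^ M - 1 - (M : PadicAlgCl ℓ) • Y with hZ
    have e : (1 + Y) ^ (M + 1) - 1 - ((M + 1 : ℕ) : PadicAlgCl ℓ) • Y =
        (M : PadicAlgCl ℓ) • (Y * Y) + (Z + Z * Y) := by
      have : (1 + Y) ^ M = 1 + (M : PadicAlgCl ℓ) • Y + Z := by rw [hZ]; abel
      rw [pow_succ, this]
      push_cast
      simp only [add_mul, mul_add, mul_one, one_mul, add_smul, one_smul, Matrix.smul_mul]
      abel
    rw [e, Matrix.add_apply, Matrix.add_apply, Matrix.smul_apply]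
    refine (IsUltrametricDist.norm_add_le_max _ _).trans (max_le ?_
      ((IsUltrametricDist.norm_add_le_max _ _).trans (max_le (ih i j) ?_)))
    · rw [smul_eq_mul, norm_mul]
      refine (mul_le_mul ?_ (norm_mul_apply_le hc hc hY hY i j) (norm_nonneg _) zero_le_one).trans
        (one_mul _).le
      rw [← map_natCast (algebraMap ℚ_[ℓ] (PadicAlgCl ℓ)), PadicAlgCl.norm_extends]
      exact_mod_cast Padic.norm_int_le_one (M : ℤ)
    · refine (norm_mul_apply_le (mul_nonneg hc hc) hc ih hY i j).trans ?_
      exact mul_le_of_le_one_right (mul_nonneg hc hc) hc1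

/-- Powers prime to `ℓ` of a matrix close to `1` do not come closer to `1`. -/
theorem eq_zero_of_pow_close {n : ℕ} {Y : Matrix (Fin n) (Fin n) (PadicAlgCl ℓ)}
    (hY : ∀ i j, ‖Y i j‖ < 1) (h : ∀ c : ℝ, 0 < c → ∃ M : ℕ, ¬ ℓ ∣ M ∧
      ∀ i j, ‖((1 + Y) ^ M - 1) i j‖ < c) : Y = 0 := by
  by_contra hne
  obtain ⟨i₀, j₀, h0⟩ : ∃ i j, Y i j ≠ 0 := by
    by_contra! hcon
    exact hne (by ext i j; exact hcon i j)
  have : Nonempty (Fin n × Fin n) := ⟨(i₀, j₀)⟩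
  obtain ⟨⟨a, b⟩, hab⟩ := Finite.exists_max fun ij : Fin n × Fin n => ‖Y ij.1 ij.2‖
  set c := ‖Y a b‖ with hc
  have hcpos : 0 < c := (norm_pos_iff.2 h0).trans_le (hab (i₀, j₀))
  have hc1 : c < 1 := hY a b
  -- Here `c` is the largest entry norm of `Y`. As `M` is a unit, `M Y` has an entry of norm `c`,
  -- but it is a sum of two terms of norm less than `c`.
  obtain ⟨M, hM, hlt⟩ := h c hcpos
  have hnM : ‖(M : PadicAlgCl ℓ)‖ = 1 := by
    rw [← map_natCast (algebraMap ℚ_[ℓ] (PadicAlgCl ℓ)), PadicAlgCl.norm_extends]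
    exact Padic.norm_natCast_eq_one_iff.2 ((Nat.Prime.coprime_iff_not_dvd Fact.out).2 hM)
  have h1 := norm_one_add_pow_sub_le hcpos.le hc1.le (fun i j => hab (i, j)) M a b
  have h2 : ‖(M : PadicAlgCl ℓ) * Y a b‖ < c := by
    have e : (M : PadicAlgCl ℓ) * Y a b = ((1 + Y) ^ M - 1) a b +
        -(((1 + Y) ^ M - 1 - (M : PadicAlgCl ℓ) • Y) a b) := by
      rw [Matrix.sub_apply (_ - 1), Matrix.smul_apply, smul_eq_mul]
      ring
    rw [e]
    refine (IsUltrametricDist.norm_add_le_max _ _).trans_lt (max_lt (hlt a b) ?_)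
    rw [norm_neg]
    exact h1.trans_lt (mul_lt_of_lt_one_right hcpos hc1)
  rw [norm_mul, hnM, one_mul] at h2
  exact lt_irrefl _ h2

/-- The powers `w ^ p ^ k` of a wild element come arbitrarily close to `1`, while powers prime to
`ℓ` of a matrix near `1` come no closer. This is where `ℓ ≠ p` enters. -/
theorem exists_open_trivial (hℓp : ℓ ≠ p) {n : ℕ} (φ : W p →* GL (Fin n) (PadicAlgCl ℓ))
    (hφ : IsLParameter (ℓ := ℓ) φ) :
    ∃ U : Subgroup (W p), IsOpen (U : Set (W p)) ∧ ∀ w ∈ U, w ∈ wildInertia p → φ w = 1 := by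
  have hnhds : ∀ c : ℝ, 0 < c → {w : W p | ∀ i j,
      ‖((φ w : Matrix (Fin n) (Fin n) (PadicAlgCl ℓ)) - 1) i j‖ < c} ∈ 𝓝 (1 : W p) := by
    intro c hc
    have : {w : W p | ∀ i j, ‖((φ w : Matrix (Fin n) (Fin n) (PadicAlgCl ℓ)) - 1) i j‖ < c} =
        ⋂ i, ⋂ j, {w | ‖((φ w : Matrix (Fin n) (Fin n) (PadicAlgCl ℓ)) - 1) i j‖ < c} := by
      ext w
      simp
    rw [this]
    refine Filter.iInter_mem.2 fun i => Filter.iInter_mem.2 fun j => ?_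
    have hcont : Continuous fun w => ‖((φ w : Matrix (Fin n) (Fin n) (PadicAlgCl ℓ)) - 1) i j‖ :=
      ((hφ i j).continuous.sub continuous_const).norm
    refine (isOpen_Iio.preimage hcont).mem_nhds ?_
    simpa using hc
  obtain ⟨U, -, hUo, -, hU⟩ := exists_open_normal_subgroup (hnhds 1 one_pos)
  refine ⟨U, hUo, fun w hw hww => Units.ext ?_⟩
  have h1 : (φ w : Matrix (Fin n) (Fin n) (PadicAlgCl ℓ)) - 1 = 0 := by
    refine eq_zero_of_pow_close (hU hw) fun c hc => ?_
    obtain ⟨k, hk⟩ := exists_pow_mem_of_wild hww (hnhds c hc)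
    refine ⟨p ^ k, fun hdvd => hℓp ?_, ?_⟩
    · exact (Nat.prime_dvd_prime_iff_eq Fact.out Fact.out).1
        ((Fact.out : ℓ.Prime).dvd_of_dvd_pow hdvd)
    · rw [add_sub_cancel, ← Units.val_pow_eq_pow_val, ← map_pow]
      exact hk
  exact sub_eq_zero.1 h1

end LParameter

/-! ### The truncated logarithm -/

open Polynomial in
/-- The truncated logarithm series `∑_{0 < i < K} (-1) ^ (i + 1) X ^ i / i`. -/
def truncLog (k : Type*) [Field k] (K : ℕ) : k[X] :=
  ∑ i ∈ Finset.range K, C ((-1) ^ (i + 1) / (i : k)) * X ^ i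

namespace truncLog

open Polynomial

variable (k : Type*) [Field k] (K : ℕ)

theorem coeff_eq (i : ℕ) (hi : i < K) : (truncLog k K).coeff i = (-1) ^ (i + 1) / (i : k) := by
  rw [truncLog, finsetSum_coeff, Finset.sum_eq_single i]
  · simp
  · intro j _ hj
    rw [coeff_C_mul_X_pow, if_neg (Ne.symm hj)]
  · intro h
    exact absurd (Finset.mem_range.2 hi) h

theorem aeval_conj {k B : Type*} [Field k] [Ring B] [Algebra k B] (g : Bˣ) (Y : B) (f : k[X]) :
    aeval (g * Y * (g⁻¹ : Bˣ)) f = g * aeval Y f * (g⁻¹ : Bˣ) := by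
  induction f using Polynomial.induction_on' with
  | add f h hf hh => rw [map_add, map_add, hf, hh, mul_add, add_mul]
  | monomial i c =>
    rw [aeval_monomial, aeval_monomial, Units.conj_pow, ← mul_assoc, ← mul_assoc, ← mul_assoc,
      Algebra.commutes]

variable [CharZero k]

theorem one_add_X_mul_derivative :
    (1 + X) * derivative (truncLog k (K + 1)) = 1 - (-X) ^ K := by
  rw [truncLog, Finset.sum_range_succ', Nat.cast_zero, div_zero, C_0, zero_mul, add_zero,
    derivative_sum]
  have h1 : ∀ i ∈ Finset.range K, derivative (C ((-1) ^ (i + 1 + 1) / ((i + 1 : ℕ) : k)) * X ^ (i + 1)) =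
      (-X : k[X]) ^ i := by
    intro i _
    have hi : ((i + 1 : ℕ) : k) ≠ 0 := Nat.cast_ne_zero.2 i.succ_ne_zero
    rw [derivative_C_mul, derivative_X_pow, ← mul_assoc, ← C_mul, div_mul_cancel₀ _ hi,
      neg_pow (X : k[X]), pow_add, pow_add]
    simp
  rw [Finset.sum_congr rfl h1]
  have := mul_neg_geom_sum (-X : k[X]) K
  rw [← this]
  ring

/-- The identity `log ((1 + X) ^ q) = q log (1 + X)` modulo `X ^ (K + 1)`: both sides vanish at `0`
and their derivatives agree modulo `X ^ K`, which suffices in characteristic zero. -/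
theorem X_pow_dvd (q : ℕ) :
    (X : k[X]) ^ (K + 1) ∣ (truncLog k (K + 1)).comp ((1 + X) ^ q - 1) - C (q : k) * truncLog k (K + 1) := by
  set L := truncLog k (K + 1) with hL
  set Z : k[X] := (1 + X) ^ q - 1 with hZ
  set D := L.comp Z - C (q : k) * L with hD
  have hXZ : X ∣ Z := by
    rw [X_dvd_iff, hZ, coeff_zero_eq_eval_zero]
    simp
  have hZ' : (1 + X) * derivative Z = C (q : k) * (1 + Z) := by
    rcases Nat.eq_zero_or_pos q with rfl | hq
    · simp [hZ]
    · rw [hZ, derivative_sub, derivative_one, sub_zero, derivative_pow]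
      simp only [derivative_add, derivative_one, derivative_X, zero_add, mul_one]
      rw [mul_left_comm, ← pow_succ', Nat.sub_add_cancel hq]
      ring
  have hD' : (1 + X) * derivative D = C (q : k) * ((-X) ^ K - (-Z) ^ K) := by
    have h1 := one_add_X_mul_derivative k K
    have h2 := congrArg (fun f : k[X] => f.comp Z) h1
    simp only [mul_comp, add_comp, sub_comp, one_comp, X_comp, pow_comp, neg_comp] at h2
    rw [hD, derivative_sub, derivative_C_mul, derivative_comp, mul_sub]
    calc (1 + X) * (derivative Z * (derivative L).comp Z) - (1 + X) * (C (q : k) * derivative L)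
        = ((1 + X) * derivative Z) * (derivative L).comp Z - C (q : k) * ((1 + X) * derivative L) := by
          ring
      _ = C (q : k) * ((1 + Z) * (derivative L).comp Z) - C (q : k) * ((1 + X) * derivative L) := by
          rw [hZ']; ring
      _ = _ := by rw [h1, h2]; ring
  have hdvd : (X : k[X]) ^ K ∣ derivative D := by
    have hcop : IsCoprime ((X : k[X]) ^ K) (1 + X) := IsCoprime.pow_left ⟨-1, 1, by ring⟩
    refine hcop.dvd_of_dvd_mul_left ?_
    rw [hD']
    refine Dvd.dvd.mul_left (dvd_sub ?_ ?_) _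
    · rw [neg_pow]; exact Dvd.intro_left _ rfl
    · rw [neg_pow]; exact (pow_dvd_pow_of_dvd hXZ K).mul_left _
  rw [X_pow_dvd_iff] at hdvd ⊢
  intro i hi
  rcases i with _ | i
  · have hZ0 : eval 0 Z = 0 := by rw [← coeff_zero_eq_eval_zero]; exact X_dvd_iff.1 hXZ
    have hL0 : eval 0 L = 0 := by
      rw [← coeff_zero_eq_eval_zero, hL, coeff_eq k _ _ (Nat.succ_pos K)]
      simp
    rw [coeff_zero_eq_eval_zero, hD, eval_sub, eval_comp, hZ0, eval_mul, hL0]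
    simp
  · have := hdvd i (by omega)
    rw [coeff_derivative] at this
    exact (mul_eq_zero.1 this).resolve_right (by exact_mod_cast i.succ_ne_zero)

variable {k} {B : Type*} [Ring B] [Algebra k B] {K}

theorem aeval_pow_sub_one {Y : B} (hY : Y ^ (K + 1) = 0) (q : ℕ) :
    aeval ((1 + Y) ^ q - 1) (truncLog k (K + 1)) = (q : k) • aeval Y (truncLog k (K + 1)) := by
  obtain ⟨c, hc⟩ := X_pow_dvd k K q
  have := congrArg (aeval Y) hc
  rw [map_sub, map_mul, map_mul, aeval_comp, map_pow, aeval_X, hY, zero_mul, sub_eq_zero, aeval_C,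
    ← Algebra.smul_def] at this
  simpa using this

/-- The logarithm is `Y` times one plus a nilpotent, so what kills `log (1 + Y)` kills `Y`. The
length `K + 2` ensures that the linear term is present. -/
theorem exists_mul_eq {Y : B} (hY : Y ^ (K + 2) = 0) :
    ∃ V : B, aeval Y (truncLog k (K + 2)) * V = Y := by
  set L := truncLog k (K + 2) with hL
  have hL0 : L.coeff 0 = 0 := by rw [hL, coeff_eq k _ _ (by omega)]; simp
  have hL1 : L.coeff 1 = 1 := by rw [hL, coeff_eq k _ _ (by omega)]; simp
  have h1 : L = X * (X * L.divX.divX + 1) := by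
    have e1 := divX_mul_X_add L
    have e2 := divX_mul_X_add L.divX
    rw [hL0, C_0, add_zero] at e1
    rw [coeff_divX, zero_add, hL1, C_1] at e2
    rw [mul_comm X L.divX.divX, e2, mul_comm, e1]
  have h2 : aeval Y L = Y * (Y * aeval Y L.divX.divX + 1) := by
    conv_lhs => rw [h1]
    simp
  have hcomm : Commute Y (aeval Y L.divX.divX) := by
    have : aeval Y (X * L.divX.divX) = aeval Y (L.divX.divX * X) := by rw [mul_comm]
    simpa [Commute, SemiconjBy] using this
  have hunit : IsUnit (Y * aeval Y L.divX.divX + 1) :=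
    (hcomm.isNilpotent_mul_right ⟨_, hY⟩).isUnit_add_one
  obtain ⟨u, hu⟩ := hunit
  exact ⟨(u⁻¹ : Bˣ), by rw [h2, ← hu, Units.mul_inv_cancel_right]⟩

end truncLog

/-! ### Density for inequivalent irreducible representations -/

namespace LParameter

section Density

variable {k G : Type*} [Field k] [Group G]

/-- The action of the group algebra attached to a homomorphism to `GL_n(A)`. -/
def algAct (k : Type*) [Field k] {G : Type*} [Group G] {n : ℕ} {A : Type*} [CommRing A] [Algebra k A]
    (φ : G →* GL (Fin n) A) : k[G] →ₐ[k] Matrix (Fin n) (Fin n) A :=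
  MonoidAlgebra.lift k _ G ((Units.coeHom _).comp φ)

theorem algAct_single {n : ℕ} {A : Type*} [CommRing A] [Algebra k A] (φ : G →* GL (Fin n) A) (g : G)
    (c : k) : algAct k φ (MonoidAlgebra.single g c) = c • (φ g : Matrix (Fin n) (Fin n) A) := by
  simp [algAct]

theorem toRep_asAlgebraHom {n : ℕ} (φ : G →* GL (Fin n) k) (b : k[G]) :
    (toRep φ).asAlgebraHom b = Matrix.toLin' (algAct k φ b) := by
  have : (toRep φ).asAlgebraHom = (Matrix.toLinAlgEquiv'.toAlgHom).comp (algAct k φ) := by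
    refine MonoidAlgebra.algHom_ext (fun g => ?_) (Subsingleton.elim _ _)
    rw [Representation.asAlgebraHom_single, one_smul, AlgHom.comp_apply, algAct_single, one_smul]
    rfl
  rw [this]
  rfl

theorem smul_asModule {n : ℕ} (φ : G →* GL (Fin n) k) (b : k[G]) (v : (toRep φ).asModule) :
    (b • v : (toRep φ).asModule) = (algAct k φ b).mulVec v := by
  have h := (toRep φ).asModuleEquiv_map_smul b v
  rw [toRep_asAlgebraHom] at h
  exact h

/-- By Schur's lemma the endomorphisms of the sum of the `V i` are tuples of scalars, so every tuple
`M` commutes with them. Jacobson density realizes it on the finitely many basis vectors. -/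
theorem exists_algAct_eq [IsAlgClosed k] {ι : Type*} [Finite ι] {d : ι → ℕ}
    (ψ : ∀ i, G →* GL (Fin (d i)) k) (hirr : ∀ i, (toRep (ψ i)).IsIrreducible)
    (hne : ∀ i j, i ≠ j → ¬ Nonempty ((toRep (ψ i)).Equiv (toRep (ψ j))))
    (M : ∀ i, Matrix (Fin (d i)) (Fin (d i)) k) : ∃ b : k[G], ∀ i, algAct k (ψ i) b = M i := by
  classical
  have := Fintype.ofFinite ι
  let V : ι → Type _ := fun i => (toRep (ψ i)).asModule
  have hsimple : ∀ i, IsSimpleModule k[G] (V i) := fun i =>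
    (Representation.irreducible_iff_isSimpleModule_asModule _).1 (hirr i)
  have hfd : ∀ i, FiniteDimensional k (V i) := fun i =>
    inferInstanceAs (FiniteDimensional k (Fin (d i) → k))
  have hzero : ∀ i j, i ≠ j → ∀ h : V i →ₗ[k[G]] V j, h = 0 := by
    intro i j hij h
    by_contra hh
    have hb : Function.Bijective h := (LinearMap.bijective_or_eq_zero h).resolve_right hh
    refine hne i j hij ⟨?_⟩
    exact Representation.IntertwiningMap.ofBijective
      ((Representation.IntertwiningMap.equivLinearMapAsModule (toRep (ψ i)) (toRep (ψ j))).symm h) hb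
  have hsc : ∀ i, ∀ h : V i →ₗ[k[G]] V i, ∃ c : k, ∀ v, h v = c • v := by
    intro i h
    obtain ⟨c, hc⟩ := (IsSimpleModule.algebraMap_end_bijective_of_isAlgClosed
      (A := k[G]) (V := V i) k).2 h
    exact ⟨c, fun v => by rw [← hc]; rfl⟩
  have hend : ∀ h : Module.End k[G] (∀ i, V i), ∃ c : ι → k, ∀ v i, h v i = c i • v i := by
    intro h
    choose c hc using fun i => hsc i
      ((LinearMap.proj i).comp (h.comp (LinearMap.single k[G] V i)))
    refine ⟨c, fun v i => ?_⟩
    conv_lhs => rw [← LinearMap.sum_single_apply V v]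
    rw [map_sum, Finset.sum_apply, Finset.sum_eq_single i]
    · exact hc i (v i)
    · intro j _ hj
      exact LinearMap.congr_fun (hzero j i hj
        ((LinearMap.proj i).comp (h.comp (LinearMap.single k[G] V j)))) (v j)
    · simp
  let f : Module.End (Module.End k[G] (∀ i, V i)) (∀ i, V i) :=
    { toFun := fun v i => (Matrix.toLin' (M i) (v i : Fin (d i) → k) : Fin (d i) → k)
      map_add' := fun v v' => funext fun i =>
        map_add (Matrix.toLin' (M i)) (v i : Fin (d i) → k) (v' i : Fin (d i) → k)
      map_smul' := fun h v => by
        obtain ⟨c, hc⟩ := hend h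
        funext i
        have h1 : ∀ u, (h • u : ∀ i, V i) i = c i • u i := fun u => hc u i
        simp only [RingHom.id_apply]
        rw [h1]
        exact ((map_smul (Matrix.toLin' (M i)) (c i) (v i : Fin (d i) → k)).trans
            (h1 fun i => (Matrix.toLin' (M i) (v i : Fin (d i) → k) : Fin (d i) → k)).symm) }
  let e : ∀ i, Fin (d i) → V i := fun i a => (Pi.single a (1 : k) : Fin (d i) → k)
  obtain ⟨r, hr⟩ := jacobson_density (R := k[G]) f
    (Finset.univ.image fun x : (Σ i, Fin (d i)) => (Pi.single x.1 (e x.1 x.2) : ∀ i, V i))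
  refine ⟨r, fun i => ?_⟩
  refine Matrix.toLin'.injective ?_
  refine (Pi.basisFun k (Fin (d i))).ext fun a => ?_
  have h1 := hr (Pi.single i (e i a)) (Finset.mem_image.2 ⟨⟨i, a⟩, Finset.mem_univ _, rfl⟩)
  have h2 := congrFun h1 i
  rw [Pi.smul_apply, Pi.single_eq_same, smul_asModule] at h2
  have h3 : f (Pi.single i (e i a)) i = Matrix.toLin' (M i) (e i a : Fin (d i) → k) := by
    change Matrix.toLin' (M i) ((Pi.single i (e i a) : ∀ i, V i) i : Fin (d i) → k) = _
    rw [Pi.single_eq_same]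
  rw [h3] at h2
  rw [Pi.basisFun_apply]
  exact h2.symm
end Density

end LParameter

/-! ### Twists and matrix form of a decomposition -/

namespace LParameter

section Twist

variable {k G : Type*} [Field k] [Group G]

theorem algAct_mul_eq {n m : ℕ} {A : Type*} [CommRing A] [Algebra k A]
    {ρ : G →* GL (Fin n) A} {ψ : G →* GL (Fin m) A} {X : Matrix (Fin n) (Fin m) A}
    (h : ∀ g, (ρ g : Matrix (Fin n) (Fin n) A) * X = X * (ψ g : Matrix (Fin m) (Fin m) A)) (b : k[G]) :
    algAct k ρ b * X = X * algAct k ψ b := by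
  induction b using MonoidAlgebra.induction_linear with
  | zero => simp
  | add x y hx hy => rw [map_add, map_add, Matrix.add_mul, Matrix.mul_add, hx, hy]
  | single g c => rw [algAct_single, algAct_single, Matrix.smul_mul, Matrix.mul_smul, h]

theorem map_algAct {n : ℕ} {A B : Type*} [CommRing A] [Algebra k A] [CommRing B] [Algebra k B]
    (ρ : G →* GL (Fin n) A) (f : A →ₐ[k] B) (b : k[G]) :
    (algAct k ρ b).map f =
      algAct k ((Matrix.GeneralLinearGroup.map (f : A →+* B)).comp ρ) b := by
  have : (f.mapMatrix).comp (algAct k ρ) =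
      algAct k ((Matrix.GeneralLinearGroup.map (f : A →+* B)).comp ρ) := by
    refine MonoidAlgebra.algHom_ext (fun g => ?_) (Subsingleton.elim _ _)
    rw [AlgHom.comp_apply, algAct_single, algAct_single, one_smul, one_smul]
    rfl
  rw [← this]
  rfl

/-- The endomorphism `g ↦ χ(g) g` of the group algebra. -/
def twistAlg (χ : G →* kˣ) : k[G] →ₐ[k] k[G] :=
  MonoidAlgebra.lift k _ G
    { toFun := fun g => MonoidAlgebra.single g (χ g : k)
      map_one' := by rw [map_one, Units.val_one]; rfl
      map_mul' := fun g h => by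
        rw [map_mul, Units.val_mul, MonoidAlgebra.single_mul_single] }

theorem twistAlg_single (χ : G →* kˣ) (g : G) (c : k) :
    twistAlg χ (MonoidAlgebra.single g c) = MonoidAlgebra.single g (c * (χ g : k)) := by
  simp [twistAlg]

/-- The twist of a homomorphism to `GL_n` by a character. -/
def twist {n : ℕ} (ψ : G →* GL (Fin n) k) (χ : G →* kˣ) : G →* GL (Fin n) k where
  toFun g := χ g • ψ g
  map_one' := by rw [map_one, map_one, one_smul]
  map_mul' g h := by
    ext1
    rw [map_mul, map_mul, Units.val_mul]
    change (_ : k) • (_ : Matrix _ _ k) = ((_ : k) • (_ : Matrix _ _ k)) * ((_ : k) • (_ : Matrix _ _ k))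
    rw [Units.val_mul, Units.val_mul, smul_mul_smul_comm]

theorem coe_twist {n : ℕ} (ψ : G →* GL (Fin n) k) (χ : G →* kˣ) (g : G) :
    (twist ψ χ g : Matrix (Fin n) (Fin n) k) = (χ g : k) • (ψ g : Matrix (Fin n) (Fin n) k) :=
  rfl

theorem algAct_twist {n : ℕ} (ψ : G →* GL (Fin n) k) (χ : G →* kˣ) (b : k[G]) :
    algAct k (twist ψ χ) b = algAct k ψ (twistAlg χ b) := by
  induction b using MonoidAlgebra.induction_linear with
  | zero => simp
  | add x y hx hy => rw [map_add, map_add, map_add, hx, hy]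
  | single g c => rw [twistAlg_single, algAct_single, algAct_single, coe_twist, smul_smul]

theorem toRep_twist {n : ℕ} (ψ : G →* GL (Fin n) k) (χ : G →* kˣ) :
    toRep (twist ψ χ) = (toRep ψ).charTwist χ := by
  ext1 g
  exact (Matrix.toLin' (R := k)).map_smul (χ g : k) (ψ g : Matrix (Fin n) (Fin n) k)

theorem isIrreducible_charTwist {V : Type*} [AddCommGroup V] [Module k V]
    {ρ : Representation k G V} (h : ρ.IsIrreducible) (χ : G →* kˣ) :
    (ρ.charTwist χ).IsIrreducible := by
  let e : Subrepresentation (ρ.charTwist χ) ≃o Subrepresentation ρ :=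
    { toFun := fun U => ⟨U.toSubmodule, fun g v hv => by
        have := U.toSubmodule.smul_mem ((χ g : k)⁻¹) (U.apply_mem_toSubmodule g hv)
        change (χ g : k)⁻¹ • (χ g : k) • ρ g v ∈ _ at this
        rwa [smul_smul, inv_mul_cancel₀ (χ g).ne_zero, one_smul] at this⟩
      invFun := fun U => ⟨U.toSubmodule, fun g v hv =>
        U.toSubmodule.smul_mem (χ g : k) (U.apply_mem_toSubmodule g hv)⟩
      left_inv := fun U => rfl
      right_inv := fun U => rfl
      map_rel_iff' := Iff.rfl }
  exact e.isSimpleOrder_iff.2 h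

theorem nonempty_equiv_of_charTwist {V V' : Type*} [AddCommGroup V] [Module k V]
    [AddCommGroup V'] [Module k V'] {ρ : Representation k G V} {σ : Representation k G V'}
    {χ : G →* kˣ} (e : (ρ.charTwist χ).Equiv (σ.charTwist χ)) : Nonempty (ρ.Equiv σ) := by
  refine ⟨Representation.Equiv.mk e.toLinearEquiv fun g => LinearMap.ext fun v => ?_⟩
  have h := Representation.IntertwiningMap.isIntertwining _ _ e.toIntertwiningMap g v
  change e ((χ g : k) • ρ g v) = (χ g : k) • σ g (e v) at h
  rw [map_smul] at h
  exact smul_right_injective _ (χ g).ne_zero h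

/-- Twisting multiplies the determinant at `g` by `χ(g) ^ dim V`, which is not `1`. This settles
equal indices, about which the hypothesis on twists says nothing. -/
theorem not_nonempty_equiv_charTwist {V : Type*} [AddCommGroup V] [Module k V]
    [FiniteDimensional k V] {ρ : Representation k G V} (h : ρ.IsIrreducible) {χ : G →* kˣ} {g : G}
    (hg : ∀ m : ℕ, m ≠ 0 → (χ g : k) ^ m ≠ 1) : ¬ Nonempty (ρ.Equiv (ρ.charTwist χ)) := by
  rintro ⟨e⟩
  have : Nontrivial V := by
    by_contra hV
    rw [not_nontrivial_iff_subsingleton] at hV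
    obtain ⟨x, y, hxy⟩ := h.exists_pair_ne
    exact hxy (Subrepresentation.toSubmodule_injective (Subsingleton.elim _ _))
  have h1 : (ρ.charTwist χ) g = e.toLinearEquiv.conj (ρ g) := by
    ext v
    have := Representation.IntertwiningMap.isIntertwining _ _ e.toIntertwiningMap g (e.toLinearEquiv.symm v)
    rw [LinearEquiv.conj_apply_apply]
    refine Eq.trans ?_ this.symm
    exact congrArg _ (e.toLinearEquiv.apply_symm_apply v).symm
  have h2 : LinearMap.det ((ρ.charTwist χ) g) = LinearMap.det (ρ g) := by
    rw [h1, LinearEquiv.conj_apply, LinearMap.comp_assoc]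
    exact LinearMap.det_conj _ _
  have h3 : LinearMap.det ((ρ.charTwist χ) g) =
      (χ g : k) ^ Module.finrank k V * LinearMap.det (ρ g) :=
    LinearMap.det_smul _ _
  have h4 : LinearMap.det (ρ g) ≠ 0 := by
    intro h0
    have : LinearMap.det (ρ g) * LinearMap.det (ρ g⁻¹) = 1 := by
      rw [← map_mul, ← map_mul, mul_inv_cancel, map_one, map_one]
    rw [h0, zero_mul] at this
    exact zero_ne_one this
  rw [h3] at h2
  exact hg _ Module.finrank_pos.ne' (mul_right_cancel₀ h4 (h2.trans (one_mul _).symm))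

/-- If neither twisting by `χ` nor permuting matches two of the irreducible representations `ψ i`,
then some element of the group algebra acts as the identity on all `ψ i`, and as zero on all
`ψ i ⊗ χ`. -/
theorem exists_algAct_eq_one_twist_eq_zero [IsAlgClosed k] {r : ℕ} {d : Fin r → ℕ}
    (ψ : ∀ i, G →* GL (Fin (d i)) k) (hirr : ∀ i, (toRep (ψ i)).IsIrreducible)
    (hne : ∀ i j, i ≠ j → ¬ Nonempty ((toRep (ψ i)).Equiv (toRep (ψ j))))
    {χ : G →* kˣ} (htw : ∀ i j, i ≠ j →
      ¬ Nonempty ((toRep (ψ i)).Equiv ((toRep (ψ j)).charTwist χ)))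
    {g : G} (hg : ∀ m : ℕ, m ≠ 0 → (χ g : k) ^ m ≠ 1) :
    ∃ b : k[G], (∀ i, algAct k (ψ i) b = 1) ∧ ∀ i, algAct k (ψ i) (twistAlg χ b) = 0 := by
  let d' : Fin r ⊕ Fin r → ℕ := Sum.elim d d
  let ψ' : ∀ i : Fin r ⊕ Fin r, G →* GL (Fin (d' i)) k :=
    fun i => match i with
      | Sum.inl i => ψ i
      | Sum.inr i => twist (ψ i) χ
  have htw' : ∀ i j, ¬ Nonempty ((toRep (ψ i)).Equiv ((toRep (ψ j)).charTwist χ)) := by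
    intro i j
    by_cases hij : i = j
    · subst hij
      exact not_nonempty_equiv_charTwist (hirr i) hg
    · exact htw i j hij
  -- Density for the `2 r` pairwise inequivalent representations `ψ i` and `ψ i ⊗ χ`, with target
  -- `1` on the former and `0` on the latter.
  obtain ⟨b, hb⟩ := exists_algAct_eq ψ' (by
      rintro (i | i)
      · exact hirr i
      · change (toRep (twist (ψ i) χ)).IsIrreducible
        rw [toRep_twist]
        exact isIrreducible_charTwist (hirr i) χ) (by
      rintro (i | i) (j | j) hij
      · exact hne i j fun h => hij (by rw [h])
      · change ¬ Nonempty ((toRep (ψ i)).Equiv (toRep (twist (ψ j) χ)))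
        rw [toRep_twist]
        exact htw' i j
      · change ¬ Nonempty ((toRep (twist (ψ i) χ)).Equiv (toRep (ψ j)))
        rw [toRep_twist]
        exact fun ⟨e⟩ => htw' j i ⟨e.symm⟩
      · change ¬ Nonempty ((toRep (twist (ψ i) χ)).Equiv (toRep (twist (ψ j) χ)))
        rw [toRep_twist, toRep_twist]
        exact fun ⟨e⟩ => hne i j (fun h => hij (by rw [h])) (nonempty_equiv_of_charTwist e))
    (fun i => match i with
      | Sum.inl i => (1 : Matrix (Fin (d i)) (Fin (d i)) k)
      | Sum.inr i => (0 : Matrix (Fin (d i)) (Fin (d i)) k))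
  exact ⟨b, fun i => hb (Sum.inl i), fun i => (algAct_twist _ _ _).symm.trans (hb (Sum.inr i))⟩

/-- The inclusions and projections of a direct sum decomposition, as matrices. -/
theorem exists_matrix_decomposition {n r : ℕ} {φ : G →* GL (Fin n) k} {d : Fin r → ℕ}
    {ψ : ∀ i, G →* GL (Fin (d i)) k}
    (e : (toRep φ).Equiv (Representation.directSum fun i => toRep (ψ i))) :
    ∃ (ι : ∀ i, Matrix (Fin n) (Fin (d i)) k) (π : ∀ i, Matrix (Fin (d i)) (Fin n) k),
      (∀ i g, (φ g : Matrix (Fin n) (Fin n) k) * ι i =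
        ι i * (ψ i g : Matrix (Fin (d i)) (Fin (d i)) k)) ∧
      (∀ i g, (ψ i g : Matrix (Fin (d i)) (Fin (d i)) k) * π i =
        π i * (φ g : Matrix (Fin n) (Fin n) k)) ∧
      (∀ i, π i * ι i = 1) ∧ (∀ i j, i ≠ j → π i * ι j = 0) ∧ ∑ i, ι i * π i = 1 := by
  let a : ∀ i, (Fin (d i) → k) →ₗ[k] (Fin n → k) := fun i =>
    e.toLinearEquiv.symm.toLinearMap ∘ₗ DirectSum.lof k (Fin r) (fun i => Fin (d i) → k) i
  let c : ∀ i, (Fin n → k) →ₗ[k] (Fin (d i) → k) := fun i =>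
    DirectSum.component k (Fin r) (fun i => Fin (d i) → k) i ∘ₗ e.toLinearEquiv.toLinearMap
  have hac : ∀ i, c i ∘ₗ a i = LinearMap.id := by
    intro i
    refine LinearMap.ext fun v => ?_
    change e.toLinearEquiv (e.toLinearEquiv.symm (DirectSum.lof k _ _ i v)) i = v
    rw [LinearEquiv.apply_symm_apply, DirectSum.lof_apply]
  have hac' : ∀ i j, i ≠ j → c i ∘ₗ a j = 0 := by
    intro i j hij
    refine LinearMap.ext fun v => ?_
    change e.toLinearEquiv (e.toLinearEquiv.symm (DirectSum.lof k _ _ j v)) i = 0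
    rw [LinearEquiv.apply_symm_apply]
    exact DirectSum.of_eq_of_ne (β := fun i => Fin (d i) → k) j i v hij
  have hca : ∑ i, a i ∘ₗ c i = LinearMap.id := by
    refine LinearMap.ext fun v => ?_
    rw [LinearMap.sum_apply]
    apply e.toLinearEquiv.injective
    rw [map_sum]
    change ∑ i, e.toLinearEquiv (e.toLinearEquiv.symm
      (DirectSum.of (fun i => Fin (d i) → k) i (e.toLinearEquiv v i))) = e.toLinearEquiv v
    simp only [LinearEquiv.apply_symm_apply]
    exact DirectSum.sum_univ_of _
  have he : ∀ g v, e.toLinearEquiv (toRep φ g v) =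
      DirectSum.lmap (fun i => toRep (ψ i) g) (e.toLinearEquiv v) := 
    fun g v => Representation.IntertwiningMap.isIntertwining _ _ e.toIntertwiningMap g v
  have hc : ∀ i g, (toRep (ψ i) g) ∘ₗ c i = c i ∘ₗ toRep φ g := by
    intro i g
    refine LinearMap.ext fun v => ?_
    change _ = (e.toLinearEquiv (toRep φ g v)) i
    rw [he]
    rfl
  have ha : ∀ i g, (toRep φ g) ∘ₗ a i = a i ∘ₗ toRep (ψ i) g := by
    intro i g
    refine LinearMap.ext fun v => ?_
    apply e.toLinearEquiv.injective
    refine (he _ _).trans ?_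
    change DirectSum.lmap (fun i => toRep (ψ i) g)
      (e.toLinearEquiv (e.toLinearEquiv.symm (DirectSum.lof k _ _ i v))) =
      e.toLinearEquiv (e.toLinearEquiv.symm (DirectSum.lof k _ _ i (toRep (ψ i) g v)))
    rw [LinearEquiv.apply_symm_apply, LinearEquiv.apply_symm_apply, DirectSum.lmap_lof]
  have key : ∀ {l m o : ℕ} (f : (Fin m → k) →ₗ[k] (Fin o → k)) (f' : (Fin l → k) →ₗ[k] (Fin m → k)),
    f.toMatrix' * f'.toMatrix' = (f ∘ₗ f').toMatrix' := fun f f' => (LinearMap.toMatrix'_comp f f').symm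
  have hM : ∀ {m : ℕ} (ψ : G →* GL (Fin m) k) g, (ψ g : Matrix (Fin m) (Fin m) k) =
    (toRep ψ g).toMatrix' := fun ψ g => (LinearMap.toMatrix'_toLin' _).symm
  refine ⟨fun i => (a i).toMatrix', fun i => (c i).toMatrix', fun i g => ?_, fun i g => ?_,
    fun i => ?_, fun i j hij => ?_, ?_⟩
  · rw [hM φ, hM (ψ i), key, key, ha]
  · rw [hM φ, hM (ψ i), key, key, hc]
  · rw [key, hac, LinearMap.toMatrix'_id]
  · rw [key, hac' i j hij, map_zero]
  · simp only [key]
    rw [← map_sum, hca, LinearMap.toMatrix'_id]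

end Twist

end LParameter

/-! ### Intertwiners as a determinantal condition -/

namespace LParameter

section Block

variable {k G : Type*} [Field k] [Group G] {n d : ℕ} {A : Type*} [CommRing A] [Algebra k A]

/-- The action of matrices over the group algebra attached to a homomorphism to `GL_n(A)`. -/
def blockAct (k : Type*) [Field k] {G : Type*} [Group G] {n : ℕ} (d : ℕ) {A : Type*} [CommRing A]
    [Algebra k A] (ρ : G →* GL (Fin n) A) :
    Matrix (Fin d) (Fin d) k[G] →ₐ[k] Matrix (Fin d × Fin n) (Fin d × Fin n) A :=
  (Matrix.compAlgEquiv (Fin d) (Fin n) A k : _ →ₐ[k] _).comp (algAct k ρ).mapMatrix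

theorem blockAct_apply (ρ : G →* GL (Fin n) A) (B : Matrix (Fin d) (Fin d) k[G])
    (x y : Fin d × Fin n) : blockAct k d ρ B x y = algAct k ρ (B x.1 y.1) x.2 y.2 := rfl

theorem map_blockAct {B : Type*} [CommRing B] [Algebra k B] (ρ : G →* GL (Fin n) A)
    (f : A →ₐ[k] B) (M : Matrix (Fin d) (Fin d) k[G]) :
    (blockAct k d ρ M).map f =
      blockAct k d ((Matrix.GeneralLinearGroup.map (f : A →+* B)).comp ρ) M := by
  ext x y
  rw [Matrix.map_apply, blockAct_apply, blockAct_apply, ← map_algAct, Matrix.map_apply]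

theorem algAct_conj {ρ ρ' : G →* GL (Fin n) A} {g : GL (Fin n) A} (h : ∀ w, ρ' w = g * ρ w * g⁻¹)
    (b : k[G]) : algAct k ρ' b = g * algAct k ρ b * (g⁻¹ : GL (Fin n) A) := by
  have : algAct k ρ' b * g = g * algAct k ρ b :=
    algAct_mul_eq (fun w => by rw [h, ← Units.val_mul, ← Units.val_mul, inv_mul_cancel_right]) b
  rw [← this, mul_assoc, ← Units.val_mul, mul_inv_cancel, Units.val_one, mul_one]

theorem det_blockAct_conj {ρ ρ' : G →* GL (Fin n) A} {g : GL (Fin n) A}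
    (h : ∀ w, ρ' w = g * ρ w * g⁻¹) (B : Matrix (Fin d) (Fin d) k[G]) :
    (blockAct k d ρ' B).det = (blockAct k d ρ B).det := by
  let s (M : Matrix (Fin n) (Fin n) A) : Matrix (Fin d × Fin n) (Fin d × Fin n) A :=
    Matrix.compRingEquiv (Fin d) (Fin n) A (Matrix.scalar (Fin d) M)
  have h1 : blockAct k d ρ' B = s g * blockAct k d ρ B * s (g⁻¹ : GL (Fin n) A) := by
    change Matrix.compRingEquiv _ _ _ (B.map (algAct k ρ')) =
      s g * Matrix.compRingEquiv _ _ _ (B.map (algAct k ρ)) * _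
    rw [← map_mul, ← map_mul]
    congr 1
    ext1 i j
    rw [Matrix.scalar_apply, Matrix.scalar_apply, Matrix.mul_diagonal, Matrix.diagonal_mul,
      Matrix.map_apply, Matrix.map_apply, algAct_conj h]
  have h2 : s g * s (g⁻¹ : GL (Fin n) A) = 1 := by
    rw [← map_mul, ← map_mul, ← Units.val_mul, mul_inv_cancel, Units.val_one, map_one, map_one]
  rw [h1, Matrix.det_mul, Matrix.det_mul, mul_right_comm, ← Matrix.det_mul, h2, Matrix.det_one,
    one_mul]

end Block

section Average

variable {k G : Type*} [Field k] [Group G] {n d : ℕ}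

/-- The operator `X ↦ w X w⁻¹`, as a matrix over the group algebra. -/
def homMatrix (ψ : G →* GL (Fin d) k) (w : G) : Matrix (Fin d) (Fin d) k[G] :=
  Matrix.of fun i j => MonoidAlgebra.single w ((((ψ w)⁻¹ : GL (Fin d) k) : Matrix (Fin d) (Fin d) k) j i)

/-- The Kronecker identity for `vec (A X B)`. It expresses operators on `Hom(ψ, ρ)` through matrices
over the group algebra that do not involve `ρ`. -/
theorem blockAct_homMatrix {A : Type*} [CommRing A] [Algebra k A] (ρ : G →* GL (Fin n) A)
    (ψ : G →* GL (Fin d) k) (w : G) (X : Matrix (Fin n) (Fin d) A) :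
    (blockAct k d ρ (homMatrix ψ w)).mulVec X.vec =
      ((ρ w : Matrix (Fin n) (Fin n) A) * X *
        (((ψ w)⁻¹ : GL (Fin d) k) : Matrix (Fin d) (Fin d) k).map (algebraMap k A)).vec := by
  have : blockAct k d ρ (homMatrix ψ w) = Matrix.kroneckerMap (· * ·)
      ((((ψ w)⁻¹ : GL (Fin d) k) : Matrix (Fin d) (Fin d) k).map (algebraMap k A)).transpose
      (ρ w : Matrix (Fin n) (Fin n) A) := by
    ext x y
    rw [blockAct_apply, homMatrix, Matrix.of_apply, algAct_single, Matrix.smul_apply,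
      Algebra.smul_def]
    rfl
  rw [this, Matrix.kronecker_mulVec_vec, Matrix.transpose_transpose]

variable (I J : Subgroup G) (F : G)

/-- The average of the operators `X ↦ w X w⁻¹` over the coset `F I`, modulo `J`. -/
def averageMatrix (ψ : G →* GL (Fin d) k) [Fintype (I ⧸ J.subgroupOf I)] :
    Matrix (Fin d) (Fin d) k[G] :=
  (Fintype.card (I ⧸ J.subgroupOf I) : k)⁻¹ •
    ∑ q : I ⧸ J.subgroupOf I, homMatrix ψ (F * (q.out : I))

variable {I J F} {K : Type*} [Field K] [Algebra k K]
  {ρ : G →* GL (Fin n) K} {ψ : G →* GL (Fin d) k}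

/-- The operator `X ↦ w X w⁻¹` on matrices. -/
def homAct (ρ : G →* GL (Fin n) K) (ψ : G →* GL (Fin d) k) (w : G) (X : Matrix (Fin n) (Fin d) K) :
    Matrix (Fin n) (Fin d) K :=
  (ρ w : Matrix (Fin n) (Fin n) K) * X *
    (((ψ w)⁻¹ : GL (Fin d) k) : Matrix (Fin d) (Fin d) k).map (algebraMap k K)

theorem homAct_mul (w w' : G) (X : Matrix (Fin n) (Fin d) K) :
    homAct ρ ψ (w * w') X = homAct ρ ψ w (homAct ρ ψ w' X) := by
  simp only [homAct]
  rw [map_mul, map_mul, mul_inv_rev, Units.val_mul, Units.val_mul, Matrix.map_mul]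
  simp only [Matrix.mul_assoc]

theorem homAct_smul (w : G) (c : k) (X : Matrix (Fin n) (Fin d) K) :
    homAct ρ ψ w (c • X) = c • homAct ρ ψ w X := by
  simp only [homAct]
  rw [Matrix.mul_smul, Matrix.smul_mul]

theorem homAct_sum {α : Type*} (s : Finset α) (w : G) (X : α → Matrix (Fin n) (Fin d) K) :
    homAct ρ ψ w (∑ a ∈ s, X a) = ∑ a ∈ s, homAct ρ ψ w (X a) := by
  simp only [homAct]
  rw [Matrix.mul_sum, Matrix.sum_mul]

theorem homAct_eq_self_iff (w : G) (X : Matrix (Fin n) (Fin d) K) :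
    homAct ρ ψ w X = X ↔ (ρ w : Matrix (Fin n) (Fin n) K) * X =
      X * (ψ w : Matrix (Fin d) (Fin d) k).map (algebraMap k K) := by
  have h1 : (((ψ w)⁻¹ : GL (Fin d) k) : Matrix (Fin d) (Fin d) k).map (algebraMap k K) *
      (ψ w : Matrix (Fin d) (Fin d) k).map (algebraMap k K) = 1 := by
    rw [← Matrix.map_mul, ← Units.val_mul, inv_mul_cancel, Units.val_one,
      Matrix.map_one _ (map_zero _) (map_one _)]
  have h2 : (ψ w : Matrix (Fin d) (Fin d) k).map (algebraMap k K) *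
      (((ψ w)⁻¹ : GL (Fin d) k) : Matrix (Fin d) (Fin d) k).map (algebraMap k K) = 1 :=
    mul_eq_one_comm.1 h1
  constructor
  · intro h
    conv_rhs => rw [← h]
    rw [homAct, Matrix.mul_assoc, h1, Matrix.mul_one]
  · intro h
    rw [homAct, h, Matrix.mul_assoc, h2, Matrix.mul_one]

variable [Fintype (I ⧸ J.subgroupOf I)]

theorem blockAct_averageMatrix (X : Matrix (Fin n) (Fin d) K) :
    (blockAct k d ρ (averageMatrix I J F ψ)).mulVec X.vec =
      ((Fintype.card (I ⧸ J.subgroupOf I) : k)⁻¹ • ∑ q : I ⧸ J.subgroupOf I,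
        (ρ (F * (q.out : I)) : Matrix (Fin n) (Fin n) K) * X *
        (((ψ (F * (q.out : I)))⁻¹ : GL (Fin d) k) : Matrix (Fin d) (Fin d) k).map
          (algebraMap k K)).vec := by
  rw [averageMatrix, map_smul, map_sum, Matrix.smul_mulVec, Matrix.sum_mulVec, Matrix.vec_smul,
    Matrix.vec_sum]
  simp only [blockAct_homMatrix]

/-- Averaging over the coset `F I` detects invariance under `I` and `F` with a single operator. A
fixed `X` is `F` applied to an `I`-average, hence `I`-invariant by normality. So the `I`-average is
`X` itself, and `F` fixes it. -/
theorem homAct_eq_self_of_average [CharZero k] [I.Normal] (hρ : ∀ w ∈ J, ρ w = 1)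
    (hψ : ∀ w ∈ J, ψ w = 1) (hgen : ∀ H : Subgroup G, I ≤ H → F ∈ H → H = ⊤)
    {X : Matrix (Fin n) (Fin d) K}
    (hX : (blockAct k d ρ (averageMatrix I J F ψ)).mulVec X.vec = X.vec) (w : G) :
    homAct ρ ψ w X = X := by
  set c : k := (Fintype.card (I ⧸ J.subgroupOf I) : k)⁻¹ with hc
  let S := ∑ q : I ⧸ J.subgroupOf I, homAct ρ ψ (q.out : I) X
  have hXS : homAct ρ ψ F (c • S) = X := by
    rw [blockAct_averageMatrix, Matrix.vec_inj] at hX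
    rw [homAct_smul, homAct_sum]
    conv_rhs => rw [← hX]
    simp only [← homAct_mul]
    rfl
  have hJ : ∀ j ∈ J, homAct ρ ψ j X = X := fun j hj => by
    rw [homAct_eq_self_iff, hρ j hj, hψ j hj, Units.val_one, Units.val_one,
      Matrix.map_one _ (map_zero _) (map_one _), Matrix.one_mul, Matrix.mul_one]
  have hS : ∀ y ∈ I, homAct ρ ψ y S = S := by
    intro y hy
    have h1 : ∀ q : I ⧸ J.subgroupOf I, homAct ρ ψ y (homAct ρ ψ (q.out : I) X) =
        homAct ρ ψ (((⟨y, hy⟩ : I) • q).out : I) X := by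
      intro q
      have h2 : (((⟨y, hy⟩ : I) • q).out)⁻¹ * (⟨y, hy⟩ * q.out) ∈ J.subgroupOf I := by
        rw [← QuotientGroup.eq, QuotientGroup.out_eq', ← smul_eq_mul, MulAction.Quotient.mk_smul_out]
      rw [← homAct_mul]
      rw [Subgroup.mem_subgroupOf] at h2
      have h3 : y * ((q.out : I) : G) = ((((⟨y, hy⟩ : I) • q).out : I) : G) *
          ((((⟨y, hy⟩ : I) • q).out)⁻¹ * (⟨y, hy⟩ * q.out) : I) := by
        simp
      rw [h3, homAct_mul, hJ _ h2]
    rw [homAct_sum, Finset.sum_congr rfl fun q _ => h1 q]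
    exact Equiv.sum_comp (MulAction.toPerm (⟨y, hy⟩ : I))
      fun q : I ⧸ J.subgroupOf I => homAct ρ ψ (q.out : I) X
  let H : Subgroup G :=
    { carrier := {w | homAct ρ ψ w X = X}
      one_mem' := by
        change homAct ρ ψ 1 X = X
        exact hJ 1 J.one_mem
      mul_mem' := fun {a b} (ha : _ = _) (hb : _ = _) => by
        change _ = _
        rw [homAct_mul, hb, ha]
      inv_mem' := fun {a} (ha : _ = _) => by
        change homAct ρ ψ a⁻¹ X = X
        conv_lhs => rw [← ha]
        rw [← homAct_mul, inv_mul_cancel]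
        exact hJ 1 J.one_mem }
  have hIH : ∀ y ∈ I, homAct ρ ψ y X = X := by
    intro y hy
    conv_lhs => rw [← hXS]
    rw [← homAct_mul, show y * F = F * (F⁻¹ * y * F) by group, homAct_mul, homAct_smul (_ * F),
      hS _ (by simpa using ‹I.Normal›.conj_mem y hy F⁻¹), hXS]
  have hFH : F ∈ H := by
    have : c • S = X := by
      have h1 : S = (Fintype.card (I ⧸ J.subgroupOf I) : k) • X := by
        change ∑ q : I ⧸ J.subgroupOf I, homAct ρ ψ (q.out : I) X = _
        rw [Finset.sum_congr rfl fun q _ => hIH _ (q.out : I).2, Finset.sum_const, Finset.card_univ,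
          Nat.cast_smul_eq_nsmul]
      rw [h1, smul_smul, hc, inv_mul_cancel₀ (Nat.cast_ne_zero.2 Fintype.card_ne_zero), one_smul]
    rw [this] at hXS
    exact hXS
  have := hgen H hIH hFH
  exact (show w ∈ H from this ▸ Subgroup.mem_top w)

theorem average_of_homAct_eq_self [CharZero k] {X : Matrix (Fin n) (Fin d) K}
    (hX : ∀ w, homAct ρ ψ w X = X) :
    (blockAct k d ρ (averageMatrix I J F ψ)).mulVec X.vec = X.vec := by
  rw [blockAct_averageMatrix]
  congr 1
  have h1 : ∀ q ∈ (Finset.univ : Finset (I ⧸ J.subgroupOf I)),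
    homAct ρ ψ (F * (q.out : I)) X = X := fun q _ => hX _
  refine (congrArg _ (Finset.sum_congr rfl h1)).trans ?_
  rw [Finset.sum_const, Finset.card_univ, ← Nat.cast_smul_eq_nsmul k, smul_smul,
    inv_mul_cancel₀ (Nat.cast_ne_zero.2 Fintype.card_ne_zero), one_smul]

/-- Intertwiners are the fixed vectors of one operator, so their existence is the vanishing of one
determinant, an invariant function of `ρ`. -/
theorem exists_intertwiner_iff [CharZero k] [I.Normal] (hρ : ∀ w ∈ J, ρ w = 1)
    (hψ : ∀ w ∈ J, ψ w = 1) (hgen : ∀ H : Subgroup G, I ≤ H → F ∈ H → H = ⊤) :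
    (∃ X : Matrix (Fin n) (Fin d) K, X ≠ 0 ∧ ∀ w, (ρ w : Matrix (Fin n) (Fin n) K) * X =
      X * (ψ w : Matrix (Fin d) (Fin d) k).map (algebraMap k K)) ↔
    (blockAct k d ρ (1 - averageMatrix I J F ψ)).det = 0 := by
  rw [← Matrix.exists_mulVec_eq_zero_iff, map_sub, map_one]
  simp only [Matrix.sub_mulVec, Matrix.one_mulVec, sub_eq_zero, ← homAct_eq_self_iff]
  constructor
  · rintro ⟨X, hX, h⟩
    exact ⟨X.vec, fun h0 => hX (Matrix.vec_eq_zero_iff.1 h0), (average_of_homAct_eq_self h).symm⟩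
  · rintro ⟨v, hv, h⟩
    obtain ⟨X, rfl⟩ := Matrix.vec_bijective.2 v
    exact ⟨X, fun h0 => hv (by rw [h0, Matrix.vec_zero]),
      homAct_eq_self_of_average hρ hψ hgen h.symm⟩

end Average

end LParameter

/-! ### Assembling intertwiners into a conjugation -/

namespace LParameter

section Decomposition

variable {k G : Type*} [Field k] [Group G] {n r : ℕ} {φ : G →* GL (Fin n) k} {d : Fin r → ℕ}
  {ψ : ∀ i, G →* GL (Fin (d i)) k} {ι : ∀ i, Matrix (Fin n) (Fin (d i)) k}
  {π : ∀ i, Matrix (Fin (d i)) (Fin n) k}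

theorem algAct_eq_sum
    (hι : ∀ i g, (φ g : Matrix (Fin n) (Fin n) k) * ι i =
      ι i * (ψ i g : Matrix (Fin (d i)) (Fin (d i)) k))
    (hsum : ∑ i, ι i * π i = 1) (b : k[G]) :
    algAct k φ b = ∑ i, ι i * algAct k (ψ i) b * π i := by
  rw [← mul_one (algAct k φ b), ← hsum, Matrix.mul_sum]
  refine Finset.sum_congr rfl fun i _ => ?_
  rw [← algAct_mul_eq (hι i), Matrix.mul_assoc]

/-- The sum `g₀ = ∑ X i π i` is an intertwiner between representations of equal dimension. It
remains to see that it is injective, and by density its kernel would contain a full constituent. -/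
theorem exists_conj_of_intertwiners [IsAlgClosed k]
    (hirr : ∀ i, (toRep (ψ i)).IsIrreducible)
    (hne : ∀ i j, i ≠ j → ¬ Nonempty ((toRep (ψ i)).Equiv (toRep (ψ j))))
    (hι : ∀ i g, (φ g : Matrix (Fin n) (Fin n) k) * ι i =
      ι i * (ψ i g : Matrix (Fin (d i)) (Fin (d i)) k))
    (hπ : ∀ i g, (ψ i g : Matrix (Fin (d i)) (Fin (d i)) k) * π i =
      π i * (φ g : Matrix (Fin n) (Fin n) k))
    (hπι : ∀ i, π i * ι i = 1) (hπι' : ∀ i j, i ≠ j → π i * ι j = 0)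
    (hsum : ∑ i, ι i * π i = 1)
    {K : Type*} [Field K] [Algebra k K] {φ' : G →* GL (Fin n) K}
    {X : ∀ i, Matrix (Fin n) (Fin (d i)) K} (hX0 : ∀ i, X i ≠ 0)
    (hX : ∀ i w, (φ' w : Matrix (Fin n) (Fin n) K) * X i =
      X i * (ψ i w : Matrix (Fin (d i)) (Fin (d i)) k).map (algebraMap k K)) :
    ∃ g : GL (Fin n) K, ∀ w,
      φ' w = g * Matrix.GeneralLinearGroup.map (algebraMap k K) (φ w) * g⁻¹ := by
  classical
  let m {a b : ℕ} (M : Matrix (Fin a) (Fin b) k) : Matrix (Fin a) (Fin b) K :=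
    M.map (algebraMap k K)
  have m_mul : ∀ {a b c : ℕ} (M : Matrix (Fin a) (Fin b) k) (N : Matrix (Fin b) (Fin c) k),
    m (M * N) = m M * m N := fun M N => Matrix.map_mul
  let g₀ : Matrix (Fin n) (Fin n) K := ∑ i, X i * m (π i)
  have hg₀ι : ∀ i, g₀ * m (ι i) = X i := by
    intro i
    rw [Matrix.sum_mul, Finset.sum_eq_single i]
    · rw [Matrix.mul_assoc, ← m_mul, hπι]
      change X i * (1 : Matrix _ _ k).map _ = _
      rw [Matrix.map_one _ (map_zero _) (map_one _), Matrix.mul_one]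
    · intro j _ hj
      rw [Matrix.mul_assoc, ← m_mul, hπι' j i hj]
      change X j * (0 : Matrix _ _ k).map _ = _
      rw [Matrix.map_zero _ (map_zero _), Matrix.mul_zero]
    · simp
  let φK : G →* GL (Fin n) K := (Matrix.GeneralLinearGroup.map (Algebra.ofId k K : k →+* K)).comp φ
  have hφK : ∀ w, (φK w : Matrix (Fin n) (Fin n) K) = m (φ w : Matrix (Fin n) (Fin n) k) :=
    fun w => rfl
  have hg₀ : ∀ w, (φ' w : Matrix (Fin n) (Fin n) K) * g₀ = g₀ * (φK w : Matrix (Fin n) (Fin n) K) := by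
    intro w
    rw [Matrix.mul_sum, Matrix.sum_mul]
    refine Finset.sum_congr rfl fun i _ => ?_
    rw [← Matrix.mul_assoc, hX, hφK, Matrix.mul_assoc, Matrix.mul_assoc, ← m_mul, hπ, m_mul]
  have hdet : g₀.det ≠ 0 := by
    intro h0
    obtain ⟨v, hv0, hv⟩ := Matrix.exists_mulVec_eq_zero_iff.2 h0
    have h1 : ∃ i a, (m (π i)).mulVec v a ≠ 0 := by
      by_contra hcon
      push Not at hcon
      refine hv0 ?_
      have : m (∑ i, ι i * π i) = 1 := by
        rw [hsum]
        exact Matrix.map_one _ (map_zero _) (map_one _)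
      have h2 : m (∑ i, ι i * π i) = ∑ i, m (ι i) * m (π i) := by
        simp only [← m_mul]
        exact map_sum (algebraMap k K).mapMatrix _ _
      rw [← Matrix.one_mulVec v, ← this, h2, Matrix.sum_mulVec]
      refine Finset.sum_eq_zero fun i _ => ?_
      rw [← Matrix.mulVec_mulVec, show (m (π i)).mulVec v = 0 from funext (hcon i),
        Matrix.mulVec_zero]
    obtain ⟨i, a, hia⟩ := h1
    refine hX0 i ?_
    ext e c
    -- This `b` moves the nonzero coordinate `a` of `π i v` to coordinate `c` and kills the other
    -- constituents. As `g₀ v = 0`, column `c` of `X i` vanishes, for every `c`.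
    obtain ⟨b, hb⟩ := exists_algAct_eq ψ hirr hne
      (Pi.single i (Matrix.single c a (1 : k)))
    have h2 : algAct k φ b = ι i * Matrix.single c a (1 : k) * π i := by
      rw [algAct_eq_sum hι hsum, Finset.sum_eq_single i]
      · rw [hb, Pi.single_eq_same]
      · intro j _ hj
        rw [hb, Pi.single_eq_of_ne hj, Matrix.mul_zero, Matrix.zero_mul]
      · simp
    have h3 : algAct k φK b = m (ι i * Matrix.single c a (1 : k) * π i) := by
      rw [← h2]
      exact (map_algAct φ (Algebra.ofId k K) b).symm
    have h4 : (X i * m (Matrix.single c a (1 : k))).mulVec ((m (π i)).mulVec v) = 0 := by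
      rw [← hg₀ι, Matrix.mulVec_mulVec, Matrix.mul_assoc g₀, Matrix.mul_assoc g₀, ← m_mul, ← m_mul, ← h3,
        ← algAct_mul_eq hg₀ b, ← Matrix.mulVec_mulVec, hv, Matrix.mulVec_zero]
    have h5 := congrFun h4 e
    rw [show m (Matrix.single c a (1 : k)) = Matrix.single c a 1 from by
      change (Matrix.single c a (1 : k)).map _ = _
      rw [Matrix.map_single, map_one], ← Matrix.mulVec_mulVec, Matrix.single_mulVec] at h5
    rw [one_mul, Pi.zero_apply, show Function.update (0 : Fin (d i) → K) c ((m (π i)).mulVec v a) =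
      Pi.single c ((m (π i)).mulVec v a) from rfl, Matrix.mulVec_single] at h5
    simpa [hia] using h5
  let g : GL (Fin n) K := Matrix.GeneralLinearGroup.mkOfDetNeZero g₀ hdet
  refine ⟨g, fun w => ?_⟩
  rw [eq_mul_inv_iff_mul_eq]
  exact Units.ext (hg₀ w)

end Decomposition

end LParameter

/-! ### The invariant function that kills the monodromy -/

namespace LParameter

open WeilGroup

theorem aeval_mul_eq_mul_aeval {R B : Type*} [CommRing R] [Ring B] [Algebra R B] {M M' X : B}
    (h : M * X = X * M') (q : Polynomial R) :
    Polynomial.aeval M q * X = X * Polynomial.aeval M' q := by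
  induction q using Polynomial.induction_on' with
  | add q₁ q₂ h₁ h₂ => rw [map_add, map_add, add_mul, mul_add, h₁, h₂]
  | monomial m c =>
    have h2 : ∀ m : ℕ, M ^ m * X = X * M' ^ m := fun m => by
      induction m with
      | zero => rw [pow_zero, pow_zero, one_mul, mul_one]
      | succ m ih => rw [pow_succ, pow_succ', mul_assoc, h, ← mul_assoc, ih, mul_assoc, ← pow_succ, ← pow_succ']
    rw [Polynomial.aeval_monomial, Polynomial.aeval_monomial, mul_assoc, h2, ← mul_assoc,
      ← mul_assoc, Algebra.commutes]

section Annihilator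

variable {k G : Type*} [Field k] [Group G] {n : ℕ} {A : Type*} [CommRing A] [Algebra k A]

/-- The determinant of the polynomial `charpoly (ρ (χ ⊗ b))`, evaluated at `ρ(b)`. -/
def resultantDet (χ : G →* kˣ) (b : k[G]) (ρ : G →* GL (Fin n) A) : A :=
  (Polynomial.aeval (algAct k ρ b) (algAct k ρ (twistAlg χ b)).charpoly).det

variable {χ : G →* kˣ} {b : k[G]}

theorem map_resultantDet {B : Type*} [CommRing B] [Algebra k B] (ρ : G →* GL (Fin n) A)
    (f : A →ₐ[k] B) : f (resultantDet χ b ρ) =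
      resultantDet χ b ((Matrix.GeneralLinearGroup.map (f : A →+* B)).comp ρ) := by
  have h1 : ∀ c, algAct k ((Matrix.GeneralLinearGroup.map (f : A →+* B)).comp ρ) c =
    (f : A →+* B).mapMatrix (algAct k ρ c) := fun c => (map_algAct ρ f c).symm
  have h2 : ((f : A →+* B).mapMatrix (algAct k ρ (twistAlg χ b))).charpoly =
    (algAct k ρ (twistAlg χ b)).charpoly.map (f : A →+* B) := Matrix.charpoly_map _ _
  rw [resultantDet, resultantDet, h1, h1, h2]
  change (f : A →+* B) _ = _
  rw [RingHom.map_det]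
  congr 1
  rw [Polynomial.aeval_def, Polynomial.aeval_def, Polynomial.hom_eval₂, Polynomial.eval₂_map]
  congr 1
  ext a i j
  by_cases hij : i = j <;> simp [Matrix.algebraMap_matrix_apply, hij]

theorem resultantDet_conj {ρ ρ' : G →* GL (Fin n) A} {g : GL (Fin n) A}
    (h : ∀ w, ρ' w = g * ρ w * g⁻¹) : resultantDet χ b ρ' = resultantDet χ b ρ := by
  rw [resultantDet, resultantDet, algAct_conj h (twistAlg χ b), Matrix.coe_units_inv,
    Matrix.charpoly_units_conj]
  have h1 := aeval_mul_eq_mul_aeval (M := algAct k ρ' b) (M' := algAct k ρ b)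
    (X := (g : Matrix (Fin n) (Fin n) A)) (by
      rw [algAct_conj h b, mul_assoc, ← Units.val_mul, inv_mul_cancel, Units.val_one, mul_one])
    (algAct k ρ (twistAlg χ b)).charpoly
  have h2 := congrArg Matrix.det h1
  rw [Matrix.det_mul, Matrix.det_mul, mul_comm] at h2
  have hg : IsUnit (g : Matrix (Fin n) (Fin n) A).det := (Matrix.isUnit_iff_isUnit_det _).1 g.isUnit
  exact hg.mul_left_cancel h2

/-- The relation on `N` says `ρ(b) N = N ρ(χ b)`, where `χ b` is the twist of `b`. So for `f` the
characteristic polynomial of `ρ(χ b)`, Cayley–Hamilton gives `f(ρ(b)) N = N f(ρ(χ b)) = 0`. Multiply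
by the adjugate of `f(ρ(b))`. -/
theorem resultantDet_smul_eq_zero {ρ : G →* GL (Fin n) A} {N : Matrix (Fin n) (Fin n) A}
    (hN : ∀ w, (ρ w : Matrix (Fin n) (Fin n) A) * N =
      (χ w : k) • (N * (ρ w : Matrix (Fin n) (Fin n) A))) :
    resultantDet χ b ρ • N = 0 := by
  have h1 : ∀ c, algAct k ρ c * N = N * algAct k ρ (twistAlg χ c) := by
    intro c
    induction c using MonoidAlgebra.induction_linear with
    | zero => simp
    | add x y hx hy => rw [map_add, map_add, map_add, add_mul, mul_add, hx, hy]
    | single g c => rw [twistAlg_single, algAct_single, algAct_single, Matrix.smul_mul, hN,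
        smul_smul, Matrix.mul_smul]
  have h2 := aeval_mul_eq_mul_aeval (h1 b) (algAct k ρ (twistAlg χ b)).charpoly
  rw [Matrix.aeval_self_charpoly, mul_zero] at h2
  rw [resultantDet, ← one_mul N, ← Matrix.smul_mul, ← Matrix.adjugate_mul, Matrix.mul_assoc, h2,
    Matrix.mul_zero]

end Annihilator

variable {p ℓ : ℕ} [Fact p.Prime] [Fact ℓ.Prime] {n : ℕ} {P : Subgroup (W p)}

namespace MonodromyData

variable (D : MonodromyData ℓ n P) {A : Type} [CommRing A] [Algebra (PadicAlgCl ℓ) A]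
  {φ : W p →* GL (Fin n) A}

theorem eq_one_of_eq_one (hφ : IsLParameter (ℓ := ℓ) φ) (hP : ∀ w ∈ P, φ w = 1)
    (h : φ D.x₀ = 1) : ∀ x ∈ D.J, φ x = 1 := by
  intro x hx
  ext1
  -- Comparing with the value at `1` avoids computing `binomPow` at `Y = 0`, which depends on
  -- whether `K = 0`.
  have h1 := D.eq_binomPow A φ hφ hP 1 D.J.one_mem
  rw [map_one] at h1
  rw [h1, D.eq_binomPow A φ hφ hP x hx, h, Units.val_one, sub_self]
  refine Finset.sum_congr rfl fun i _ => ?_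
  rcases Nat.eq_zero_or_pos i with rfl | hi
  · rw [Ring.choose_zero_right, Ring.choose_zero_right]
  · rw [zero_pow hi.ne', smul_zero, smul_zero]

/-- The logarithm `N` of `φ x₀` turns the tame relation into `φ(w) N = |w| N φ(w)`, so the function
kills `N`; and `φ x₀ - 1` is a multiple of `N`. -/
theorem resultantDet_smul_eq_zero (hφ : IsLParameter (ℓ := ℓ) φ) (hP : ∀ w ∈ P, φ w = 1)
    (b : (PadicAlgCl ℓ)[W p]) :
    resultantDet (normChar p ℓ) b φ • ((φ D.x₀ : Matrix (Fin n) (Fin n) A) - 1) = 0 := by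
  set Y := (φ D.x₀ : Matrix (Fin n) (Fin n) A) - 1 with hY
  have hYK : Y ^ (D.K + 2) = 0 := by
    rw [pow_add, D.pow_eq_zero A φ hφ hP, zero_mul]
  obtain ⟨F, hF⟩ := exists_frobenius p
  let N := Polynomial.aeval Y (truncLog (PadicAlgCl ℓ) (D.K + 2))
  have hconj : ∀ (w : W p) (m : ℕ), degree p w = Multiplicative.ofAdd (m : ℤ) →
      (φ w : Matrix (Fin n) (Fin n) A) * N * ((φ w)⁻¹ : GL (Fin n) A) =
        ((p ^ m : ℕ) : PadicAlgCl ℓ) • N := by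
    intro w m hw
    rw [← truncLog.aeval_pow_sub_one hYK, ← truncLog.aeval_conj]
    congr 2
    rw [hY, add_sub_cancel, mul_sub, sub_mul, mul_one, ← Units.val_mul, ← Units.val_mul,
      ← Units.val_mul, mul_inv_cancel, D.conj_eq_pow A φ hP w m hw, Units.val_pow_eq_pow_val,
      Units.val_one]
  have hchar : ∀ (w : W p) (m : ℕ), degree p w = Multiplicative.ofAdd (m : ℤ) →
      (normChar p ℓ w : PadicAlgCl ℓ) = ((p ^ m : ℕ) : PadicAlgCl ℓ) := by
    intro w m hw
    rw [normChar, MonoidHom.comp_apply, hw]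
    simp
  -- The relation defines a subgroup, so it is enough to have it in degrees `0` and `1`, where
  -- conjugation is an honest power.
  let H : Subgroup (W p) :=
    { carrier := {w | (φ w : Matrix (Fin n) (Fin n) A) * N =
        (normChar p ℓ w : PadicAlgCl ℓ) • (N * (φ w : Matrix (Fin n) (Fin n) A))}
      one_mem' := by simp
      mul_mem' := fun {v w} (hv : _ = _) (hw : _ = _) => by
        change _ = _
        rw [map_mul, Units.val_mul, mul_assoc, hw, Matrix.mul_smul, ← mul_assoc, hv, Matrix.smul_mul,
          smul_smul, map_mul, Units.val_mul, mul_comm (normChar p ℓ w : PadicAlgCl ℓ), mul_assoc N]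
      inv_mem' := fun {v} (hv : _ = _) => by
        change _ = _
        have h1 : N * (φ v⁻¹ : Matrix (Fin n) (Fin n) A) =
            (normChar p ℓ v : PadicAlgCl ℓ) • ((φ v⁻¹ : Matrix (Fin n) (Fin n) A) * N) := by
          have h2 : (φ v⁻¹ : Matrix (Fin n) (Fin n) A) * (φ v : Matrix (Fin n) (Fin n) A) = 1 := by
            rw [← Units.val_mul, ← map_mul, inv_mul_cancel, map_one, Units.val_one]
          have h3 : (φ v : Matrix (Fin n) (Fin n) A) * (φ v⁻¹ : Matrix (Fin n) (Fin n) A) = 1 := by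
            rw [← Units.val_mul, ← map_mul, mul_inv_cancel, map_one, Units.val_one]
          conv_lhs => rw [← one_mul N, ← h2, mul_assoc _ _ N, hv]
          rw [Matrix.mul_smul, Matrix.smul_mul, mul_assoc, mul_assoc N, h3, mul_one]
        rw [h1, smul_smul, ← Units.val_mul, ← map_mul, inv_mul_cancel, map_one, Units.val_one,
          one_smul] }
  have hmem : ∀ (w : W p) (m : ℕ), degree p w = Multiplicative.ofAdd (m : ℤ) → w ∈ H := by
    intro w m hw
    change _ = _
    rw [hchar w m hw, ← Matrix.smul_mul, ← hconj w m hw, mul_assoc, ← Units.val_mul, inv_mul_cancel,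
      Units.val_one, mul_one]
  have htop : H = ⊤ := subgroup_eq_top (fun w hw => hmem w 0 hw) hF (hmem F 1 hF)
  have h1 : resultantDet (normChar p ℓ) b φ • N = 0 :=
    LParameter.resultantDet_smul_eq_zero fun w => (show w ∈ H from htop ▸ Subgroup.mem_top w)
  obtain ⟨V, hV⟩ := truncLog.exists_mul_eq (k := PadicAlgCl ℓ) hYK
  rw [← hV, ← Matrix.smul_mul]
  exact (congrArg (· * V) h1).trans (zero_mul V)

end MonodromyData

end LParameter

/-! ### Finitely many invariants that characterize the parameter -/

namespace LParameter

open WeilGroup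

variable {p ℓ : ℕ} [Fact p.Prime] [Fact ℓ.Prime] {n : ℕ} {P : Subgroup (W p)}

theorem resultantDet_eq_one {k G : Type*} [Field k] [Group G] {A : Type*} [CommRing A]
    [Algebra k A] {χ : G →* kˣ} {b : k[G]} {ρ : G →* GL (Fin n) A} (h1 : (algAct k ρ b).det = 1)
    (h2 : (algAct k ρ (twistAlg χ b)).charpoly = Polynomial.X ^ n) : resultantDet χ b ρ = 1 := by
  rw [resultantDet, h2, map_pow, Polynomial.aeval_X, Matrix.det_pow, h1, one_pow]

theorem normChar_frobenius_pow_ne_one {F : W p} (hF : degree p F = Multiplicative.ofAdd (1 : ℤ))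
    (m : ℕ) (hm : m ≠ 0) : (normChar p ℓ F : PadicAlgCl ℓ) ^ m ≠ 1 := by
  have : (normChar p ℓ F : PadicAlgCl ℓ) = p := by
    rw [normChar, MonoidHom.comp_apply, hF]
    simp
  rw [this]
  exact_mod_cast (Nat.one_lt_pow hm (Fact.out : p.Prime).one_lt).ne'

/-- A parameter `φ` whose constituents are pairwise distinct, also after a twist by `|·|_p`, is
characterized up to conjugation by the values of finitely many invariant functions. -/
theorem exists_characterizing_elements {r : ℕ} {φ : W p →* GL (Fin n) (PadicAlgCl ℓ)}
    (hφ : IsLParameter (ℓ := ℓ) φ) {d : Fin r → ℕ}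
    {ψ : (i : Fin r) → W p →* GL (Fin (d i)) (PadicAlgCl ℓ)}
    (hirr : ∀ i, (toRep (ψ i)).IsIrreducible)
    (hsum : Nonempty ((toRep φ).Equiv (Representation.directSum fun i => toRep (ψ i))))
    (hne : ∀ i j, i ≠ j → ¬ Nonempty ((toRep (ψ i)).Equiv (toRep (ψ j))))
    (htw : ∀ i j, i ≠ j →
      ¬ Nonempty ((toRep (ψ i)).Equiv ((toRep (ψ j)).charTwist (normChar p ℓ))))
    (hP : ∀ w ∈ P, φ w = 1) (D : MonodromyData ℓ n P) :
    ∃ (b : (PadicAlgCl ℓ)[W p])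
      (B : ∀ i, Matrix (Fin (d i)) (Fin (d i)) (PadicAlgCl ℓ)[W p]),
      algAct (PadicAlgCl ℓ) φ b = 1 ∧
      algAct (PadicAlgCl ℓ) φ (twistAlg (normChar p ℓ) b) = 0 ∧
      (∀ i, (blockAct (PadicAlgCl ℓ) (d i) φ (B i)).det = 0) ∧
      ∀ (K : Type) [Field K] [Algebra (PadicAlgCl ℓ) K] (φ' : W p →* GL (Fin n) K),
        IsLParameter (ℓ := ℓ) φ' → (∀ w ∈ P, φ' w = 1) → resultantDet (normChar p ℓ) b φ' ≠ 0 →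
        (∀ i, (blockAct (PadicAlgCl ℓ) (d i) φ' (B i)).det = 0) →
        ∃ g : GL (Fin n) K, ∀ w, φ' w =
          g * Matrix.GeneralLinearGroup.map (algebraMap (PadicAlgCl ℓ) K) (φ w) * g⁻¹ := by
  obtain ⟨e⟩ := hsum
  obtain ⟨ι, π, hι, hπ, hπι, hπι', hιπ⟩ := exists_matrix_decomposition e
  obtain ⟨F, hF⟩ := exists_frobenius p
  obtain ⟨b, hb, hb'⟩ := exists_algAct_eq_one_twist_eq_zero ψ hirr hne htw
    (normChar_frobenius_pow_ne_one (ℓ := ℓ) hF)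
  have h1 : algAct (PadicAlgCl ℓ) φ b = 1 := by
    simp only [algAct_eq_sum hι hιπ, hb, Matrix.mul_one, hιπ]
  have h2 : algAct (PadicAlgCl ℓ) φ (twistAlg (normChar p ℓ) b) = 0 := by
    simp only [algAct_eq_sum hι hιπ, hb', Matrix.mul_zero, Matrix.zero_mul, Finset.sum_const_zero]
  have htriv : ∀ (K : Type) [Field K] [Algebra (PadicAlgCl ℓ) K] (φ' : W p →* GL (Fin n) K),
      IsLParameter (ℓ := ℓ) φ' → (∀ w ∈ P, φ' w = 1) → resultantDet (normChar p ℓ) b φ' ≠ 0 →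
      ∀ x ∈ D.J, φ' x = 1 := by
    intro K _ _ φ' hφ' hP' hb
    refine D.eq_one_of_eq_one hφ' hP' (Units.ext ?_)
    exact sub_eq_zero.1 ((smul_eq_zero.1 (D.resultantDet_smul_eq_zero hφ' hP' b)).resolve_left hb)
  have hJφ : ∀ x ∈ D.J, φ x = 1 := by
    refine htriv _ φ hφ hP ?_
    rw [resultantDet_eq_one (by rw [h1, Matrix.det_one])
      (by rw [h2, Matrix.charpoly_zero, Fintype.card_fin])]
    exact one_ne_zero
  -- The constituents inherit triviality on `J` from `φ`.
  have hJψ : ∀ i, ∀ x ∈ D.J, ψ i x = 1 := by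
    intro i x hx
    ext1
    rw [← Matrix.mul_one (ψ i x : Matrix (Fin (d i)) (Fin (d i)) (PadicAlgCl ℓ)), ← hπι i, ← Matrix.mul_assoc, hπ,
      hJφ x hx, Units.val_one, Matrix.mul_one, hπι, Units.val_one]
  have hfin := finite_inertia_quotient D.isOpen
  let _ := Fintype.ofFinite (inertia p ⧸ D.J.subgroupOf (inertia p))
  have hgen : ∀ H : Subgroup (W p), inertia p ≤ H → F ∈ H → H = ⊤ :=
    fun H hI hFH => subgroup_eq_top hI hF hFH
  have hd : ∀ i, Nonempty (Fin (d i)) := by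
    intro i
    by_contra hd
    rw [not_nonempty_iff] at hd
    obtain ⟨x, y, hxy⟩ := (hirr i).exists_pair_ne
    exact hxy (Subrepresentation.toSubmodule_injective (Subsingleton.elim _ _))
  -- For a representation trivial on `J`, the determinant of this matrix vanishes exactly when there
  -- is a nonzero map from `ψ i`; for `φ` itself the inclusion `ι i` is one.
  refine ⟨b, fun i => 1 - averageMatrix (inertia p) D.J F (ψ i), h1, h2, fun i => ?_, ?_⟩
  · refine (exists_intertwiner_iff hJφ (hJψ i) hgen).1 ⟨ι i, fun h0 => ?_, fun w => ?_⟩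
    · have := hπι i
      rw [h0, Matrix.mul_zero] at this
      exact zero_ne_one this
    · rw [hι]
      congr 1
  · intro K _ _ φ' hφ' hP' hb hB
    have hX := fun i => (exists_intertwiner_iff (htriv K φ' hφ' hP' hb) (hJψ i) hgen).2 (hB i)
    choose X hX0 hX using hX
    exact exists_conj_of_intertwiners hirr hne hι hπ hπι hπι' hιπ hX0 hX

end LParameter

/-! ### Fibres of `θ` and closed points -/

namespace LParameter

open WeilGroup

variable {p ℓ : ℕ} [Fact p.Prime] [Fact ℓ.Prime] {n : ℕ} {P : Subgroup (W p)}

namespace ModuliSpace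

variable (X : ModuliSpace ℓ n P)

theorem isLParameter_param {A : Type} [CommRing A] [Algebra (PadicAlgCl ℓ) A]
    (f : X.R →ₐ[PadicAlgCl ℓ] A) : IsLParameter (ℓ := ℓ) (X.param f) :=
  X.isLParameter.map f

theorem param_trivial_on {A : Type} [CommRing A] [Algebra (PadicAlgCl ℓ) A]
    (f : X.R →ₐ[PadicAlgCl ℓ] A) (w : W p) (hw : w ∈ P) : X.param f w = 1 := by
  rw [param, MonoidHom.comp_apply, X.trivial_on w hw, map_one]

theorem param_comp {A B : Type} [CommRing A] [Algebra (PadicAlgCl ℓ) A] [CommRing B]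
    [Algebra (PadicAlgCl ℓ) B] (f : X.R →ₐ[PadicAlgCl ℓ] A) (g : A →ₐ[PadicAlgCl ℓ] B) (w : W p) :
    X.param (g.comp f) w = Matrix.GeneralLinearGroup.map (g : A →+* B) (X.param f w) := rfl

theorem apply_resultantDet {A : Type} [CommRing A] [Algebra (PadicAlgCl ℓ) A]
    (f : X.R →ₐ[PadicAlgCl ℓ] A) (χ : W p →* (PadicAlgCl ℓ)ˣ) (b : (PadicAlgCl ℓ)[W p]) :
    f (resultantDet χ b X.univ) = resultantDet χ b (X.param f) :=
  map_resultantDet X.univ f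

theorem apply_det_blockAct {A : Type} [CommRing A] [Algebra (PadicAlgCl ℓ) A]
    (f : X.R →ₐ[PadicAlgCl ℓ] A) {d : ℕ} (B : Matrix (Fin d) (Fin d) (PadicAlgCl ℓ)[W p]) :
    f (blockAct (PadicAlgCl ℓ) d X.univ B).det = (blockAct (PadicAlgCl ℓ) d (X.param f) B).det := by
  refine Eq.trans ?_ (congrArg Matrix.det (map_blockAct X.univ f B))
  exact AlgHom.map_det f _

theorem resultantDet_mem_invariants (χ : W p →* (PadicAlgCl ℓ)ˣ) (b : (PadicAlgCl ℓ)[W p]) :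
    resultantDet χ b X.univ ∈ X.invariants := by
  rintro A _ _ f f' ⟨g, hg⟩
  rw [apply_resultantDet, apply_resultantDet, resultantDet_conj hg]

theorem det_blockAct_mem_invariants {d : ℕ} (B : Matrix (Fin d) (Fin d) (PadicAlgCl ℓ)[W p]) :
    (blockAct (PadicAlgCl ℓ) d X.univ B).det ∈ X.invariants := by
  rintro A _ _ f f' ⟨g, hg⟩
  rw [apply_det_blockAct, apply_det_blockAct, det_blockAct_conj hg]

variable {X}

theorem ker_invariants_isMaximal (f : X.R →ₐ[PadicAlgCl ℓ] PadicAlgCl ℓ) :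
    (PrimeSpectrum.comap X.invariants.val.toRingHom (X.specPoint f)).asIdeal.IsMaximal := by
  have : (PrimeSpectrum.comap X.invariants.val.toRingHom (X.specPoint f)).asIdeal =
      RingHom.ker (f.comp X.invariants.val) := by
    ext a
    rfl
  rw [this]
  exact RingHom.ker_isMaximal_of_surjective _ fun c =>
    ⟨algebraMap _ _ c, AlgHom.commutes _ c⟩

/-- If an invariant-theoretic fibre has only one geometric point up to conjugation, then the
corresponding fibre of `θ` is a single closed point. -/
theorem theta_fibre_eq (f₀ : X.R →ₐ[PadicAlgCl ℓ] PadicAlgCl ℓ)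
    (h : ∀ (K : Type) [Field K] [Algebra (PadicAlgCl ℓ) K] [IsAlgClosed K]
      (f : X.R →ₐ[PadicAlgCl ℓ] K), (∀ a ∈ X.invariants, f a = algebraMap (PadicAlgCl ℓ) K (f₀ a)) →
      X.Conj ((Algebra.ofId (PadicAlgCl ℓ) K).comp f₀) f) :
    X.theta ⁻¹' {X.theta (X.stackPoint f₀)} = {X.stackPoint f₀} := by
  ext y
  refine ⟨fun hy => ?_, fun hy => by rw [Set.mem_singleton_iff.1 hy]; rfl⟩
  obtain ⟨z, rfl⟩ := Quot.exists_rep y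
  have hy' : PrimeSpectrum.comap X.invariants.val.toRingHom z =
    PrimeSpectrum.comap X.invariants.val.toRingHom (X.specPoint f₀) := hy
  -- A geometric point supported at `z`.
  let K := AlgebraicClosure (FractionRing (X.R ⧸ z.asIdeal))
  let f : X.R →ₐ[PadicAlgCl ℓ] K :=
    ((Algebra.ofId (FractionRing (X.R ⧸ z.asIdeal)) K).restrictScalars (PadicAlgCl ℓ)).comp
      ((IsScalarTower.toAlgHom (PadicAlgCl ℓ) (X.R ⧸ z.asIdeal) (FractionRing (X.R ⧸ z.asIdeal))).comp
        (Ideal.Quotient.mkₐ (PadicAlgCl ℓ) z.asIdeal))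
  have hker : ∀ a, f a = 0 ↔ a ∈ z.asIdeal := by
    intro a
    change algebraMap (FractionRing (X.R ⧸ z.asIdeal)) K (algebraMap (X.R ⧸ z.asIdeal)
      (FractionRing (X.R ⧸ z.asIdeal)) (Ideal.Quotient.mk z.asIdeal a)) = 0 ↔ _
    rw [FaithfulSMul.algebraMap_eq_zero_iff, FaithfulSMul.algebraMap_eq_zero_iff,
      Ideal.Quotient.eq_zero_iff_mem]
  have hinv : ∀ a ∈ X.invariants, f a = algebraMap (PadicAlgCl ℓ) K (f₀ a) := by
    intro a ha
    -- This invariant vanishes at `f₀`, hence at `z`, which has the same image in the categorical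
    -- quotient. Equality of primes thus yields equality of values.
    have h1 : a - algebraMap (PadicAlgCl ℓ) X.R (f₀ a) ∈ X.invariants :=
      sub_mem ha (X.invariants.algebraMap_mem _)
    have h2 : (⟨_, h1⟩ : X.invariants) ∈
        (PrimeSpectrum.comap X.invariants.val.toRingHom (X.specPoint f₀)).asIdeal := by
      change f₀ (a - algebraMap (PadicAlgCl ℓ) X.R (f₀ a)) = 0
      rw [map_sub, AlgHom.commutes, Algebra.algebraMap_self, RingHom.id_apply, sub_self]
    rw [← hy'] at h2
    have h3 : f (a - algebraMap (PadicAlgCl ℓ) X.R (f₀ a)) = 0 := (hker _).2 h2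
    rwa [map_sub, AlgHom.commutes, sub_eq_zero] at h3
  have hconj := h K f hinv
  refine (Quot.sound (r := X.StackRel) ⟨K, _, _, _, f, hconj, ?_, ?_⟩).symm
  · ext a
    change algebraMap (PadicAlgCl ℓ) K (f₀ a) = 0 ↔ f₀ a = 0
    rw [FaithfulSMul.algebraMap_eq_zero_iff]
  · ext a
    exact hker a

theorem continuous_theta : Continuous X.theta :=
  continuous_quot_lift _ (PrimeSpectrum.continuous_comap _)

theorem isClosed_stackPoint (f₀ : X.R →ₐ[PadicAlgCl ℓ] PadicAlgCl ℓ)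
    (h : X.theta ⁻¹' {X.theta (X.stackPoint f₀)} = {X.stackPoint f₀}) :
    IsClosed {X.stackPoint f₀} := by
  rw [← h]
  refine IsClosed.preimage continuous_theta ?_
  exact (PrimeSpectrum.isClosed_singleton_iff_isMaximal _).2 (ker_invariants_isMaximal f₀)

end ModuliSpace

end LParameter

/-! ### Lifting representations along square-zero surjections -/

section SquareZero

variable {M M' : Type*} [Ring M] [Ring M'] {q : M →+* M'}

theorem isUnit_of_isUnit_map_of_ker_mul (hq : Function.Surjective q)
    (h0 : ∀ x y, q x = 0 → q y = 0 → x * y = 0) {m : M} (hm : IsUnit (q m)) : IsUnit m := by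
  obtain ⟨u, hu⟩ := hm
  obtain ⟨m', hm'⟩ := hq (u⁻¹ : M'ˣ)
  have key : ∀ x, q x = 1 → IsUnit x := by
    intro x hx
    have h1 : q (x - 1) = 0 := by rw [map_sub, hx, map_one, sub_self]
    have h2 : IsNilpotent (x - 1) := ⟨2, by rw [sq, h0 _ _ h1 h1]⟩
    simpa using h2.isUnit_add_one
  obtain ⟨v, hv⟩ := key (m * m') (by rw [map_mul, ← hu, hm', Units.mul_inv])
  obtain ⟨v', hv'⟩ := key (m' * m) (by rw [map_mul, ← hu, hm', Units.inv_mul])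
  have h1 : m * (m' * (v⁻¹ : Mˣ)) = 1 := by rw [← mul_assoc, ← hv, Units.mul_inv]
  have h2 : ((v'⁻¹ : Mˣ) * m') * m = 1 := by rw [mul_assoc, ← hv', Units.inv_mul]
  exact ⟨⟨m, m' * (v⁻¹ : Mˣ), h1, by rwa [left_inv_eq_right_inv h2 h1] at h2⟩, rfl⟩

theorem exists_unit_lift (hq : Function.Surjective q)
    (h0 : ∀ x y, q x = 0 → q y = 0 → x * y = 0) (u : M'ˣ) :
    ∃ v : Mˣ, q v = u := by
  obtain ⟨m, hm⟩ := hq u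
  obtain ⟨v, rfl⟩ := isUnit_of_isUnit_map_of_ker_mul hq h0 (m := m) (hm ▸ u.isUnit)
  exact ⟨v, hm⟩

variable {D : Type*} [Group D] [Finite D] (k : Type*) [Field k] [CharZero k] [Algebra k M]
  [Algebra k M']

/-- Homomorphisms from finite groups lift along surjections with square-zero kernel. -/
theorem exists_monoidHom_lift (hq : Function.Surjective q)
    (h0 : ∀ x y, q x = 0 → q y = 0 → x * y = 0) (hqk : ∀ (c : k) x, q (c • x) = c • q x)
    (σ : D →* M'ˣ) : ∃ S : D →* Mˣ, ∀ x, q (S x) = σ x := by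
  have := Fintype.ofFinite D
  choose s hs using fun x => exists_unit_lift hq h0 (σ x)
  set c : k := (Fintype.card D : k)⁻¹ with hc
  have hcard : c * (Fintype.card D : k) = 1 :=
    inv_mul_cancel₀ (Nat.cast_ne_zero.2 Fintype.card_ne_zero)
  have hcs : ∀ x : M, c • ∑ _z : D, x = x := fun x => by
    rw [Finset.sum_const, Finset.card_univ, ← Nat.cast_smul_eq_nsmul k, smul_smul, hcard, one_smul]
  have hs' : ∀ x, q ((s x)⁻¹ : Mˣ) = ((σ x)⁻¹ : M'ˣ) := fun x => by
    refine (Units.inv_eq_of_mul_eq_one_right (?_)).symm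
    rw [← hs, ← map_mul, Units.mul_inv, map_one]
  let e (x y : D) : M := s x * s y - s (x * y)
  have he : ∀ x y, q (e x y) = 0 := fun x y => by
    simp only [e]
    rw [map_sub, map_mul, hs, hs, hs, map_mul, Units.val_mul, sub_self]
  -- The set-theoretic lift `s`, corrected by the averaged defect. The defect `e` is a 2-cocycle
  -- with values in the kernel, and averaging exhibits it as a coboundary because the order of `D`
  -- is invertible.
  let S₀ (x : D) : M := c • ∑ z, (s (x * z) : M) * ((s z)⁻¹ : Mˣ)
  have hqS : ∀ x, q (S₀ x) = σ x := fun x => by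
    simp only [S₀]
    rw [hqk, map_sum]
    have : ∀ z ∈ Finset.univ, q ((s (x * z) : M) * ((s z)⁻¹ : Mˣ)) = σ x := fun z _ => by
      rw [map_mul, hs, hs', map_mul, Units.val_mul, mul_assoc, Units.mul_inv, mul_one]
    rw [Finset.sum_congr rfl this, Finset.sum_const, Finset.card_univ, ← Nat.cast_smul_eq_nsmul k,
      smul_smul, hcard, one_smul]
  have hS : ∀ x, S₀ x = s x - c • ∑ z, e x z * ((s z)⁻¹ : Mˣ) := fun x => by
    simp only [S₀, e, sub_mul, mul_assoc, Units.mul_inv, mul_one]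
    rw [Finset.sum_sub_distrib, smul_sub, hcs, sub_sub_cancel]
  have hcoc : ∀ x y z, s x * (e y z * ((s z)⁻¹ : Mˣ)) + e x (y * z) * ((s z)⁻¹ : Mˣ) =
      e x y + e (x * y) z * ((s z)⁻¹ : Mˣ) := fun x y z => by
    have h1 : s x * e y z + e x (y * z) = e x y * s z + e (x * y) z := by
      simp only [e, mul_sub, sub_mul, mul_assoc]
      abel
    rw [← mul_assoc, ← add_mul, h1, add_mul, mul_assoc, Units.mul_inv, mul_one]
  let t (x : D) : M := c • ∑ z, e x z * ((s z)⁻¹ : Mˣ)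
  have ht : ∀ x, q (t x) = 0 := fun x => by
    simp only [t]
    rw [hqk, map_sum, Finset.sum_eq_zero fun z _ => by rw [map_mul, he, zero_mul], smul_zero]
  have hts : ∀ x y, t x * s y = c • ∑ z, e x (y * z) * ((s z)⁻¹ : Mˣ) := fun x y => by
    simp only [t]
    rw [smul_mul_assoc, Finset.sum_mul, ← Equiv.sum_comp (Equiv.mulLeft y)]
    congr 1
    refine Finset.sum_congr rfl fun z _ => ?_
    -- The elements `(s (y z))⁻¹ s y` and `(s z)⁻¹` agree modulo the kernel, and `e` annihilates
    -- their difference.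
    rw [Equiv.coe_mulLeft, mul_assoc, ← sub_eq_zero, ← mul_sub]
    refine h0 _ _ (he _ _) ?_
    rw [map_sub, map_mul, hs', hs', hs, map_mul, mul_inv_rev, Units.val_mul,
      Units.inv_mul_cancel_right, sub_self]
  have hmul : ∀ x y, S₀ (x * y) = S₀ x * S₀ y := fun x y => by
    have h1 : s x * t y + t x * s y = e x y + t (x * y) := by
      rw [hts]
      simp only [t]
      rw [mul_smul_comm, Finset.mul_sum, ← smul_add, ← Finset.sum_add_distrib,
        Finset.sum_congr rfl fun z _ => hcoc x y z, Finset.sum_add_distrib, smul_add, hcs]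
    have h2 : t x * t y = 0 := h0 _ _ (ht x) (ht y)
    rw [hS, hS, hS]
    change (s (x * y) : M) - t (x * y) = (s x - t x) * (s y - t y)
    rw [sub_mul, mul_sub, mul_sub, h2, eq_sub_of_add_eq' h1.symm]
    simp only [e]
    abel
  refine ⟨MonoidHom.toHomUnits
    { toFun := S₀
      map_one' := by
        simp only [S₀, one_mul, Units.mul_inv]
        exact hcs 1
      map_mul' := hmul }, fun x => hqS x⟩

/-- Elements intertwining a representation of a finite group with a conjugate lift along surjections
with square-zero kernel. -/
theorem exists_intertwiner_lift (hq : Function.Surjective q)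
    (h0 : ∀ x y, q x = 0 → q y = 0 → x * y = 0) (hqk : ∀ (c : k) x, q (c • x) = c • q x)
    (S : D →* Mˣ) (c : D →* D) (g : M'ˣ) (hg : ∀ x, (g : M') * q (S x) = q (S (c x)) * g) :
    ∃ G : Mˣ, q G = g ∧ ∀ x, G * S x = S (c x) * G := by
  have := Fintype.ofFinite D
  obtain ⟨G₀, hG₀⟩ := exists_unit_lift hq h0 g
  set a : k := (Fintype.card D : k)⁻¹ with ha
  have hcard : a * (Fintype.card D : k) = 1 :=
    inv_mul_cancel₀ (Nat.cast_ne_zero.2 Fintype.card_ne_zero)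
  -- Every summand reduces to `g`, so averaging makes the lift equivariant without changing its
  -- reduction.
  let G : M := a • ∑ y, (S (c y) : M) * G₀ * (S y⁻¹ : Mˣ)
  have hG : q G = g := by
    simp only [G]
    have : ∀ y ∈ Finset.univ, q ((S (c y) : M) * G₀ * (S y⁻¹ : Mˣ)) = g := fun y _ => by
      rw [map_mul, map_mul, hG₀, ← hg, mul_assoc, ← map_mul, ← Units.val_mul, ← map_mul,
        mul_inv_cancel, map_one, Units.val_one, map_one, mul_one]
    rw [hqk, map_sum, Finset.sum_congr rfl this, Finset.sum_const, Finset.card_univ,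
      ← Nat.cast_smul_eq_nsmul k, smul_smul, hcard, one_smul]
  obtain ⟨u, hu⟩ := isUnit_of_isUnit_map_of_ker_mul hq h0 (m := G) (hG ▸ g.isUnit)
  refine ⟨u, hu ▸ hG, fun x => Units.ext ?_⟩
  rw [Units.val_mul, Units.val_mul, hu]
  simp only [G]
  rw [smul_mul_assoc, mul_smul_comm, Finset.sum_mul, Finset.mul_sum,
    ← Equiv.sum_comp (Equiv.mulLeft x)]
  congr 1
  refine Finset.sum_congr rfl fun y _ => ?_
  rw [Equiv.coe_mulLeft, mul_inv_rev, map_mul, map_mul, map_mul, Units.val_mul, Units.val_mul]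
  simp only [mul_assoc]
  rw [← Units.val_mul (S x⁻¹), ← map_mul, inv_mul_cancel, map_one, Units.val_one, mul_one]

end SquareZero

/-- A homomorphism from the kernel of a map to `ℤ`, together with a compatible value at an element of
degree one, extends to the whole group. -/
theorem exists_monoidHom_of_ker_degree {G H : Type*} [Group G] [Group H]
    {deg : G →* Multiplicative ℤ} {F : G} (hF : deg F = Multiplicative.ofAdd 1)
    (α : deg.ker →* H) (g : H)
    (hg : ∀ x y : deg.ker, (y : G) = F * x * F⁻¹ → g * α x * g⁻¹ = α y) :
    ∃ ρ : G →* H, (∀ x : deg.ker, ρ x = α x) ∧ ρ F = g := by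
  have hd : ∀ m : ℤ, deg (F ^ m) = Multiplicative.ofAdd m := fun m => by
    rw [map_zpow, hF, ← ofAdd_zsmul, smul_eq_mul, mul_one]
  have hconj : ∀ (m : ℤ) (x y : deg.ker), (y : G) = F ^ m * x * (F ^ m)⁻¹ →
      g ^ m * α x * (g ^ m)⁻¹ = α y := by
    intro m
    induction m using Int.induction_on with
    | zero =>
      intro x y h
      have : y = x := Subtype.ext (by simpa using h)
      simp [this]
    | succ m ih =>
      intro x y h
      have hx := deg.normal_ker.conj_mem _ x.2 F
      rw [zpow_add_one, mul_inv_rev, ← ih ⟨_, hx⟩ y (by rw [h]; simp only [zpow_add_one]; group),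
        ← hg x ⟨_, hx⟩ rfl]
      group
    | pred m ih =>
      intro x y h
      have hx := deg.normal_ker.conj_mem _ x.2 F⁻¹
      have h1 := hg ⟨_, hx⟩ x (by simp; group)
      rw [zpow_sub_one, mul_inv_rev, ← ih ⟨_, hx⟩ y (by rw [h]; simp only [zpow_sub_one]; group), ← h1]
      group
  have hmem : ∀ w : G, w * (F ^ (deg w).toAdd)⁻¹ ∈ deg.ker := fun w => by
    rw [MonoidHom.mem_ker, map_mul, map_inv, hd, ofAdd_toAdd, mul_inv_cancel]
  -- Write `w = (w F⁻ᵈ) Fᵈ` with `d = deg w`: the group is a semidirect product with the free group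
  -- `ℤ`, so no further relation has to be checked.
  let ρ : G →* H :=
    { toFun := fun w => α ⟨_, hmem w⟩ * g ^ (deg w).toAdd
      map_one' := by
        have : (⟨_, hmem 1⟩ : deg.ker) = 1 := Subtype.ext (by simp)
        rw [this]
        simp
      map_mul' := fun v w => by
        have h1 : (⟨_, hmem (v * w)⟩ : deg.ker) = ⟨_, hmem v⟩ *
            ⟨_, deg.normal_ker.conj_mem _ (hmem w) (F ^ (deg v).toAdd)⟩ := by
          refine Subtype.ext ?_
          simp only [map_mul, toAdd_mul, zpow_add, Subgroup.coe_mul]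
          group
        rw [h1, map_mul, ← hconj (deg v).toAdd ⟨_, hmem w⟩ ⟨_, _⟩ rfl, map_mul, toAdd_mul, zpow_add]
        group }
  refine ⟨ρ, fun x => ?_, ?_⟩
  · have hx : deg x = 1 := x.2
    have h1 : (⟨_, hmem x⟩ : deg.ker) = x := Subtype.ext (by simp [hx])
    change α ⟨_, hmem x⟩ * g ^ (deg x).toAdd = _
    rw [h1, hx, toAdd_one, zpow_zero, mul_one]
  · change α _ * _ = _
    have : (⟨_, hmem F⟩ : deg.ker) = 1 := Subtype.ext (by simp [hF])
    rw [this, map_one, one_mul, hF]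
    simp

/-! ### Smoothness where the monodromy vanishes -/

namespace LParameter

open WeilGroup

variable {p ℓ : ℕ} [Fact p.Prime] [Fact ℓ.Prime] {n : ℕ} {P : Subgroup (W p)}

/-- L-parameters with finite image of inertia lift along square-zero thickenings. -/
theorem exists_lift_of_trivial {B : Type} [CommRing B] [Algebra (PadicAlgCl ℓ) B] (I : Ideal B)
    (hI : I ^ 2 = ⊥) {J : Subgroup (W p)} (hJ : IsOpen (J : Set (W p)))
    (φ : W p →* GL (Fin n) (B ⧸ I)) (hφJ : ∀ w ∈ J, φ w = 1) :
    ∃ ρ : W p →* GL (Fin n) B,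
      (∀ w, Matrix.GeneralLinearGroup.map (Ideal.Quotient.mk I) (ρ w) = φ w) ∧
      ∀ w ∈ inertia p, φ w = 1 → ρ w = 1 := by
  obtain ⟨F, hF⟩ := exists_frobenius p
  let q : Matrix (Fin n) (Fin n) B →+* Matrix (Fin n) (Fin n) (B ⧸ I) :=
    (Ideal.Quotient.mk I).mapMatrix
  have hq : Function.Surjective q := fun M => by
    choose N hN using fun i j => Ideal.Quotient.mk_surjective (M i j)
    exact ⟨Matrix.of N, Matrix.ext fun i j => hN i j⟩
  have h0 : ∀ x y, q x = 0 → q y = 0 → x * y = 0 := by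
    intro x y hx hy
    ext i j
    rw [Matrix.mul_apply, Matrix.zero_apply]
    refine Finset.sum_eq_zero fun l _ => ?_
    have h1 : x i l ∈ I := Ideal.Quotient.eq_zero_iff_mem.1 (congrFun (congrFun hx i) l)
    have h2 : y l j ∈ I := Ideal.Quotient.eq_zero_iff_mem.1 (congrFun (congrFun hy l) j)
    have := Ideal.mul_mem_mul h1 h2
    rwa [← sq, hI] at this
  have hqk : ∀ (c : PadicAlgCl ℓ) x, q (c • x) = c • q x := fun c x => by
    ext i j
    exact map_smul (Ideal.Quotient.mkₐ (PadicAlgCl ℓ) I) c (x i j)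
  -- Lifting the finite image of inertia, rather than a quotient of inertia, ensures that the lift
  -- kills everything in inertia that `φ` kills, in particular `P`.
  let D : Subgroup (GL (Fin n) (B ⧸ I)) := (inertia p).map φ
  have hfin := finite_inertia_quotient hJ
  let τ : inertia p →* D := (φ.comp (inertia p).subtype).codRestrict D fun x => ⟨x, x.2, rfl⟩
  have hτ : Function.Surjective τ := by
    rintro ⟨_, w, hw, rfl⟩
    exact ⟨⟨w, hw⟩, rfl⟩
  have hD : Finite D := by
    refine Finite.of_surjective (fun x : inertia p ⧸ J.subgroupOf (inertia p) => τ x.out) fun y => ?_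
    obtain ⟨x, rfl⟩ := hτ y
    refine ⟨QuotientGroup.mk x, ?_⟩
    have h1 : ((QuotientGroup.mk x : inertia p ⧸ J.subgroupOf (inertia p)).out)⁻¹ * x ∈
      J.subgroupOf (inertia p) := by rw [← QuotientGroup.eq, QuotientGroup.out_eq']
    have h2 : τ (((QuotientGroup.mk x : inertia p ⧸ J.subgroupOf (inertia p)).out)⁻¹ * x) = 1 :=
      Subtype.ext (hφJ _ h1)
    rw [map_mul, map_inv, inv_mul_eq_one] at h2
    exact h2
  obtain ⟨S, hS⟩ := exists_monoidHom_lift (PadicAlgCl ℓ) hq h0 hqk D.subtype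
  have hDF : ∀ x ∈ D, φ F * x * (φ F)⁻¹ ∈ D := by
    rintro _ ⟨w, hw, rfl⟩
    refine ⟨F * w * F⁻¹, (inferInstance : (inertia p).Normal).conj_mem w hw F, ?_⟩
    rw [map_mul, map_mul, map_inv]
  let c : D →* D := ((MulAut.conj (φ F)).toMonoidHom.comp D.subtype).codRestrict D
    fun x => hDF x x.2
  obtain ⟨G, hG, hGS⟩ := exists_intertwiner_lift (PadicAlgCl ℓ) hq h0 hqk S c (φ F) (fun x => by
    rw [hS, hS, ← Units.val_mul, ← Units.val_mul]
    congr 1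
    change _ = φ F * x * (φ F)⁻¹ * φ F
    rw [inv_mul_cancel_right]
    rfl)
  obtain ⟨ρ, hρ, hρF⟩ := exists_monoidHom_of_ker_degree hF (S.comp τ) G (fun x y hxy => by
    have h1 : τ y = c (τ x) := by
      refine Subtype.ext ?_
      change φ y = φ F * φ x * (φ F)⁻¹
      rw [hxy, map_mul, map_mul, map_inv]
    change G * S (τ x) * G⁻¹ = S (τ y)
    rw [h1, hGS, mul_inv_cancel_right])
  refine ⟨ρ, ?_, ?_⟩
  · have htop : ((Matrix.GeneralLinearGroup.map (Ideal.Quotient.mk I)).comp ρ).eqLocus φ = ⊤ := by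
      refine subgroup_eq_top (fun w hw => ?_) hF ?_
      · change Matrix.GeneralLinearGroup.map (Ideal.Quotient.mk I) (ρ w) = φ w
        rw [show ρ w = S (τ ⟨w, hw⟩) from hρ ⟨w, hw⟩]
        exact Units.ext (hS _)
      · change Matrix.GeneralLinearGroup.map (Ideal.Quotient.mk I) (ρ F) = φ F
        rw [hρF]
        exact Units.ext hG
    intro w
    exact (show w ∈ ((Matrix.GeneralLinearGroup.map (Ideal.Quotient.mk I)).comp ρ).eqLocus φ from
      htop ▸ Subgroup.mem_top w)
  · intro w hw h1
    rw [show ρ w = S (τ ⟨w, hw⟩) from hρ ⟨w, hw⟩, show τ ⟨w, hw⟩ = 1 from Subtype.ext h1, map_one]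

namespace ModuliSpace

variable (X : ModuliSpace ℓ n P)

/-- Where `a` is invertible, `x₀` acts trivially, hence so does `J`; such parameters lift along
square-zero thickenings, which is the infinitesimal criterion. Over a field, finite type gives
finite presentation. -/
theorem smooth_away (D : MonodromyData ℓ n P) (hP : P ≤ wildInertia p) {a : X.R}
    (ha : a • ((X.univ D.x₀ : Matrix (Fin n) (Fin n) X.R) - 1) = 0) :
    Algebra.Smooth (PadicAlgCl ℓ) (Localization.Away a) := by
  have h1 : Algebra.FinitePresentation (PadicAlgCl ℓ) (Localization.Away a) := by
    have := X.finiteType D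
    have h2 : Algebra.FiniteType X.R (Localization.Away a) :=
      IsLocalization.finiteType_of_monoid_fg (Submonoid.powers a) _
    exact Algebra.FinitePresentation.of_finiteType.1
      (Algebra.FiniteType.trans this h2)
  refine ⟨Algebra.FormallySmooth.of_comp_surjective fun B _ _ I hI h => ?_, h1⟩
  let f : X.R →ₐ[PadicAlgCl ℓ] B ⧸ I :=
    h.comp (IsScalarTower.toAlgHom (PadicAlgCl ℓ) X.R (Localization.Away a))
  have hfa : IsUnit (f a) :=
    (IsLocalization.Away.algebraMap_isUnit (S := Localization.Away a) a).map h
  have hfJ : ∀ w ∈ D.J, X.param f w = 1 := by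
    refine D.eq_one_of_eq_one (X.isLParameter_param f) (X.param_trivial_on f) (Units.ext ?_)
    have h2 := congrArg (f : X.R →+* B ⧸ I).mapMatrix ha
    have h3 : f a • ((X.param f D.x₀ : Matrix (Fin n) (Fin n) (B ⧸ I)) - 1) = 0 := by
      rw [X.coe_param, ← map_one (f : X.R →+* B ⧸ I).mapMatrix, ← map_sub]
      refine Eq.trans ?_ (h2.trans (map_zero _))
      ext i j
      exact (map_mul f _ _).symm
    obtain ⟨u, hu⟩ := hfa
    rw [← hu] at h3
    have h4 := congrArg (fun M => ((u⁻¹ : (B ⧸ I)ˣ) : B ⧸ I) • M) h3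
    simp only [smul_smul, Units.inv_mul, one_smul, smul_zero] at h4
    exact sub_eq_zero.1 h4
  obtain ⟨ρ, hρ, hρ1⟩ := exists_lift_of_trivial (ℓ := ℓ) I hI D.isOpen (X.param f) hfJ
  let g : X.R →ₐ[PadicAlgCl ℓ] B := X.point ρ
    (isLParameter_of_eq_one (ℓ := ℓ) D.isOpen fun x hx => hρ1 x (D.le_inertia hx) (hfJ x hx))
    (fun w hw => hρ1 w (wildInertia_le_inertia (hP hw)) (X.param_trivial_on f w hw))
  have hg : X.param g = ρ := X.param_point _ _ _
  have hgf : (Ideal.Quotient.mkₐ (PadicAlgCl ℓ) I).comp g = f :=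
    X.hom_ext fun w => by rw [X.param_comp, hg]; exact hρ w
  -- Units lift along square-zero ideals, so the lifted point still factors through the
  -- localization.
  have hga : IsUnit (g a) := by
    refine isUnit_of_isUnit_map_of_ker_mul (q := Ideal.Quotient.mk I)
      Ideal.Quotient.mk_surjective (fun x y hx hy => ?_) ?_
    · have := Ideal.mul_mem_mul (Ideal.Quotient.eq_zero_iff_mem.1 hx)
        (Ideal.Quotient.eq_zero_iff_mem.1 hy)
      rwa [← sq, hI] at this
    · have := DFunLike.congr_fun hgf a
      exact this ▸ hfa
  have hpow : ∀ y : Submonoid.powers a, IsUnit (g y) := by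
    rintro ⟨_, m, rfl⟩
    simp only [map_pow]
    exact hga.pow m
  refine ⟨IsLocalization.liftAlgHom (M := Submonoid.powers a) hpow, ?_⟩
  refine IsLocalization.algHom_ext (Submonoid.powers a) ?_
  refine AlgHom.ext fun x => ?_
  have hlift : IsLocalization.liftAlgHom (M := Submonoid.powers a) (S := Localization.Away a) hpow
      (algebraMap X.R (Localization.Away a) x) = g x := IsLocalization.lift_eq _ x
  exact (congrArg (Ideal.Quotient.mk I) hlift).trans (DFunLike.congr_fun hgf x)

end ModuliSpace

end LParameter

/-! ### Determinants along composition series -/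

section MatrixAction

variable {k R : Type*} [Field k] [Ring R] [Algebra k R] {d : ℕ}

/-- The action of matrices over `R` on tuples of elements of an `R`-module. -/
def matrixAct (k : Type*) [Field k] {R : Type*} [Ring R] [Algebra k R] (M : Type*) [AddCommGroup M]
    [Module k M] [Module R M] [IsScalarTower k R M] (B : Matrix (Fin d) (Fin d) R) :
    (Fin d → M) →ₗ[k] (Fin d → M) :=
  LinearMap.pi fun i => ∑ j, (Algebra.lsmul k k M (B i j)).comp (LinearMap.proj j)

variable {M M' M'' : Type*} [AddCommGroup M] [Module k M] [Module R M] [IsScalarTower k R M]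
  [AddCommGroup M'] [Module k M'] [Module R M'] [IsScalarTower k R M']
  [AddCommGroup M''] [Module k M''] [Module R M''] [IsScalarTower k R M'']
  (B : Matrix (Fin d) (Fin d) R)

theorem LinearMap.det_eq_of_comp_eq {V V' : Type*} [AddCommGroup V] [Module k V] [AddCommGroup V']
    [Module k V'] (e : V ≃ₗ[k] V') {f : V →ₗ[k] V} {f' : V' →ₗ[k] V'}
    (h : ∀ v, e (f v) = f' (e v)) : LinearMap.det f = LinearMap.det f' := by
  rw [← LinearMap.det_conj f e]
  congr 1
  refine LinearMap.ext fun v => ?_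
  change e (f (e.symm v)) = f' v
  rw [h, e.apply_symm_apply]

theorem matrixAct_apply (v : Fin d → M) (i : Fin d) :
    matrixAct k M B v i = ∑ j, B i j • v j := by
  simp [matrixAct]

theorem matrixAct_comp (f : M →ₗ[R] M') (v : Fin d → M) :
    matrixAct k M' B (f ∘ v) = f ∘ matrixAct k M B v := by
  funext i
  rw [Function.comp_apply, matrixAct_apply, matrixAct_apply, map_sum]
  simp

theorem det_matrixAct_of_exact [FiniteDimensional k M] {f : M' →ₗ[R] M} {g : M →ₗ[R] M''}
    (hf : Function.Injective f) (hg : Function.Surjective g) (hfg : Function.Exact f g) :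
    LinearMap.det (matrixAct k M B) =
      LinearMap.det (matrixAct k M' B) * LinearMap.det (matrixAct k M'' B) := by
  let F : (Fin d → M') →ₗ[k] (Fin d → M) := LinearMap.compLeft (f.restrictScalars k) (Fin d)
  let G : (Fin d → M) →ₗ[k] (Fin d → M'') := LinearMap.compLeft (g.restrictScalars k) (Fin d)
  have hF : Function.Injective F := fun v w h => funext fun i => hf (congrFun h i)
  have hG : Function.Surjective G := fun v => by
    choose w hw using fun i => hg (v i)
    exact ⟨w, funext hw⟩
  have hFB : ∀ v, matrixAct k M B (F v) = F (matrixAct k M' B v) := fun v => matrixAct_comp B f v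
  have hGB : ∀ v, matrixAct k M'' B (G v) = G (matrixAct k M B v) := fun v => matrixAct_comp B g v
  have hW : LinearMap.ker G ≤ (LinearMap.ker G).comap (matrixAct k M B) := fun v hv => by
    rw [LinearMap.mem_ker] at hv
    rw [Submodule.mem_comap, LinearMap.mem_ker, ← hGB, hv, map_zero]
  have hker : ∀ v, F v ∈ LinearMap.ker G := fun v => by
    rw [LinearMap.mem_ker]
    exact funext fun i => hfg.apply_apply_eq_zero (v i)
  let e₁ : (Fin d → M') ≃ₗ[k] LinearMap.ker G := LinearEquiv.ofBijective (F.codRestrict _ hker)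
    ⟨fun v w h => hF (congrArg Subtype.val h), fun ⟨v, hv⟩ => by
      choose w hw using fun i => (hfg (v i)).1 (congrFun hv i)
      exact ⟨w, Subtype.ext (funext hw)⟩⟩
  let e₂ : ((Fin d → M) ⧸ LinearMap.ker G) ≃ₗ[k] (Fin d → M'') := G.quotKerEquivOfSurjective hG
  rw [LinearMap.det_eq_det_mul_det (LinearMap.ker G) (matrixAct k M B) hW]
  congr 1
  · refine (LinearMap.det_eq_of_comp_eq e₁ fun v => ?_).symm
    exact Subtype.ext (hFB v).symm
  · refine LinearMap.det_eq_of_comp_eq e₂ fun v => ?_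
    obtain ⟨v, rfl⟩ := Submodule.Quotient.mk_surjective _ v
    exact (hGB v).symm

theorem det_matrixAct_of_equiv (e : M ≃ₗ[R] M') :
    LinearMap.det (matrixAct k M B) = LinearMap.det (matrixAct k M' B) :=
  LinearMap.det_eq_of_comp_eq (LinearEquiv.piCongrRight fun _ => e.restrictScalars k)
    fun v => (matrixAct_comp B e.toLinearMap v).symm

theorem det_matrixAct_of_subsingleton [Subsingleton M] :
    LinearMap.det (matrixAct k M B) = 1 :=
  LinearMap.det_eq_one_of_subsingleton _

theorem eq_prod_of_succ_eq_mul {m : ℕ} (a : Fin (m + 1) → k) (b : Fin m → k) (h0 : a 0 = 1)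
    (h : ∀ i, a i.succ = a i.castSucc * b i) : a (Fin.last m) = ∏ i, b i := by
  induction m with
  | zero => rw [Fin.prod_univ_zero]; exact h0
  | succ m ih =>
    rw [Fin.prod_univ_castSucc, ← ih (fun i => a i.castSucc) (fun i => b i.castSucc) h0
      fun i => h i.castSucc]
    exact h (Fin.last m)

theorem det_matrixAct_pi {m : ℕ} {Q : Fin m → Type*} [∀ i, AddCommGroup (Q i)] [∀ i, Module k (Q i)]
    [∀ i, Module R (Q i)] [∀ i, IsScalarTower k R (Q i)] [∀ i, FiniteDimensional k (Q i)] :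
    LinearMap.det (matrixAct k (∀ i, Q i) B) = ∏ i, LinearMap.det (matrixAct k (Q i) B) := by
  induction m with
  | zero => rw [det_matrixAct_of_subsingleton, Fin.prod_univ_zero]
  | succ m ih =>
    let g : (∀ i, Q i) →ₗ[R] ∀ i : Fin m, Q i.succ := LinearMap.pi fun i => LinearMap.proj i.succ
    rw [Fin.prod_univ_succ, ← ih]
    refine det_matrixAct_of_exact (f := LinearMap.single R Q 0) (g := g) B
      (Pi.single_injective 0) (fun v => ⟨Fin.cons 0 v, rfl⟩) fun v => ⟨fun h => ?_, ?_⟩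
    · refine ⟨v 0, funext fun i => ?_⟩
      refine Fin.cases ?_ (fun i => ?_) i
      · simp
      · have h1 : v i.succ = 0 := congrFun h i
        rw [h1]
        simp
    · rintro ⟨x, rfl⟩
      exact funext fun i => by simp [g]

/-- Determinants are multiplicative in exact sequences, so only the graded pieces of the filtration
matter. -/
theorem det_matrixAct_eq_of_compositionSeries [FiniteDimensional k M]
    (s : CompositionSeries (Submodule R M)) (hbot : s.head = ⊥) (htop : s.last = ⊤) :
    LinearMap.det (matrixAct k M B) = LinearMap.det (matrixAct k
      ((i : Fin s.length) → (s i.succ) ⧸ (s i.castSucc).submoduleOf (s i.succ)) B) := by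
  have hfd : ∀ N : Submodule R M, FiniteDimensional k N := fun N =>
    inferInstanceAs (FiniteDimensional k (N.restrictScalars k))
  have hfdq : ∀ (N : Submodule R M) (N' : Submodule R N), FiniteDimensional k (N ⧸ N') := fun N N' =>
    Module.Finite.of_surjective (N'.mkQ.restrictScalars k) N'.mkQ_surjective
  have h0 : LinearMap.det (matrixAct k (s 0) B) = 1 := by
    have h0 : s 0 = ⊥ := hbot
    have : Subsingleton (s 0) := by
      rw [h0]
      infer_instance
    exact det_matrixAct_of_subsingleton B
  have hsucc : ∀ i : Fin s.length, LinearMap.det (matrixAct k (s i.succ) B) =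
      LinearMap.det (matrixAct k (s i.castSucc) B) * LinearMap.det (matrixAct k
        ((s i.succ) ⧸ (s i.castSucc).submoduleOf (s i.succ)) B) := by
    intro i
    have hle : s i.castSucc ≤ s i.succ := (s.step i).1.le
    exact det_matrixAct_of_exact (f := Submodule.inclusion hle)
      (g := ((s i.castSucc).submoduleOf (s i.succ)).mkQ) B (Submodule.inclusion_injective hle)
      (Submodule.mkQ_surjective _) (by
        rw [LinearMap.exact_iff, Submodule.ker_mkQ]
        exact (Submodule.range_inclusion _ _ hle).symm)
  have h1 := eq_prod_of_succ_eq_mul (fun i => LinearMap.det (matrixAct k (s i) B)) _ h0 hsucc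
  rw [det_matrixAct_pi, ← h1]
  have htop' : s (Fin.last s.length) = ⊤ := htop
  exact (det_matrixAct_of_equiv B (LinearEquiv.ofTop _ htop')).symm

end MatrixAction

namespace LParameter

variable {k G : Type*} [Field k] [Group G] {n m d : ℕ}

theorem det_matrixAct_asModule (ρ : G →* GL (Fin n) k) (B : Matrix (Fin d) (Fin d) k[G]) :
    LinearMap.det (matrixAct k (toRep ρ).asModule B) = (blockAct k d ρ B).det := by
  rw [← LinearMap.det_toLin']
  let e : (Fin d → (toRep ρ).asModule) ≃ₗ[k] (Fin d × Fin n → k) :=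
    (LinearEquiv.curry k k (Fin d) (Fin n)).symm
  refine LinearMap.det_eq_of_comp_eq e fun v => ?_
  funext x
  rw [Matrix.toLin'_apply, Matrix.mulVec, dotProduct, Fintype.sum_prod_type]
  change (matrixAct k (toRep ρ).asModule B v x.1 : Fin n → k) x.2 = _
  rw [matrixAct_apply]
  refine (Finset.sum_apply x.2 Finset.univ fun j => (B x.1 j • v j : Fin n → k)).trans ?_
  refine Finset.sum_congr rfl fun j _ => ?_
  exact congrFun (smul_asModule ρ (B x.1 j) (v j)) x.2

theorem det_blockAct_eq_of_isSemisimplification {ρ : G →* GL (Fin n) k} {σ : G →* GL (Fin m) k}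
    (h : (toRep ρ).IsSemisimplification (toRep σ)) (B : Matrix (Fin d) (Fin d) k[G]) :
    (blockAct k d ρ B).det = (blockAct k d σ B).det := by
  obtain ⟨s, hbot, htop, ⟨e⟩⟩ := h
  have : FiniteDimensional k (toRep ρ).asModule :=
    inferInstanceAs (FiniteDimensional k (Fin n → k))
  rw [← det_matrixAct_asModule, ← det_matrixAct_asModule,
    det_matrixAct_eq_of_compositionSeries B s hbot htop]
  exact (det_matrixAct_of_equiv B e).symm

end LParameter

/-! ### Uniqueness among parameters with given semisimplification -/

namespace LParameter

section Charpoly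

variable {k G : Type*} [Field k] [Group G] {n : ℕ}

theorem det_blockAct_fin_one (ρ : G →* GL (Fin n) k) (b : k[G]) :
    (blockAct k 1 ρ (Matrix.of fun _ _ => b)).det = (algAct k ρ b).det := by
  rw [← Matrix.det_submatrix_equiv_self (Equiv.uniqueProd (Fin n) (Fin 1)).symm]
  rfl

/-- Over an infinite field a characteristic polynomial is determined by its values, which are
determinants of the group algebra elements `c - b`. -/
theorem charpoly_algAct_eq_of_isSemisimplification [Infinite k] {ρ σ : G →* GL (Fin n) k}
    (h : (toRep ρ).IsSemisimplification (toRep σ)) (b : k[G]) :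
    (algAct k ρ b).charpoly = (algAct k σ b).charpoly := by
  refine Polynomial.funext fun c => ?_
  have key : ∀ τ : G →* GL (Fin n) k, Polynomial.eval c (algAct k τ b).charpoly =
      (blockAct k 1 τ (Matrix.of fun _ _ => algebraMap k k[G] c - b)).det := fun τ => by
    rw [det_blockAct_fin_one, Matrix.eval_charpoly, map_sub, AlgHom.commutes]
    rfl
  rw [key, key, det_blockAct_eq_of_isSemisimplification h]

end Charpoly

open WeilGroup

variable {p ℓ : ℕ} [Fact p.Prime] [Fact ℓ.Prime] {n : ℕ}

theorem isOpen_inf_wildInertia_subgroupOf {U : Subgroup (W p)} (hU : IsOpen (U : Set (W p))) :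
    IsOpen (((U ⊓ wildInertia p).subgroupOf (wildInertia p) : Subgroup (wildInertia p)) :
      Set (wildInertia p)) := by
  rw [Subgroup.inf_subgroupOf_right]
  exact hU.preimage continuous_subtype_val

/-- Both parameters are trivial on a common open subgroup of wild inertia, and all characterizing
invariants of `φ` are preserved by semisimplification. -/
theorem exists_conj_of_isSemisimplification (hℓp : ℓ ≠ p) {r : ℕ} {φ : W p →* GL (Fin n) (PadicAlgCl ℓ)}
    (hφ : IsLParameter (ℓ := ℓ) φ) {d : Fin r → ℕ}
    {φi : (i : Fin r) → W p →* GL (Fin (d i)) (PadicAlgCl ℓ)}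
    (hirr : ∀ i, (toRep (φi i)).IsIrreducible)
    (hsum : Nonempty ((toRep φ).Equiv (Representation.directSum fun i => toRep (φi i))))
    (hne : ∀ i j, i ≠ j → ¬ Nonempty ((toRep (φi i)).Equiv (toRep (φi j))))
    (htw : ∀ i j, i ≠ j →
      ¬ Nonempty ((toRep (φi i)).Equiv ((toRep (φi j)).charTwist (normChar p ℓ))))
    {φ' : W p →* GL (Fin n) (PadicAlgCl ℓ)} (hφ' : IsLParameter (ℓ := ℓ) φ')
    (hss : (toRep φ').IsSemisimplification (toRep φ)) :
    ∃ g : GL (Fin n) (PadicAlgCl ℓ), ∀ w, φ' w = g * φ w * g⁻¹ := by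
  obtain ⟨U, hU, hUφ⟩ := exists_open_trivial hℓp φ hφ
  obtain ⟨U', hU', hUφ'⟩ := exists_open_trivial hℓp φ' hφ'
  have hUU : IsOpen ((U ⊓ U' : Subgroup (W p)) : Set (W p)) := hU.inter hU'
  obtain ⟨D⟩ := nonempty_monodromyData (ℓ := ℓ) n _ (isOpen_inf_wildInertia_subgroupOf hUU)
  have hP : ∀ w ∈ U ⊓ U' ⊓ wildInertia p, φ w = 1 := fun w hw => hUφ w hw.1.1 hw.2
  have hP' : ∀ w ∈ U ⊓ U' ⊓ wildInertia p, φ' w = 1 := fun w hw => hUφ' w hw.1.2 hw.2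
  obtain ⟨b, B, hb, hb', hB, h⟩ := exists_characterizing_elements hφ hirr hsum hne htw hP D
  have h1 : resultantDet (normChar p ℓ) b φ' = 1 := by
    refine resultantDet_eq_one ?_ ?_
    · rw [← det_blockAct_fin_one, det_blockAct_eq_of_isSemisimplification hss,
        det_blockAct_fin_one, hb, Matrix.det_one]
    · rw [charpoly_algAct_eq_of_isSemisimplification hss, hb', Matrix.charpoly_zero, Fintype.card_fin]
  obtain ⟨g, hg⟩ := h (PadicAlgCl ℓ) φ' hφ' hP' (by rw [h1]; exact one_ne_zero)
    fun i => by rw [det_blockAct_eq_of_isSemisimplification hss, hB i]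
  exact ⟨g, hg⟩

end LParameter

end

/-! ### The theorem -/

theorem mainTheorem11 (p ℓ : ℕ) [Fact p.Prime] [Fact ℓ.Prime] (hℓp : ℓ ≠ p) (n r : ℕ)
    (φ : WeilGroup.W p →* GL (Fin n) (PadicAlgCl ℓ))
    (hφ : LParameter.IsLParameter (ℓ := ℓ) φ)
    (d : Fin r → ℕ)
    (φi : (i : Fin r) → WeilGroup.W p →* GL (Fin (d i)) (PadicAlgCl ℓ))
    (hirr : ∀ i, (LParameter.toRep (φi i)).IsIrreducible)
    (hsum : Nonempty ((LParameter.toRep φ).Equiv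
      (Representation.directSum fun i => LParameter.toRep (φi i))))
    (hne : ∀ i j, i ≠ j →
      ¬ Nonempty ((LParameter.toRep (φi i)).Equiv (LParameter.toRep (φi j))))
    (htw : ∀ i j, i ≠ j →
      ¬ Nonempty ((LParameter.toRep (φi i)).Equiv
        ((LParameter.toRep (φi j)).charTwist (WeilGroup.normChar p ℓ)))) :
    -- `φ` is the only L-parameter with semisimplification `φ`, up to conjugation
    (∀ φ' : WeilGroup.W p →* GL (Fin n) (PadicAlgCl ℓ), LParameter.IsLParameter (ℓ := ℓ) φ' →
      (LParameter.toRep φ').IsSemisimplification (LParameter.toRep φ) →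
      ∃ g : GL (Fin n) (PadicAlgCl ℓ), ∀ w, φ' w = g * φ w * g⁻¹) ∧
    -- `φ` lies in some `Z¹(W/P, GL_n)`, with `P` open in wild inertia
    (∃ P : Subgroup (WeilGroup.W p), P ≤ WeilGroup.wildInertia p ∧
      IsOpen ((P.subgroupOf (WeilGroup.wildInertia p) : Subgroup (WeilGroup.wildInertia p)) :
        Set (WeilGroup.wildInertia p)) ∧ ∀ w ∈ P, φ w = 1) ∧
    -- in each `Z¹(W/P, GL_n)` that contains `φ`:
    ∀ P : Subgroup (WeilGroup.W p), P ≤ WeilGroup.wildInertia p →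
      IsOpen ((P.subgroupOf (WeilGroup.wildInertia p) : Subgroup (WeilGroup.wildInertia p)) :
        Set (WeilGroup.wildInertia p)) →
      ∀ hP : ∀ w ∈ P, φ w = 1,
      Nonempty (LParameter.ModuliSpace ℓ n P) ∧
      ∀ X : LParameter.ModuliSpace ℓ n P,
        -- the fibre of `θ` through `φ` has only one geometric point
        (∀ (K : Type) [Field K] [Algebra (PadicAlgCl ℓ) K] [IsAlgClosed K]
          (f : X.R →ₐ[PadicAlgCl ℓ] K),
          (∀ a ∈ X.invariants, f a = algebraMap (PadicAlgCl ℓ) K (X.point φ hφ hP a)) →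
          X.Conj ((Algebra.ofId (PadicAlgCl ℓ) K).comp (X.point φ hφ hP)) f) ∧
        -- it is a single point of the stack, which is closed and smooth
        X.theta ⁻¹' {X.theta (X.stackPoint (X.point φ hφ hP))} =
          {X.stackPoint (X.point φ hφ hP)} ∧
        IsClosed {X.stackPoint (X.point φ hφ hP)} ∧
        X.SmoothAt (X.stackPoint (X.point φ hφ hP)) := by
  refine ⟨fun φ' hφ' hss => LParameter.exists_conj_of_isSemisimplification hℓp hφ hirr hsum hne htw
    hφ' hss, ?_, fun P hPw hPo hP => ?_⟩
  · obtain ⟨U, hU, hUφ⟩ := LParameter.exists_open_trivial hℓp φ hφ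
    exact ⟨U ⊓ WeilGroup.wildInertia p, inf_le_right,
      LParameter.isOpen_inf_wildInertia_subgroupOf hU, fun w hw => hUφ w hw.1 hw.2⟩
  · refine ⟨LParameter.nonempty_moduliSpace n P hPo, fun X => ?_⟩
    obtain ⟨D⟩ := LParameter.nonempty_monodromyData (ℓ := ℓ) n P hPo
    obtain ⟨b, B, hb, hb', hB, h⟩ :=
      LParameter.exists_characterizing_elements hφ hirr hsum hne htw hP D
    have h1 : LParameter.resultantDet (WeilGroup.normChar p ℓ) b φ = 1 :=
      LParameter.resultantDet_eq_one (by rw [hb, Matrix.det_one])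
        (by rw [hb', Matrix.charpoly_zero, Fintype.card_fin])
    have hpt : X.param (X.point φ hφ hP) = φ := X.param_point φ hφ hP
    have hfibre : ∀ (K : Type) [Field K] [Algebra (PadicAlgCl ℓ) K] [IsAlgClosed K]
        (f : X.R →ₐ[PadicAlgCl ℓ] K),
        (∀ a ∈ X.invariants, f a = algebraMap (PadicAlgCl ℓ) K (X.point φ hφ hP a)) →
        X.Conj ((Algebra.ofId (PadicAlgCl ℓ) K).comp (X.point φ hφ hP)) f := by
      intro K _ _ _ f hf
      -- The characterizing functions are invariant elements of `R`, so at `f` they take the values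
      -- they have at `φ`: `1` for the resultant, `0` for the determinants.
      obtain ⟨g, hg⟩ := h K (X.param f) (X.isLParameter_param f) (X.param_trivial_on f) (by
        rw [← X.apply_resultantDet, hf _ (X.resultantDet_mem_invariants _ b), X.apply_resultantDet,
          hpt, h1, map_one]
        exact one_ne_zero) fun i => by
        rw [← X.apply_det_blockAct, hf _ (X.det_blockAct_mem_invariants (B i)), X.apply_det_blockAct,
          hpt, hB i, map_zero]
      refine ⟨g, fun w => ?_⟩
      rw [hg, X.param_comp, hpt]
      rfl
    have htheta := LParameter.ModuliSpace.theta_fibre_eq (X.point φ hφ hP) hfibre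
    refine ⟨hfibre, htheta, LParameter.ModuliSpace.isClosed_stackPoint _ htheta,
      X.specPoint (X.point φ hφ hP), rfl,
      -- The smooth neighbourhood is the locus where this function, equal to `1` at `φ`, is
      -- invertible.
      LParameter.resultantDet (WeilGroup.normChar p ℓ) b X.univ, fun ha => ?_,
      X.smooth_away D hPw (D.resultantDet_smul_eq_zero X.isLParameter X.trivial_on b)⟩
    have h2 : X.point φ hφ hP (LParameter.resultantDet (WeilGroup.normChar p ℓ) b X.univ) = 0 := ha
    rw [X.apply_resultantDet, hpt, h1] at h2
    exact one_ne_zero h2
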